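/- **Protocol.** Finitely many nodes, some of them corrupted from the beginning, run the checkpointed longest chain protocol in continuous time, all nodes being online. Honest blocks are mined at the points of a Poisson process of rate $(1-\beta)\lambda$, adversarial blocks at the points of an independent Poisson process of rate $\beta\lambda$. Under partial synchrony the adversary chooses a stabilization time $T_{\mathrm{GST}}\ge 0$; honest nodes re-broadcast all they receive, and a message sent or received by an honest node at time $t$ reaches all honest nodes by time $\max(t,T_{\mathrm{GST}})+\Delta$. At every time each honest node holds a longest chain among the chains it has received that contain the last checkpoint it has heard of (ties are broken by the adversary), and honest miners extend the chain they hold and broadcast the new block at once. Adversarial blocks extend any earlier block. Checkpoints are produced by a multi-iteration variant of the Algorand Byzantine agreement among the checkpointers, fewer than one third of whom are corrupted. A *quorum* is a set of votes of at least two thirds of the checkpointers; values are chains, or $\perp$ for next-votes. Every period of every iteration has a leader, and the leaders are independent and uniform among the checkpointers. All checkpointers start period $1$ of iteration $1$ at time $0$; a checkpointer starts period $1$ of iteration $n+1$ a time $e$ after it has seen a quorum of cert-votes of one period of iteration $n$ for one value, and period $p+1$ of an iteration when it sees a quorum of next-votes for one value for period $p$ (this value is its starting value; in period $1$ it is $\perp$),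 unless it has started a later period or has halted the iteration. With the clock reset to $0$ at the start of a period $p$, an honest checkpointer acts as follows. Call the period *open* for it if $p=1$ or it has seen a quorum of next-votes for $\perp$ for period $p-1$. (1) At clock $0$ the leader proposes the chain it holds if the period is open, and otherwise the value $v\ne\perp$ that has a quorum of next-votes for period $p-1$. (2) At clock $2\Delta$ it soft-votes, if the period is open, one value $v$ proposed by the leader that is valid or has a quorum of next-votes for period $p-1$, and otherwise the $v\neq\perp$ that has such a quorum. Here $v$ is valid if its $k$-deep block (the one followed by exactly $k$ blocks) lies in the chain that the checkpointer held when it entered the period and is a proper descendant of all checkpoints of earlier iterations that it knows. (3) Between clock $2\Delta$ and $4\Delta$ (inclusive) it cert-votes a value for which it has seen a quorum of soft-votes of this period. (4) At clock $4\Delta$ it next-votes the value it has cert-voted; if there is none, it next-votes $\perp$ if it has seen a quorum of next-votes for $\perp$ for period $p-1$, and else its starting value. (5) Later, until it leaves the period, it next-votes a value once it has seen a quorum of soft-votes for it in this period, and next-votes $\perp$ if it has not cert-voted and has seen a quorum of next-votes for $\perp$ for period $p-1$. A checkpointer halts an iteration once it has seen a quorum of cert-votes of one period for one value $v$ in it;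 any node that sees such a quorum has heard of the checkpoint of this iteration, which is the $k$-deep block of $v$. Votes are signed, and votes of honest checkpointers cannot be forged. **Properties.** Slot $j$ is the time interval $((j-1)\Delta,j\Delta]$, and $\mathsf{GST}$ denotes the first slot that begins at or after $T_{\mathrm{GST}}$. The *$k$-common prefix property holds after slot $s$* if for any two chains $\mathcal C_1,\mathcal C_2$ held by honest nodes at times $t_1\le t_2$, with $t_1$ in a slot $>s$, the chain $\mathcal C_1$ without its last $k$ blocks is a prefix of $\mathcal C_2$. The *$(k,s)$-chain quality property holds after slot $s$* if in every chain held by an honest node in a slot $>s$, any $k$ consecutive blocks mined in slots $>s$ include an honest block. **Corollary.** Let $0\le\beta<1/2$ and $\lambda,\Delta>0$ be such that $\bar y>\lambda\Delta-\bar y$, where $\bar y=(1-\beta)\lambda\Delta\,e^{-3(1-\beta)\lambda\Delta}$. There are constants $C,c,K,K_0>0$, depending only on $\beta,\lambda,\Delta$, such that the following holds for every $a\in\mathbb N$ and all sufficiently large security parameters $\kappa\ge\kappa_0(a)$. Let the checkpoint depth $k$ satisfy $k\ge K_0\kappa$ (in particular, $k=\Theta(\kappa)$ with a large enough constant), let the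 inter-checkpoint interval satisfy $e\ge K\sqrt\kappa\,\Delta$, and let the execution have duration $T_{\max}\le\kappa^a$. Then, whatever the adversary does, with probability at least $1-e^{-c\sqrt\kappa}$ the $k$-common prefix property and the $(k,C\cdot\mathsf{GST})$-chain quality property hold after slot $C\cdot\mathsf{GST}$ (up to time $T_{\max}$). -/

import Mathlib

open MeasureTheory ProbabilityTheory Filter Topology

universe u v

namespace CLC

/-! ### Blocks, chains and messages -/

/-- A block is the genesis block or is identified by its miner type and its mining time. -/
inductive Block : Type
  | genesis : Block
  | honest (τ : ℝ) : Block
  | adversarial (τ : ℝ) : Block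

/-- Mining time (`0` for the genesis block). -/
def Block.time : Block → ℝ
  | .genesis => 0
  | .honest τ => τ
  | .adversarial τ => τ

/-- The block was mined by an honest node. -/
def Block.IsHonest : Block → Prop
  | .honest _ => True
  | _ => False

/-- A blockchain, listed from the genesis block to the tip. -/
abbrev Chain : Type := List Block

/-- Messages. Iterations `n` and periods `p` of the agreement protocol are numbered from `0`;
`i` is the (signed) sender; the value `none` of a next-vote is the empty value `⊥`. -/
inductive Msg (Node : Type u) : Type u
  | chain (c : Chain) : Msg Node
  | proposal (n p : ℕ) (i : Node) (v : Chain) : Msg Node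
  | soft (n p : ℕ) (i : Node) (v : Chain) : Msg Node
  | cert (n p : ℕ) (i : Node) (v : Chain) : Msg Node
  | next (n p : ℕ) (i : Node) (w : Option Chain) : Msg Node

/-- The blockchain that a message transports, if any. -/
def Msg.carries {Node : Type u} : Msg Node → Option Chain
  | .chain c => some c
  | .proposal _ _ _ v => some v
  | .soft _ _ _ v => some v
  | .cert _ _ _ v => some v
  | .next _ _ _ w => w

/-- The signer of a message, if it is signed. -/
def Msg.sender {Node : Type u} : Msg Node → Option Node
  | .chain _ => none
  | .proposal _ _ i _ => some i
  | .soft _ _ i _ => some i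
  | .cert _ _ i _ => some i
  | .next _ _ i _ => some i

/-! ### Parameters, oracle outputs and runs -/

/-- Parameters of the protocol: the nodes that are not corrupted, the checkpointers, the delay
bound `Δ`, the inter-checkpoint interval `e` and the checkpoint depth `k`. -/
structure Setting (Node : Type u) where
  honest : Set Node
  ckpt : Finset Node
  Δ : ℝ
  e : ℝ
  k : ℕ

/-- One outcome of the oracle: the mining times of honest and of adversarial blocks, and the
leader of each period of each iteration. -/
structure Oracle (Node : Type u) where
  honestTimes : Set ℝ
  advTimes : Set ℝ
  leader : ℕ → ℕ → Node

/-- The data of a run in continuous time. The rules that it has to obey are `Run.Admissible`. -/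
structure Run (Node : Type u) where
  /-- the global stabilization time -/
  gst : ℝ
  /-- the parent of each block -/
  parent : Block → Block
  /-- the honest node that mines the honest block of a given time -/
  miner : ℝ → Node
  /-- the time at which a node first receives a message (`⊤` if never) -/
  recv : Node → Msg Node → WithTop ℝ
  /-- the blockchain that a node holds at a given time -/
  chain : Node → ℝ → Chain
  /-- the time at which a checkpointer starts a period of an iteration (`⊤` if never) -/
  start : Node → ℕ → ℕ → WithTop ℝ
  /-- the starting value of a checkpointer for a period of an iteration -/
  startVal : Node → ℕ → ℕ → Option Chain
  /-- the value that a checkpointer soft-votes in a period of an iteration, if any -/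
  softVal : Node → ℕ → ℕ → Option Chain

section Rules

variable {Node : Type u} (S : Setting Node) (O : Oracle Node) (R : Run Node)

/-- The block exists in this outcome of the mining oracle. -/
def Mined : Block → Prop
  | .genesis => True
  | .honest τ => τ ∈ O.honestTimes
  | .adversarial τ => τ ∈ O.advTimes

/-- `c` is a blockchain all of whose blocks have been mined by time `t`. -/
def ValidChain (t : ℝ) (c : Chain) : Prop :=
  c.head? = some Block.genesis ∧
  c.IsChain (fun a b => b ≠ Block.genesis ∧ R.parent b = a) ∧
  ∀ b ∈ c, Mined O b ∧ (b = Block.genesis ∨ b.time ≤ t)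

/-- Node `h` has received the message `m` by time `t`. -/
def Knows (h : Node) (t : ℝ) (m : Msg Node) : Prop := R.recv h m ≤ (t : WithTop ℝ)

/-- Node `h` has received the blockchain `c` by time `t`. -/
def KnowsChain (h : Node) (t : ℝ) (c : Chain) : Prop :=
  ∃ m, Knows R h t m ∧ m.carries = some c

open Classical in
/-- At least two thirds of the checkpointers satisfy `Q`. -/
def Quorum (Q : Node → Prop) : Prop :=
  2 * S.ckpt.card ≤ 3 * (S.ckpt.filter Q).card

def SoftQuorum (h : Node) (t : ℝ) (n p : ℕ) (v : Chain) : Prop :=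
  Quorum S (fun i => Knows R h t (Msg.soft n p i v))

def CertQuorum (h : Node) (t : ℝ) (n p : ℕ) (v : Chain) : Prop :=
  Quorum S (fun i => Knows R h t (Msg.cert n p i v))

def NextQuorum (h : Node) (t : ℝ) (n p : ℕ) (w : Option Chain) : Prop :=
  Quorum S (fun i => Knows R h t (Msg.next n p i w))

/-- By time `t`, `h` has received a certificate for the output `v` of iteration `n`. -/
def Certified (h : Node) (t : ℝ) (n : ℕ) (v : Chain) : Prop :=
  ∃ p, CertQuorum S R h t n p v

/-- The block that is exactly `k`-deep in `v`, if `v` is long enough. -/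
def ckptBlock (v : Chain) : Option Block := (v.rdrop S.k).getLast?

/-- `c` contains the last checkpoint that `h` has heard of by time `t` (if any). -/
def ExtendsLast (h : Node) (t : ℝ) (c : Chain) : Prop :=
  ∀ n v, Certified S R h t n v → (∀ n' v', Certified S R h t n' v' → n' ≤ n) →
    ∀ B, ckptBlock S v = some B → B ∈ c

/-- `c` is a longest chain known to `h` at time `t` that extends the last checkpoint. -/
def IsCheckpointedLongest (h : Node) (t : ℝ) (c : Chain) : Prop :=
  KnowsChain R h t c ∧ ExtendsLast S R h t c ∧
  ∀ c', KnowsChain R h t c' → ExtendsLast S R h t c' → c'.length ≤ c.length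

/-- Period `p'` of iteration `n'` comes after period `p` of iteration `n`. -/
def Later (n p n' p' : ℕ) : Prop := n < n' ∨ (n = n' ∧ p < p')

/-- Checkpointer `i` has halted iteration `n` before time `t`. -/
def HaltedBefore (i : Node) (n : ℕ) (t : ℝ) : Prop :=
  ∃ u, u < t ∧ ∃ v, Certified S R i u n v

/-- Checkpointer `i` is in period `p` of iteration `n` at time `t`. At the very instant of leaving
a period it can still act in it. -/
def InPeriod (i : Node) (n p : ℕ) (t : ℝ) : Prop :=
  R.start i n p ≤ (t : WithTop ℝ) ∧
  (∀ n' p', Later n p n' p' → ¬ R.start i n' p' < (t : WithTop ℝ)) ∧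
  ¬ HaltedBefore S R i n t

/-- What `i` waits for before it starts period `p` of iteration `n`. -/
def Ready (i : Node) : ℕ → ℕ → ℝ → Prop
  | 0, 0, t => 0 ≤ t
  | n + 1, 0, t => ∃ v, Certified S R i (t - S.e) n v
  | n, q + 1, t => ∃ w, NextQuorum S R i t n q w

/-- By time `t`, `i` has received enough next-votes for `w` for the period before `p`. -/
def PrevNext (i : Node) (t : ℝ) (n p : ℕ) (w : Option Chain) : Prop :=
  ∃ q, p = q + 1 ∧ NextQuorum S R i t n q w

/-- New proposals are admitted: `p` is the first period, or `⊥` has enough next-votes for the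
period before `p`. -/
def Fresh (i : Node) (t : ℝ) (n p : ℕ) : Prop := p = 0 ∨ PrevNext S R i t n p none

/-- The proposed value `v` is VALID for `i` at time `t` in a period of iteration `n` that `i` has
entered at time `s`: its `k`-deep block is in the chain that `i` held at time `s`, and is a
descendant of all earlier checkpoints (`v.rdrop (k + 1)` are the proper ancestors of that block). -/
def ValidValue (i : Node) (s t : ℝ) (n : ℕ) (v : Chain) : Prop :=
  (∃ B, ckptBlock S v = some B ∧ B ∈ R.chain i s) ∧
  ∀ m, m < n → ∀ v', Certified S R i t m v' →
    ∀ B', ckptBlock S v' = some B' → B' ∈ v.rdrop (S.k + 1)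

/-- Step 2 (at clock `2Δ`): `i` may soft-vote `v` in period `p` of iteration `n`. -/
def SoftEligible (i : Node) (n p : ℕ) (v : Chain) : Prop :=
  ∃ s : ℝ, R.start i n p = (s : WithTop ℝ) ∧ InPeriod S R i n p (s + 2 * S.Δ) ∧
    ((Fresh S R i (s + 2 * S.Δ) n p ∧
        Knows R i (s + 2 * S.Δ) (Msg.proposal n p (O.leader n p) v) ∧
        (ValidValue S R i s (s + 2 * S.Δ) n v ∨
          PrevNext S R i (s + 2 * S.Δ) n p (some v))) ∨
      (¬ Fresh S R i (s + 2 * S.Δ) n p ∧ PrevNext S R i (s + 2 * S.Δ) n p (some v)))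

/-- Step 1 (at clock `0`): `i` proposes `v` at time `t`. -/
def Proposes (i : Node) (n p : ℕ) (v : Chain) (t : ℝ) : Prop :=
  O.leader n p = i ∧ R.start i n p = (t : WithTop ℝ) ∧
    ((Fresh S R i t n p ∧ v = R.chain i t) ∨
      (¬ Fresh S R i t n p ∧ PrevNext S R i t n p (some v)))

/-- Step 2: the soft-vote is cast at clock `2Δ`. -/
def SoftVotes (i : Node) (n p : ℕ) (v : Chain) (t : ℝ) : Prop :=
  ∃ s : ℝ, R.start i n p = (s : WithTop ℝ) ∧ t = s + 2 * S.Δ ∧ R.softVal i n p = some v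

/-- Step 3 (clock from `2Δ` to `4Δ`): `i` cert-votes a value with enough soft-votes. -/
def CertVotes (i : Node) (n p : ℕ) (v : Chain) (t : ℝ) : Prop :=
  InPeriod S R i n p t ∧ ∃ s : ℝ, R.start i n p = (s : WithTop ℝ) ∧
    s + 2 * S.Δ ≤ t ∧ t ≤ s + 4 * S.Δ ∧ SoftQuorum S R i t n p v

/-- `i` cert-votes `v` at some time in period `p` of iteration `n`. -/
def HasCertVoted (i : Node) (n p : ℕ) (v : Chain) : Prop := ∃ t, CertVotes S R i n p v t

/-- Step 4 (at clock `4Δ`) and Step 5 (later): `i` next-votes `w`. -/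
def NextVotes (i : Node) (n p : ℕ) (w : Option Chain) (t : ℝ) : Prop :=
  InPeriod S R i n p t ∧ ∃ s : ℝ, R.start i n p = (s : WithTop ℝ) ∧
    ((t = s + 4 * S.Δ ∧
        ((∃ v, HasCertVoted S R i n p v ∧ w = some v) ∨
          ((∀ v, ¬ HasCertVoted S R i n p v) ∧ PrevNext S R i t n p none ∧ w = none) ∨
          ((∀ v, ¬ HasCertVoted S R i n p v) ∧ ¬ PrevNext S R i t n p none ∧
            w = R.startVal i n p))) ∨
      (s + 4 * S.Δ < t ∧
        ((∃ v, SoftQuorum S R i t n p v ∧ w = some v) ∨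
          (PrevNext S R i t n p none ∧ (∀ v, ¬ HasCertVoted S R i n p v) ∧ w = none))))

/-- The protocol makes the honest checkpointer `i` send the signed message `m` at time `t`. -/
def Casts (i : Node) (t : ℝ) : Msg Node → Prop
  | .chain _ => False
  | .proposal n p j v => j = i ∧ Proposes S O R i n p v t
  | .soft n p j v => j = i ∧ SoftVotes S R i n p v t
  | .cert n p j v => j = i ∧ CertVotes S R i n p v t
  | .next n p j w => j = i ∧ NextVotes S R i n p w t

/-- The runs of the checkpointed longest chain protocol under partial synchrony, with all nodes
online. Whatever is not determined by these rules is up to the adversary: the stabilization time,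
message delays, the behaviour of corrupted nodes, the parents of adversarial blocks, the choice of
the honest miner, and all ties. -/
structure Run.Admissible : Prop where
  gst_nonneg : 0 ≤ R.gst
  /-- a block is mined after its parent -/
  parent_mined : ∀ b, b ≠ Block.genesis → Mined O b →
    Mined O (R.parent b) ∧ (R.parent b).time < b.time
  recv_nonneg : ∀ h m, 0 ≤ R.recv h m
  /-- honest nodes only take notice of chains of mined blocks -/
  recv_valid : ∀ h ∈ S.honest, ∀ t c, KnowsChain R h t c → ValidChain O R t c
  /-- everybody knows the genesis block from the beginning -/
  genesis_known : ∀ h ∈ S.honest, Knows R h 0 (Msg.chain [Block.genesis])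
  /-- honest nodes broadcast all they send or receive; this reaches the other honest nodes within
  `Δ`, or by `GST + Δ` if it was sent before `GST` -/
  network : ∀ h ∈ S.honest, ∀ h' ∈ S.honest, ∀ m,
    R.recv h' m ≤ max (R.recv h m) (R.gst : WithTop ℝ) + (S.Δ : WithTop ℝ)
  /-- an honest checkpointer sends every message that the protocol prescribes -/
  own_messages : ∀ i ∈ S.honest, i ∈ S.ckpt → ∀ t m, Casts S O R i t m → Knows R i t m
  /-- signed messages of honest nodes cannot be forged -/
  unforgeable : ∀ h ∈ S.honest, ∀ i ∈ S.honest, ∀ t m, m.sender = some i → Knows R h t m →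
    i ∈ S.ckpt ∧ ∃ t' ≤ t, Casts S O R i t' m
  /-- checkpointed longest chain rule -/
  chain_rule : ∀ h ∈ S.honest, ∀ t, 0 ≤ t → IsCheckpointedLongest S R h t (R.chain h t)
  miner_honest : ∀ τ ∈ O.honestTimes, R.miner τ ∈ S.honest
  /-- an honest block extends the chain that its miner holds just before the mining time, and is
  broadcast at once -/
  mining_rule : ∀ τ ∈ O.honestTimes, ∃ c : Chain,
    (∀ᶠ s in 𝓝[<] τ, R.chain (R.miner τ) s = c) ∧
    c.getLast? = some (R.parent (Block.honest τ)) ∧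
    Knows R (R.miner τ) τ (Msg.chain (c ++ [Block.honest τ]))
  /-- a period is started as soon as `Ready` holds, unless a later one has been started or the
  iteration has been halted -/
  start_rule : ∀ i ∈ S.honest, i ∈ S.ckpt → ∀ (n p : ℕ) (t : ℝ),
    R.start i n p = (t : WithTop ℝ) ↔
      IsLeast {x : ℝ | Ready S R i n p x} t ∧
      (∀ n' p', Later n p n' p' → ¬ R.start i n' p' ≤ (t : WithTop ℝ)) ∧
      ¬ HaltedBefore S R i n t
  /-- the starting value is `⊥` in the first period, and otherwise the value whose next-votes
  started the period -/
  startVal_rule : ∀ i ∈ S.honest, i ∈ S.ckpt → ∀ (n p : ℕ) (t : ℝ),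
    R.start i n p = (t : WithTop ℝ) →
      (p = 0 → R.startVal i n p = none) ∧
      (∀ q, p = q + 1 → NextQuorum S R i t n q (R.startVal i n p))
  /-- one eligible value is soft-voted if there is any -/
  softVal_rule : ∀ i ∈ S.honest, i ∈ S.ckpt → ∀ (n p : ℕ),
    (∀ v, R.softVal i n p = some v → SoftEligible S O R i n p v) ∧
    (R.softVal i n p = none → ∀ v, ¬ SoftEligible S O R i n p v)

/-! ### Security properties -/

/-- The slot that contains time `t`: slot `j` is the interval `((j - 1) Δ, j Δ]`. -/
noncomputable def slot (t : ℝ) : ℕ := ⌈t / S.Δ⌉₊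

/-- The first slot that begins at or after the global stabilization time. -/
noncomputable def gstSlot : ℕ := ⌈R.gst / S.Δ⌉₊ + 1

/-- The `k`-common prefix property after slot `s`, up to time `T`. -/
def CommonPrefixAfter (k : ℕ) (s T : ℝ) : Prop :=
  ∀ h₁ ∈ S.honest, ∀ h₂ ∈ S.honest, ∀ t₁ t₂ : ℝ, s < slot S t₁ → t₁ ≤ t₂ → t₂ ≤ T →
    (R.chain h₁ t₁).rdrop k <+: R.chain h₂ t₂

/-- The `(k, s)`-chain quality property after slot `s'`, up to time `T`: in chains held by honest
nodes, any `k` consecutive blocks mined after slot `s` include an honest block. -/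
def ChainQualityAfter (k : ℕ) (s s' T : ℝ) : Prop :=
  ∀ h ∈ S.honest, ∀ t : ℝ, s' < slot S t → t ≤ T →
    ∀ L : List Block, L <:+: R.chain h t → L.length = k →
      (∀ b ∈ L, b ≠ Block.genesis ∧ s < slot S b.time) → ∃ b ∈ L, b.IsHonest

end Rules

/-! ### Randomness -/

section Probability

variable {Ω : Type v} [MeasurableSpace Ω]

/-- The number of points in the interval `(a, b]`. -/
noncomputable def count (A : Ω → Set ℝ) (a b : ℝ) (ω : Ω) : ℕ := (A ω ∩ Set.Ioc a b).ncard

/-- `A` is the random set of arrival times of a Poisson process of rate `r` on `(0, ∞)`. -/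
structure IsPoissonProcess (μ : Measure Ω) (r : ℝ) (A : Ω → Set ℝ) : Prop where
  pos : ∀ ω, A ω ⊆ Set.Ioi 0
  locallyFinite : ∀ ω t, (A ω ∩ Set.Iic t).Finite
  measurable_count : ∀ a b, Measurable (count A a b)
  law : ∀ a b, 0 ≤ a → a ≤ b →
    μ.map (count A a b) = poissonMeasure (Real.toNNReal (r * (b - a)))
  indep_increments : ∀ x : ℕ → ℝ, 0 ≤ x 0 → Monotone x →
    iIndepFun (fun j => count A (x j) (x (j + 1))) μ

/-- The oracle: honest blocks arrive at rate `(1 - β) lam`, adversarial blocks independently at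
rate `β lam`, and the leaders of the periods are independent and uniform among checkpointers. -/
structure IsOracle {Node : Type u} (μ : Measure Ω) (S : Setting Node) (β lam : ℝ)
    (H A : Ω → Set ℝ) (ld : ℕ × ℕ → Ω → S.ckpt) : Prop where
  honest_poisson : IsPoissonProcess μ ((1 - β) * lam) H
  adv_poisson : IsPoissonProcess μ (β * lam) A
  indep : IndepFun (fun ω (x : ℝ × ℝ) => count H x.1 x.2 ω)
    (fun ω (x : ℝ × ℝ) => count A x.1 x.2 ω) μ
  ld_measurable : ∀ x i, MeasurableSet {ω | ld x ω = i}
  ld_uniform : ∀ x i, μ {ω | ld x ω = i} = (S.ckpt.card : ENNReal)⁻¹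
  ld_indep : iIndepFun (m := fun _ => ⊤) ld μ

/-- The outcome of the oracle at the sample point `ω`. -/
def oracleAt {Node : Type u} {S : Setting Node} (H A : Ω → Set ℝ) (ld : ℕ × ℕ → Ω → S.ckpt)
    (ω : Ω) : Oracle Node where
  honestTimes := H ω
  advTimes := A ω
  leader n p := (ld (n, p) ω : Node)

end Probability

/-- The probability that a slot is a convergence opportunity: one honest block is mined in the
slot and none in the two adjacent slots. -/
noncomputable def ybar (β lam Δ : ℝ) : ℝ :=
  (1 - β) * lam * Δ * Real.exp (-3 * ((1 - β) * lam * Δ))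

end CLC

open CLC

namespace CLC

section

variable {Node : Type u} {S : Setting Node} {O : Oracle Node} {R : Run Node}

/-! The adversary is confined to a deterministic statement. `Typical` is a property of the oracle
outcome alone, `Typical.secure` shows that in a typical outcome every admissible run is secure, and
`typical_prob` bounds the probability of the remaining outcomes by a union bound over polynomially
many events.

Without checkpoints the argument is the classical one. An honest block with no other honest block
within `Δ` of it (a convergence opportunity) is the only one of its kind at its height, and from `Δ`
later on all honest chains are longer than that height. Suppose that two honest chains disagree
about an old block, or that a long stretch of an honest chain has no honest block. Then each
opportunity since the last relevant good block is matched by a different block at the same height,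
so at least twice as many blocks as opportunities were mined (`Settled.two_mul_good_le`). The
assumption on `ybar` excludes this on long intervals (`Settled.dominant`), which gives
`Dominant.mem_step`, `Dominant.common_prefix` and `Dominant.chain_quality`.

Checkpoints disturb this picture, because a new checkpoint can force a node onto a shorter chain.
The remedy is that certified values are recent. After stabilization periods last at most `7Δ`, so
within `M` periods there is one with an honest leader. If it does not decide the iteration, then `⊥`
had a quorum of next-votes in the period before (`Fair.honest_leader`). Hence no earlier period has
certified anything (`Fair.certQuorum_lock`), and what is certified later lies on a chain that an
honest node held in this period or a later one (`Fair.certified_fresh`). So the checkpoint was on an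
honest chain at most `W = 7Δ(M + 2)` before the decision, and only opportunities in a window of
length about `W` around a decision are lost; at all other times honest chains keep growing
(`Settled.growth`). Decisions are at least `e` apart. With `M = ⌈√κ⌉` and `e ≥ K√κΔ` only a small
fraction is lost, while `M` corrupted leaders in a row have probability at most `3^(-M)`; this is
the source of the error `exp(-c√κ)`.

Recency can fail for one iteration, whose predecessor was decided before stabilization, if `e` is
huge compared with the stabilization time. But then there was a long calm stretch without any
decision, in which dominance already holds and keeps the old checkpoint candidate in all honest
chains. This bootstrap is `Typical.settled`. -/

/-- An admissible run with fewer than one third of the checkpointers corrupted. -/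
structure Fair (S : Setting Node) (O : Oracle Node) (R : Run Node) : Prop where
  adm : R.Admissible S O
  bad : 3 * {i ∈ (S.ckpt : Set Node) | i ∉ S.honest}.ncard < S.ckpt.card
  Δ_pos : 0 < S.Δ
  e_pos : 0 < S.e

/-- Some honest node has received a certificate for iteration `n` by time `t`. -/
def Decided (S : Setting Node) (R : Run Node) (n : ℕ) (t : ℝ) : Prop :=
  ∃ h ∈ S.honest, ∃ v, Certified S R h t n v

/-! ### Quorums -/

theorem Quorum.mono {Q Q' : Node → Prop} (h : Quorum S Q) (hQ : ∀ i, Q i → Q' i) :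
    Quorum S Q' := by
  classical
  unfold Quorum at *
  refine h.trans (Nat.mul_le_mul_left 3 (Finset.card_le_card ?_))
  intro i hi
  simp only [Finset.mem_filter] at hi ⊢
  exact ⟨hi.1, hQ i hi.2⟩

open Classical in
theorem Fair.bad_filter (E : Fair S O R) :
    3 * (S.ckpt.filter (fun i => i ∉ S.honest)).card < S.ckpt.card := by
  have h := E.bad
  have : {i ∈ (S.ckpt : Set Node) | i ∉ S.honest}
      = ((S.ckpt.filter (fun i => i ∉ S.honest) : Finset Node) : Set Node) := by
    ext i; simp
  rwa [this, Set.ncard_coe_finset] at h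

/-- Two sets of two thirds overlap in at least one third of the checkpointers, more than are
corrupted. All safety arguments rest on this common honest voter. -/
theorem Fair.quorum_inter (E : Fair S O R) {Q Q' : Node → Prop} (h : Quorum S Q)
    (h' : Quorum S Q') : ∃ i ∈ S.honest, i ∈ S.ckpt ∧ Q i ∧ Q' i := by
  classical
  have hb := E.bad_filter
  unfold Quorum at h h'
  by_contra hcon
  push Not at hcon
  have h1 := Finset.card_union_add_card_inter (S.ckpt.filter Q) (S.ckpt.filter Q')
  have h2 : ((S.ckpt.filter Q) ∪ (S.ckpt.filter Q')).card ≤ S.ckpt.card := by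
    apply Finset.card_le_card
    intro i hi
    simp only [Finset.mem_union, Finset.mem_filter] at hi
    tauto
  have h3 : ((S.ckpt.filter Q) ∩ (S.ckpt.filter Q')).card
      ≤ (S.ckpt.filter (fun i => i ∉ S.honest)).card := by
    apply Finset.card_le_card
    intro i hi
    simp only [Finset.mem_inter, Finset.mem_filter] at hi ⊢
    refine ⟨hi.1.1, fun hh => hcon i hh hi.1.1 hi.1.2 hi.2.2⟩
  omega

theorem Fair.quorum_honest (E : Fair S O R) {Q : Node → Prop} (h : Quorum S Q) :
    ∃ i ∈ S.honest, i ∈ S.ckpt ∧ Q i := by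
  obtain ⟨i, h1, h2, h3, -⟩ := E.quorum_inter h h
  exact ⟨i, h1, h2, h3⟩

/-- The liveness counterpart: the honest checkpointers alone form a quorum. -/
theorem Fair.quorum_of_honest (E : Fair S O R) {Q : Node → Prop}
    (h : ∀ i ∈ S.honest, i ∈ S.ckpt → Q i) : Quorum S Q := by
  classical
  have hb := E.bad_filter
  unfold Quorum
  have h1 : (S.ckpt.filter (fun i => i ∉ S.honest)).card + (S.ckpt.filter Q).card
      ≥ S.ckpt.card := by
    rw [← Finset.card_filter_add_card_filter_not (s := S.ckpt) (fun i => i ∈ S.honest), add_comm]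
    refine Nat.add_le_add_right (Finset.card_le_card ?_) _
    intro i hi
    simp only [Finset.mem_filter] at hi ⊢
    exact ⟨hi.1, h i hi.2 hi.1⟩
  omega

theorem Fair.exists_honest (E : Fair S O R) : ∃ i ∈ S.honest, i ∈ S.ckpt := by
  obtain ⟨i, h1, h2, -⟩ := E.quorum_honest (Q := fun _ => True)
    (E.quorum_of_honest (fun _ _ _ => trivial))
  exact ⟨i, h1, h2⟩

/-! ### Knowledge -/

theorem Knows.mono {h : Node} {t t' : ℝ} {m : Msg Node} (hk : Knows R h t m) (htt : t ≤ t') :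
    Knows R h t' m :=
  le_trans hk (WithTop.coe_le_coe.2 htt)

theorem SoftQuorum.mono {h : Node} {t t' : ℝ} {n p : ℕ} {v : Chain}
    (hk : SoftQuorum S R h t n p v) (htt : t ≤ t') : SoftQuorum S R h t' n p v :=
  Quorum.mono hk fun _ hi => hi.mono htt

theorem CertQuorum.mono {h : Node} {t t' : ℝ} {n p : ℕ} {v : Chain}
    (hk : CertQuorum S R h t n p v) (htt : t ≤ t') : CertQuorum S R h t' n p v :=
  Quorum.mono hk fun _ hi => hi.mono htt

theorem NextQuorum.mono {h : Node} {t t' : ℝ} {n p : ℕ} {w : Option Chain}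
    (hk : NextQuorum S R h t n p w) (htt : t ≤ t') : NextQuorum S R h t' n p w :=
  Quorum.mono hk fun _ hi => hi.mono htt

theorem PrevNext.mono {h : Node} {t t' : ℝ} {n p : ℕ} {w : Option Chain}
    (hk : PrevNext S R h t n p w) (htt : t ≤ t') : PrevNext S R h t' n p w := by
  obtain ⟨q, hq, hn⟩ := hk
  exact ⟨q, hq, hn.mono htt⟩

theorem Certified.mono {h : Node} {t t' : ℝ} {n : ℕ} {v : Chain}
    (hk : Certified S R h t n v) (htt : t ≤ t') : Certified S R h t' n v := by
  obtain ⟨q, hn⟩ := hk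
  exact ⟨q, hn.mono htt⟩

theorem Decided.mono {t t' : ℝ} {n : ℕ} (hk : Decided S R n t) (htt : t ≤ t') :
    Decided S R n t' := by
  obtain ⟨h, hh, v, hv⟩ := hk
  exact ⟨h, hh, v, hv.mono htt⟩

theorem Fair.knows_relay (E : Fair S O R) {h h' : Node} (hh : h ∈ S.honest) (hh' : h' ∈ S.honest)
    {t t' : ℝ} {m : Msg Node} (hk : Knows R h t m) (ht : t + S.Δ ≤ t') (hg : R.gst + S.Δ ≤ t') :
    Knows R h' t' m := by
  have h1 := E.adm.network h hh h' hh' m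
  refine h1.trans ?_
  have h2 : max (R.recv h m) (R.gst : WithTop ℝ) ≤ ((t' - S.Δ : ℝ) : WithTop ℝ) := by
    refine max_le (le_trans hk ?_) ?_
    · exact WithTop.coe_le_coe.2 (by linarith)
    · exact WithTop.coe_le_coe.2 (by linarith)
  calc _ ≤ ((t' - S.Δ : ℝ) : WithTop ℝ) + (S.Δ : WithTop ℝ) := by gcongr
    _ = ((t' : ℝ) : WithTop ℝ) := by
      rw [← WithTop.coe_add]; congr 1; ring

theorem Fair.knowsChain_relay (E : Fair S O R) {h h' : Node} (hh : h ∈ S.honest)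
    (hh' : h' ∈ S.honest) {t t' : ℝ} {c : Chain} (hk : KnowsChain R h t c) (ht : t + S.Δ ≤ t')
    (hg : R.gst + S.Δ ≤ t') : KnowsChain R h' t' c := by
  obtain ⟨m, hm, hc⟩ := hk
  exact ⟨m, E.knows_relay hh hh' hm ht hg, hc⟩

theorem Fair.softQuorum_relay (E : Fair S O R) {h h' : Node} (hh : h ∈ S.honest)
    (hh' : h' ∈ S.honest) {t t' : ℝ} {n p : ℕ} {v : Chain} (hk : SoftQuorum S R h t n p v)
    (ht : t + S.Δ ≤ t') (hg : R.gst + S.Δ ≤ t') : SoftQuorum S R h' t' n p v :=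
  Quorum.mono hk fun _ hi => E.knows_relay hh hh' hi ht hg

theorem Fair.nextQuorum_relay (E : Fair S O R) {h h' : Node} (hh : h ∈ S.honest)
    (hh' : h' ∈ S.honest) {t t' : ℝ} {n p : ℕ} {w : Option Chain}
    (hk : NextQuorum S R h t n p w)
    (ht : t + S.Δ ≤ t') (hg : R.gst + S.Δ ≤ t') : NextQuorum S R h' t' n p w :=
  Quorum.mono hk fun _ hi => E.knows_relay hh hh' hi ht hg

theorem Fair.prevNext_relay (E : Fair S O R) {h h' : Node} (hh : h ∈ S.honest)
    (hh' : h' ∈ S.honest) {t t' : ℝ} {n p : ℕ} {w : Option Chain} (hk : PrevNext S R h t n p w)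
    (ht : t + S.Δ ≤ t') (hg : R.gst + S.Δ ≤ t') : PrevNext S R h' t' n p w := by
  obtain ⟨q, hq, hn⟩ := hk
  exact ⟨q, hq, E.nextQuorum_relay hh hh' hn ht hg⟩

theorem Fair.certified_relay (E : Fair S O R) {h h' : Node} (hh : h ∈ S.honest)
    (hh' : h' ∈ S.honest) {t t' : ℝ} {n : ℕ} {v : Chain} (hk : Certified S R h t n v)
    (ht : t + S.Δ ≤ t') (hg : R.gst + S.Δ ≤ t') : Certified S R h' t' n v := by
  obtain ⟨q, hn⟩ := hk
  exact ⟨q, Quorum.mono hn fun _ hi => E.knows_relay hh hh' hi ht hg⟩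

theorem Fair.decided_relay (E : Fair S O R) {h' : Node}
    (hh' : h' ∈ S.honest) {t t' : ℝ} {n : ℕ} (hk : Decided S R n t)
    (ht : t + S.Δ ≤ t') (hg : R.gst + S.Δ ≤ t') : ∃ v, Certified S R h' t' n v := by
  obtain ⟨h, hh, v, hv⟩ := hk
  exact ⟨v, E.certified_relay hh hh' hv ht hg⟩

/-! ### Votes of honest checkpointers -/

theorem Fair.softQuorum_voter (E : Fair S O R) {h : Node} (hh : h ∈ S.honest) {t : ℝ} {n p : ℕ}
    {v : Chain} (hq : SoftQuorum S R h t n p v) :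
    ∃ j ∈ S.honest, j ∈ S.ckpt ∧ ∃ t' ≤ t, SoftVotes S R j n p v t' := by
  obtain ⟨j, hj, hjc, hk⟩ := E.quorum_honest hq
  obtain ⟨-, t', ht', -, hc⟩ := E.adm.unforgeable h hh j hj t _ rfl hk
  exact ⟨j, hj, hjc, t', ht', hc⟩

/-- A common honest voter has a single `softVal` in the period, and its votes cannot be forged. -/
theorem Fair.softQuorum_unique (E : Fair S O R) {h h' : Node} (hh : h ∈ S.honest)
    (hh' : h' ∈ S.honest) {t t' : ℝ} {n p : ℕ}
    {v v' : Chain} (hq : SoftQuorum S R h t n p v) (hq' : SoftQuorum S R h' t' n p v') :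
    v = v' := by
  obtain ⟨j, hj, hjc, hk, hk'⟩ := E.quorum_inter hq hq'
  obtain ⟨-, x, -, -, s, -, -, hc⟩ := E.adm.unforgeable h hh j hj t _ rfl hk
  obtain ⟨-, x', -, -, s', -, -, hc'⟩ := E.adm.unforgeable h' hh' j hj t' _ rfl hk'
  rw [hc] at hc'
  exact Option.some.inj hc'

theorem Fair.hasCertVoted_unique (E : Fair S O R) {i j : Node} (hi : i ∈ S.honest)
    (hj : j ∈ S.honest) {n p : ℕ} {v v' : Chain} (hv : HasCertVoted S R i n p v)
    (hv' : HasCertVoted S R j n p v') : v = v' := by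
  obtain ⟨t, -, s, -, -, -, hq⟩ := hv
  obtain ⟨t', -, s', -, -, -, hq'⟩ := hv'
  exact E.softQuorum_unique hi hj hq hq'

/-- An honest next-vote for a chain comes from a quorum of soft-votes or from the starting
value. -/
theorem nextVotes_some {i : Node} {n p : ℕ} {v : Chain} {t : ℝ}
    (h : NextVotes S R i n p (some v) t) :
    SoftQuorum S R i t n p v ∨
      ∃ s : ℝ, R.start i n p = (s : WithTop ℝ) ∧ t = s + 4 * S.Δ ∧
        ¬ PrevNext S R i (s + 4 * S.Δ) n p none ∧ R.startVal i n p = some v := by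
  obtain ⟨-, s, hs, ⟨rfl, h⟩ | ⟨-, h⟩⟩ := h
  · rcases h with ⟨v', ⟨t', -, s', hs', -, ht', hq⟩, hv⟩ | ⟨-, -, h⟩ | ⟨-, h1, h2⟩
    · rw [hs] at hs'
      obtain rfl := WithTop.coe_inj.1 hs'
      obtain rfl := Option.some.inj hv
      exact Or.inl (hq.mono ht')
    · simp at h
    · exact Or.inr ⟨s, hs, rfl, h1, h2.symm⟩
  · rcases h with ⟨v', hq, hv⟩ | ⟨-, -, h⟩
    · obtain rfl := Option.some.inj hv
      exact Or.inl hq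
    · simp at h

/-- An honest next-vote for `⊥` in a period after the first one needs a quorum for `⊥` in the
period before. -/
theorem Fair.nextVotes_none (E : Fair S O R) {i : Node} (hi : i ∈ S.honest) (hic : i ∈ S.ckpt)
    {n p : ℕ} {t : ℝ} (h : NextVotes S R i n (p + 1) none t) :
    NextQuorum S R i t n p none := by
  have key : ∀ {t : ℝ}, PrevNext S R i t n (p + 1) none → NextQuorum S R i t n p none := by
    rintro t ⟨q, hq, hn⟩
    obtain rfl : p = q := by omega
    exact hn
  obtain ⟨-, s, hs, ⟨rfl, h⟩ | ⟨-, h⟩⟩ := h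
  · rcases h with ⟨v', -, hv⟩ | ⟨-, h, -⟩ | ⟨-, h1, h2⟩
    · simp at hv
    · exact key h
    · have := (E.adm.startVal_rule i hi hic n (p + 1) s hs).2 p rfl
      rw [← h2] at this
      exact this.mono (by linarith [E.Δ_pos])
  · rcases h with ⟨v', -, hv⟩ | ⟨h, -, -⟩
    · simp at hv
    · exact key h

theorem nextVotes_no_cert {i : Node} {n p : ℕ} {t : ℝ}
    (h : NextVotes S R i n p none t) : ∀ v, ¬ HasCertVoted S R i n p v := by
  obtain ⟨-, s, hs, ⟨rfl, h⟩ | ⟨-, h⟩⟩ := h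
  · rcases h with ⟨v', -, hv⟩ | ⟨h, -, -⟩ | ⟨h, -, -⟩
    · simp at hv
    · exact h
    · exact h
  · rcases h with ⟨v', -, hv⟩ | ⟨-, h, -⟩
    · simp at hv
    · exact h

theorem nextVotes_start {i : Node} {n p : ℕ} {w : Option Chain} {t : ℝ}
    (h : NextVotes S R i n p w t) :
    ∃ s : ℝ, R.start i n p = (s : WithTop ℝ) ∧ s + 4 * S.Δ ≤ t := by
  obtain ⟨-, s, hs, ⟨rfl, -⟩ | ⟨h, -⟩⟩ := h
  · exact ⟨s, hs, le_rfl⟩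
  · exact ⟨s, hs, h.le⟩

theorem Fair.nextQuorum_voter (E : Fair S O R) {h : Node} (hh : h ∈ S.honest) {t : ℝ} {n p : ℕ}
    {w : Option Chain} (hq : NextQuorum S R h t n p w) :
    ∃ j ∈ S.honest, j ∈ S.ckpt ∧ ∃ t' ≤ t, NextVotes S R j n p w t' := by
  obtain ⟨j, hj, hjc, hk⟩ := E.quorum_honest hq
  obtain ⟨-, t', ht', -, hc⟩ := E.adm.unforgeable h hh j hj t _ rfl hk
  exact ⟨j, hj, hjc, t', ht', hc⟩

theorem Fair.certQuorum_voter (E : Fair S O R) {h : Node} (hh : h ∈ S.honest) {t : ℝ} {n p : ℕ}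
    {v : Chain} (hq : CertQuorum S R h t n p v) :
    ∃ j ∈ S.honest, j ∈ S.ckpt ∧ ∃ t' ≤ t, CertVotes S R j n p v t' := by
  obtain ⟨j, hj, hjc, hk⟩ := E.quorum_honest hq
  obtain ⟨-, t', ht', -, hc⟩ := E.adm.unforgeable h hh j hj t _ rfl hk
  exact ⟨j, hj, hjc, t', ht', hc⟩

theorem Fair.startVal_prev (E : Fair S O R) {i : Node} (hi : i ∈ S.honest) (hic : i ∈ S.ckpt)
    {n p : ℕ} {s : ℝ} {v : Chain} (hs : R.start i n p = (s : WithTop ℝ))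
    (hv : R.startVal i n p = some v) : PrevNext S R i s n p (some v) := by
  obtain ⟨h1, h2⟩ := E.adm.startVal_rule i hi hic n p s hs
  cases p with
  | zero => rw [h1 rfl] at hv; simp at hv
  | succ q => exact ⟨q, rfl, hv ▸ h2 q rfl⟩

/-- What an honest soft-vote relies on. -/
theorem Fair.softVotes_cases (E : Fair S O R) {i : Node} (hi : i ∈ S.honest) (hic : i ∈ S.ckpt)
    {n p : ℕ} {v : Chain} {t : ℝ} (h : SoftVotes S R i n p v t) :
    ∃ s : ℝ, R.start i n p = (s : WithTop ℝ) ∧ t = s + 2 * S.Δ ∧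
    ((Fresh S R i t n p ∧ Knows R i t (Msg.proposal n p (O.leader n p) v) ∧
        (ValidValue S R i s t n v ∨ PrevNext S R i t n p (some v))) ∨
      (¬ Fresh S R i t n p ∧ PrevNext S R i t n p (some v))) := by
  obtain ⟨s, hs, rfl, hv⟩ := h
  obtain ⟨s', hs', -, h⟩ := (E.adm.softVal_rule i hi hic n p).1 v hv
  rw [hs] at hs'
  obtain rfl := WithTop.coe_inj.1 hs'
  exact ⟨s, hs, rfl, h⟩

/-! ### Agreement -/

/-- Honest next-votes for chains come from soft-quorums, which are unique, or from starting values,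
which had a quorum one period earlier. Induction on the period settles the mixed cases. The value
`⊥` may well have a quorum besides the unique chain. -/
theorem Fair.nextQuorum_some_unique (E : Fair S O R) {n p : ℕ} :
    ∀ {h h' : Node} (_ : h ∈ S.honest) (_ : h' ∈ S.honest) {t t' : ℝ}
    {v v' : Chain} (_ : NextQuorum S R h t n p (some v))
    (_ : NextQuorum S R h' t' n p (some v')), v = v' := by
  induction p with
  | zero =>
    intro h h' hh hh' t t' v v' hq hq'
    have key : ∀ {h : Node} (_ : h ∈ S.honest) {t : ℝ} {v : Chain}
        (_ : NextQuorum S R h t n 0 (some v)), ∃ j ∈ S.honest, ∃ t, SoftQuorum S R j t n 0 v := by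
      intro h hh t v hq
      obtain ⟨j, hj, hjc, t', -, hn⟩ := E.nextQuorum_voter hh hq
      rcases nextVotes_some hn with h1 | ⟨s, hs, -, -, h1⟩
      · exact ⟨j, hj, t', h1⟩
      · rw [(E.adm.startVal_rule j hj hjc n 0 s hs).1 rfl] at h1
        simp at h1
    obtain ⟨j, hj, x, hx⟩ := key hh hq
    obtain ⟨j', hj', x', hx'⟩ := key hh' hq'
    exact E.softQuorum_unique hj hj' hx hx'
  | succ p ih =>
    -- A common voter that next-votes its starting value has not seen `⊥` win by clock `4Δ`, so at
    -- clock `2Δ` it was bound to soft-vote a value with a quorum in the period before. The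
    -- induction hypothesis identifies the two.
    have key : ∀ {h h' : Node} (_ : h ∈ S.honest) (_ : h' ∈ S.honest) {t t' : ℝ} {v v' : Chain}
        (_ : NextQuorum S R h t n (p + 1) (some v)) (_ : SoftQuorum S R h' t' n (p + 1) v'),
        v = v' := by
      intro h h' hh hh' t t' v v' hq hq'
      obtain ⟨j, hj, hjc, hk, hk'⟩ := E.quorum_inter hq hq'
      obtain ⟨-, x, -, -, hc⟩ := E.adm.unforgeable h hh j hj t _ rfl hk
      obtain ⟨-, x', -, -, hc'⟩ := E.adm.unforgeable h' hh' j hj t' _ rfl hk'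
      rcases nextVotes_some hc with h1 | ⟨s, hs, -, hnp, h1⟩
      · exact E.softQuorum_unique hj hh' h1 hq'
      · have hpv := E.startVal_prev hj hjc hs h1
        obtain ⟨s', hs', rfl, h2⟩ := E.softVotes_cases hj hjc hc'
        rw [hs] at hs'
        obtain rfl := WithTop.coe_inj.1 hs'
        have h3 : PrevNext S R j (s + 2 * S.Δ) n (p + 1) (some v') := by
          rcases h2 with ⟨hf, -⟩ | ⟨-, h2⟩
          · rcases hf with hf | hf
            · omega
            · exact absurd (hf.mono (by linarith [E.Δ_pos])) hnp
          · exact h2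
        obtain ⟨q, hq1, hq2⟩ := h3
        obtain ⟨q', hq1', hq2'⟩ := hpv
        obtain rfl : p = q := by omega
        obtain rfl : p = q' := by omega
        exact ih hj hj hq2' hq2
    intro h h' hh hh' t t' v v' hq hq'
    obtain ⟨j, hj, hjc, hk, hk'⟩ := E.quorum_inter hq hq'
    obtain ⟨-, x, -, -, hc⟩ := E.adm.unforgeable h hh j hj t _ rfl hk
    obtain ⟨-, x', -, -, hc'⟩ := E.adm.unforgeable h' hh' j hj t' _ rfl hk'
    rcases nextVotes_some hc with h1 | ⟨s, hs, -, hnp, h1⟩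
    · exact (key hh' hj hq' h1).symm
    · rcases nextVotes_some hc' with h1' | ⟨s', hs', -, hnp', h1'⟩
      · exact key hh hj hq h1'
      · rw [h1] at h1'
        exact Option.some.inj h1'

theorem Fair.prevNext_some_unique (E : Fair S O R) {n p : ℕ} {h h' : Node} (hh : h ∈ S.honest)
    (hh' : h' ∈ S.honest) {t t' : ℝ} {v v' : Chain} (hq : PrevNext S R h t n p (some v))
    (hq' : PrevNext S R h' t' n p (some v')) : v = v' := by
  obtain ⟨q, hq1, hq2⟩ := hq
  obtain ⟨q', hq1', hq2'⟩ := hq'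
  obtain rfl : q = q' := by omega
  exact E.nextQuorum_some_unique hh hh' hq2 hq2'

/-- After a quorum of cert-votes for `v`, only `v` can get a quorum of next-votes. -/
theorem Fair.certQuorum_lock (E : Fair S O R) {n p : ℕ} {g : Node} (hg : g ∈ S.honest) {x : ℝ}
    {v : Chain} (hc : CertQuorum S R g x n p v) (d : ℕ) :
    ∀ {h : Node} (_ : h ∈ S.honest) {t : ℝ} {w : Option Chain}
    (_ : NextQuorum S R h t n (p + d) w), w = some v := by
  induction d with
  | zero =>
    intro h hh t w hq
    obtain ⟨j, hj, hjc, hk, hk'⟩ := E.quorum_inter hq hc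
    obtain ⟨-, y, -, -, hn⟩ := E.adm.unforgeable h hh j hj t _ rfl hk
    obtain ⟨-, y', -, -, hv⟩ := E.adm.unforgeable g hg j hj x _ rfl hk'
    cases w with
    | none => exact absurd ⟨y', hv⟩ (nextVotes_no_cert hn v)
    | some v' =>
      rcases nextVotes_some hn with h1 | ⟨s, hs, rfl, hnp, h1⟩
      · obtain ⟨-, -, -, -, -, h2⟩ := hv
        rw [E.softQuorum_unique hj hj h1 h2]
      · obtain ⟨-, s', hs', h2⟩ := hn
        rw [hs] at hs'
        obtain rfl := WithTop.coe_inj.1 hs'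
        rcases h2 with ⟨-, ⟨v'', h3, h4⟩ | ⟨h3, -⟩ | ⟨h3, -⟩⟩ | ⟨h3, -⟩
        · obtain rfl := Option.some.inj h4
          rw [E.hasCertVoted_unique hj hj h3 ⟨y', hv⟩]
        · exact absurd ⟨y', hv⟩ (h3 v)
        · exact absurd ⟨y', hv⟩ (h3 v)
        · exact absurd h3 (lt_irrefl _)
  | succ d ih =>
    intro h hh t w hq
    rw [← add_assoc] at hq
    obtain ⟨j, hj, hjc, t', ht', hn⟩ := E.nextQuorum_voter hh hq
    have hprev : ∀ {i : Node} (_ : i ∈ S.honest) {t : ℝ} {w : Option Chain},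
        PrevNext S R i t n (p + d + 1) w → w = some v := by
      rintro i hi t w ⟨q, hq1, hq2⟩
      obtain rfl : p + d = q := by omega
      exact ih hi hq2
    cases w with
    | none => exact ih hj (E.nextVotes_none hj hjc hn)
    | some v' =>
      rcases nextVotes_some hn with h1 | ⟨s, hs, rfl, hnp, h1⟩
      -- By induction `⊥` had no quorum in the period before, so the period is open for nobody and
      -- soft-votes can only repeat the locked value.
      · obtain ⟨i, hi, hic, y, -, hs⟩ := E.softQuorum_voter hj h1
        obtain ⟨s, -, rfl, ⟨hf, -⟩ | ⟨-, h2⟩⟩ := E.softVotes_cases hi hic hs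
        · rcases hf with hf | hf
          · omega
          · exact absurd (hprev hi hf) (by simp)
        · exact hprev hi h2
      · exact hprev hj (E.startVal_prev hj hjc hs h1)

/-- Within one period this is uniqueness of soft-quorums; across periods the first certificate locks
its value, and a later soft-vote cannot deviate from it. -/
theorem Fair.certQuorum_agree (E : Fair S O R) {n p q : ℕ} {g h : Node} (hg : g ∈ S.honest)
    (hh : h ∈ S.honest) {x y : ℝ} {v v' : Chain} (hc : CertQuorum S R g x n p v)
    (hc' : CertQuorum S R h y n q v') (hpq : p ≤ q) : v = v' := by
  obtain ⟨i, hi, hic, t, -, -, -, -, -, -, hq⟩ := E.certQuorum_voter hg hc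
  obtain ⟨j, hj, hjc, t', -, -, -, -, -, -, hq'⟩ := E.certQuorum_voter hh hc'
  rcases hpq.eq_or_lt with rfl | hlt
  · exact E.softQuorum_unique hi hj hq hq'
  · obtain ⟨d, rfl⟩ : ∃ d, q = p + d + 1 := ⟨q - p - 1, by omega⟩
    have hprev : ∀ {i : Node} (_ : i ∈ S.honest) {t : ℝ} {w : Option Chain},
        PrevNext S R i t n (p + d + 1) w → w = some v := by
      rintro i hi t w ⟨q, hq1, hq2⟩
      obtain rfl : p + d = q := by omega
      exact E.certQuorum_lock hg hc d hi hq2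
    obtain ⟨l, hl, hlc, y, -, hs⟩ := E.softQuorum_voter hj hq'
    obtain ⟨s, -, rfl, ⟨hf, -⟩ | ⟨-, h2⟩⟩ := E.softVotes_cases hl hlc hs
    · rcases hf with hf | hf
      · omega
      · exact absurd (hprev hl hf) (by simp)
    · exact (Option.some.inj (hprev hl h2)).symm

theorem Fair.certified_unique (E : Fair S O R) {n : ℕ} {g h : Node} (hg : g ∈ S.honest)
    (hh : h ∈ S.honest) {x y : ℝ} {v v' : Chain} (hc : Certified S R g x n v)
    (hc' : Certified S R h y n v') : v = v' := by
  obtain ⟨p, hp⟩ := hc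
  obtain ⟨q, hq⟩ := hc'
  rcases le_total p q with h1 | h1
  · exact E.certQuorum_agree hg hh hp hq h1
  · exact (E.certQuorum_agree hh hg hq hp h1).symm

end

section

variable {Node : Type u} {S : Setting Node} {O : Oracle Node} {R : Run Node}

/-! ### Order of periods and iterations -/

theorem exists_start_of_le {x : WithTop ℝ} {t : ℝ} (h : x ≤ (t : WithTop ℝ)) :
    ∃ s : ℝ, x = (s : WithTop ℝ) ∧ s ≤ t := by
  lift x to ℝ using ne_top_of_le_ne_top WithTop.coe_ne_top h
  exact ⟨x, rfl, WithTop.coe_le_coe.1 h⟩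

theorem ready_succ_iff {i : Node} {n q : ℕ} {t : ℝ} :
    Ready S R i n (q + 1) t ↔ ∃ w, NextQuorum S R i t n q w := by
  cases n <;> rfl

theorem Fair.ready_of_start (E : Fair S O R) {i : Node} (hi : i ∈ S.honest) (hic : i ∈ S.ckpt)
    {n p : ℕ} {t : ℝ} (h : R.start i n p = (t : WithTop ℝ)) : Ready S R i n p t :=
  ((E.adm.start_rule i hi hic n p t).1 h).1.1

/-- A period is opened by next-votes, some of them honest, and these are cast at clock `4Δ` or later
of the period before. -/
theorem Fair.start_pred (E : Fair S O R) {i : Node} (hi : i ∈ S.honest) (hic : i ∈ S.ckpt)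
    {n p : ℕ} {t : ℝ} (h : R.start i n (p + 1) = (t : WithTop ℝ)) :
    ∃ j ∈ S.honest, j ∈ S.ckpt ∧ ∃ s : ℝ, R.start j n p = (s : WithTop ℝ) ∧ s + 4 * S.Δ ≤ t := by
  obtain ⟨w, hw⟩ := ready_succ_iff.1 (E.ready_of_start hi hic h)
  obtain ⟨j, hj, hjc, t', ht', hn⟩ := E.nextQuorum_voter hi hw
  obtain ⟨s, hs, hle⟩ := nextVotes_start hn
  exact ⟨j, hj, hjc, s, hs, hle.trans ht'⟩

theorem Fair.start_pred_iter (E : Fair S O R) {n p : ℕ} (d : ℕ) :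
    ∀ {i : Node} (_ : i ∈ S.honest) (_ : i ∈ S.ckpt)
    {t : ℝ} (_ : R.start i n (p + d) = (t : WithTop ℝ)),
    ∃ j ∈ S.honest, j ∈ S.ckpt ∧
      ∃ s : ℝ, R.start j n p = (s : WithTop ℝ) ∧ s + 4 * S.Δ * d ≤ t := by
  induction d with
  | zero => intro i hi hic t h; exact ⟨i, hi, hic, t, h, by simp⟩
  | succ d ih =>
    intro i hi hic t h
    obtain ⟨j, hj, hjc, s, hs, hle⟩ := E.start_pred hi hic (p := p + d) h
    obtain ⟨l, hl, hlc, s', hs', hle'⟩ := ih hj hjc hs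
    refine ⟨l, hl, hlc, s', hs', ?_⟩
    push_cast
    linarith

theorem Fair.start_pred_of_le (E : Fair S O R) {n p q : ℕ} (hpq : p ≤ q) {i : Node}
    (hi : i ∈ S.honest) (hic : i ∈ S.ckpt) {t : ℝ} (h : R.start i n q = (t : WithTop ℝ)) :
    ∃ j ∈ S.honest, j ∈ S.ckpt ∧
      ∃ s : ℝ, R.start j n p = (s : WithTop ℝ) ∧ s + 4 * S.Δ * (q - p) ≤ t := by
  obtain ⟨d, rfl⟩ := Nat.exists_eq_add_of_le hpq
  obtain ⟨j, hj, hjc, s, hs, hle⟩ := E.start_pred_iter d hi hic h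
  exact ⟨j, hj, hjc, s, hs, by push_cast; linarith⟩

theorem Fair.decided_of_start (E : Fair S O R) {i : Node} (hi : i ∈ S.honest) (hic : i ∈ S.ckpt)
    {n p : ℕ} {t : ℝ} (h : R.start i (n + 1) p = (t : WithTop ℝ)) :
    Decided S R n (t - S.e) := by
  obtain ⟨j, hj, hjc, s, hs, hle⟩ := E.start_pred_of_le (Nat.zero_le p) hi hic h
  obtain ⟨v, hv⟩ := E.ready_of_start hj hjc hs
  have : 0 ≤ 4 * S.Δ * ((p : ℝ) - (0 : ℕ)) := by
    have := E.Δ_pos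
    simp; positivity
  exact ⟨j, hj, v, hv.mono (by linarith)⟩

theorem Fair.start_of_certQuorum (E : Fair S O R) {h : Node} (hh : h ∈ S.honest) {t : ℝ}
    {n p : ℕ} {v : Chain} (hc : CertQuorum S R h t n p v) :
    ∃ j ∈ S.honest, j ∈ S.ckpt ∧ ∃ s : ℝ, R.start j n p = (s : WithTop ℝ) ∧ s + 2 * S.Δ ≤ t := by
  obtain ⟨j, hj, hjc, t', ht', -, s, hs, hle, -⟩ := E.certQuorum_voter hh hc
  exact ⟨j, hj, hjc, s, hs, hle.trans ht'⟩

/-- Consecutive decisions are at least `e` apart. This limits the number of disturbances by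
checkpoints. -/
theorem Fair.decided_pred (E : Fair S O R) {n : ℕ} {t : ℝ} (h : Decided S R (n + 1) t) :
    Decided S R n (t - S.e) := by
  obtain ⟨g, hg, v, p, hc⟩ := h
  obtain ⟨j, hj, hjc, s, hs, hle⟩ := E.start_of_certQuorum hg hc
  exact (E.decided_of_start hj hjc hs).mono (by linarith [E.Δ_pos])

theorem Fair.decided_sub (E : Fair S O R) {n : ℕ} (d : ℕ) {t : ℝ} (h : Decided S R (n + d) t) :
    Decided S R n (t - d * S.e) := by
  induction d generalizing t with
  | zero => simpa using h
  | succ d ih =>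
    have := ih (E.decided_pred h)
    convert this using 1
    push_cast; ring

theorem Fair.decided_of_le (E : Fair S O R) {m n : ℕ} (hmn : m ≤ n) {t : ℝ}
    (h : Decided S R n t) : Decided S R m t := by
  obtain ⟨d, rfl⟩ := Nat.exists_eq_add_of_le hmn
  refine (E.decided_sub d h).mono ?_
  have := E.e_pos
  have : 0 ≤ (d : ℝ) * S.e := by positivity
  linarith

theorem Fair.decided_of_start_later (E : Fair S O R) {i : Node} (hi : i ∈ S.honest)
    (hic : i ∈ S.ckpt) {n n' p : ℕ} (hn : n < n') {t : ℝ}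
    (h : R.start i n' p ≤ (t : WithTop ℝ)) : Decided S R n t := by
  obtain ⟨s, hs, hle⟩ := exists_start_of_le h
  obtain ⟨d, rfl⟩ := Nat.exists_eq_add_of_lt hn
  exact E.decided_of_le (by omega : n ≤ n + d)
    ((E.decided_of_start hi hic hs).mono (by linarith [E.e_pos]))

theorem Fair.certQuorum_nonneg (E : Fair S O R) {h : Node} {t : ℝ}
    {n p : ℕ} {v : Chain} (hc : CertQuorum S R h t n p v) : 0 ≤ t := by
  obtain ⟨i, -, -, hk⟩ := E.quorum_honest hc
  have := (E.adm.recv_nonneg h _).trans hk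
  exact_mod_cast this

theorem Fair.decided_nonneg (E : Fair S O R) {n : ℕ} {t : ℝ} (h : Decided S R n t) : 0 ≤ t := by
  obtain ⟨g, hg, v, p, hc⟩ := h
  exact E.certQuorum_nonneg hc

theorem Fair.decided_time (E : Fair S O R) {n : ℕ} {t : ℝ} (h : Decided S R n t) :
    n * S.e ≤ t := by
  have h1 : Decided S R (0 + n) t := by simpa using h
  linarith [E.decided_nonneg (E.decided_sub n h1)]

/-- Only boundedly many periods and iterations can be reached by a given time, so finitely many
leaders matter in the union bound. -/
theorem Fair.start_time (E : Fair S O R) {i : Node} (hi : i ∈ S.honest)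
    (hic : i ∈ S.ckpt) {n p : ℕ} {t : ℝ} (h : R.start i n p = (t : WithTop ℝ)) :
    n * S.e + 4 * S.Δ * p ≤ t := by
  obtain ⟨j, hj, hjc, s, hs, hle⟩ := E.start_pred_of_le (Nat.zero_le p) hi hic h
  have h0 : n * S.e ≤ s := by
    cases n with
    | zero =>
      have : 0 ≤ s := E.ready_of_start hj hjc hs
      simpa using this
    | succ n =>
      have := E.decided_time (E.decided_of_start hj hjc hs)
      push_cast
      linarith
  push_cast at hle
  linarith

/-! ### Existence of starting times -/

theorem isClosed_knows (h : Node) (m : Msg Node) : IsClosed {t : ℝ | Knows R h t m} := by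
  unfold Knows
  cases hx : R.recv h m with
  | top => simp
  | coe x =>
    have : {t : ℝ | (x : WithTop ℝ) ≤ (t : WithTop ℝ)} = Set.Ici x := by
      ext t; simp
    rw [this]
    exact isClosed_Ici

theorem isClosed_quorum_knows (h : Node) (m : Node → Msg Node) :
    IsClosed {t : ℝ | Quorum S (fun i => Knows R h t (m i))} := by
  classical
  have : {t : ℝ | Quorum S (fun i => Knows R h t (m i))}
      = ⋃ J ∈ S.ckpt.powerset.filter (fun J => 2 * S.ckpt.card ≤ 3 * J.card),
        ⋂ i ∈ J, {t : ℝ | Knows R h t (m i)} := by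
    ext t
    simp only [Set.mem_ofPred_eq, Set.mem_iUnion, Finset.mem_filter, Finset.mem_powerset,
      Set.mem_iInter, exists_prop]
    constructor
    · intro hq
      refine ⟨S.ckpt.filter (fun i => Knows R h t (m i)), ⟨Finset.filter_subset _ _, ?_⟩, ?_⟩
      · unfold Quorum at hq
        convert hq
      · intro i hi
        exact (Finset.mem_filter.1 hi).2
    · rintro ⟨J, ⟨hJ, hc⟩, hk⟩
      unfold Quorum
      refine hc.trans (Nat.mul_le_mul_left 3 (Finset.card_le_card ?_))
      intro i hi
      exact Finset.mem_filter.2 ⟨hJ hi, hk i hi⟩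
  rw [this]
  refine isClosed_biUnion_finset fun J _ => isClosed_biInter fun i _ => isClosed_knows h (m i)

/-- The union over all values is infinite, but by the agreement properties only one value ever
contributes. -/
theorem isClosed_exists_of_unique {α : Type*} {P : α → ℝ → Prop}
    (hcl : ∀ a, IsClosed {t | P a t}) (huniq : ∀ a b x y, P a x → P b y → a = b) :
    IsClosed {t | ∃ a, P a t} := by
  by_cases h : ∃ a x, P a x
  · obtain ⟨a, x, hax⟩ := h
    have : {t | ∃ a, P a t} = {t | P a t} := by
      ext t
      constructor
      · rintro ⟨b, hb⟩
        have := huniq _ _ _ _ hb hax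
        subst this; exact hb
      · intro hb; exact ⟨a, hb⟩
    rw [this]; exact hcl a
  · push Not at h
    have : {t | ∃ a, P a t} = ∅ := by
      ext t; simp [h]
    rw [this]; exact isClosed_empty

theorem Fair.isClosed_certified (E : Fair S O R) {i : Node} (hi : i ∈ S.honest) (n : ℕ) :
    IsClosed {t : ℝ | ∃ v, Certified S R i t n v} := by
  have : {t : ℝ | ∃ v, Certified S R i t n v}
      = ⋃ p : ℕ, {t : ℝ | ∃ v, CertQuorum S R i t n p v} := by
    ext t
    simp only [Set.mem_ofPred_eq, Set.mem_iUnion, Certified]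
    exact exists_comm
  rw [this]
  -- Period `p` has no certificate before time `4Δp`, so near each time only finitely many periods
  -- contribute.
  apply LocallyFinite.isClosed_iUnion
  · intro x
    refine ⟨Set.Iio (x + 1), Iio_mem_nhds (by linarith), ?_⟩
    obtain ⟨N, hN⟩ := exists_nat_gt ((x + 1) / (4 * S.Δ))
    refine (Set.finite_lt_nat N).subset ?_
    rintro p ⟨t, ⟨v, hv⟩, ht⟩
    have hΔ := E.Δ_pos
    obtain ⟨j, hj, hjc, s, hs, hle⟩ := E.start_of_certQuorum hi hv
    have h1 := E.start_time hj hjc hs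
    have h2 : 0 ≤ (n : ℝ) * S.e := mul_nonneg n.cast_nonneg E.e_pos.le
    simp only [Set.mem_Iio] at ht
    rw [div_lt_iff₀ (by positivity)] at hN
    have h3 : (p : ℝ) < N := by
      by_contra hcon
      push Not at hcon
      nlinarith
    exact_mod_cast h3
  · intro p
    apply isClosed_exists_of_unique
    · intro v; exact isClosed_quorum_knows i (fun j => Msg.cert n p j v)
    · intro v v' x y hx hy
      exact E.certified_unique hi hi ⟨p, hx⟩ ⟨p, hy⟩

/-- A start is tied to a least ready time; closedness makes the infimum of the ready times such a
minimum. -/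
theorem Fair.isClosed_ready (E : Fair S O R) {i : Node} (hi : i ∈ S.honest) (n p : ℕ) :
    IsClosed {t : ℝ | Ready S R i n p t} := by
  cases p with
  | zero =>
    cases n with
    | zero => exact isClosed_Ici
    | succ n =>
      exact (E.isClosed_certified hi n).preimage (continuous_id.sub continuous_const)
  | succ q =>
    have : {t : ℝ | Ready S R i n (q + 1) t} = {t | NextQuorum S R i t n q none}
        ∪ {t | ∃ v, NextQuorum S R i t n q (some v)} := by
      ext t
      simp only [Set.mem_ofPred_eq, ready_succ_iff, Set.mem_union, Option.exists]
    rw [this]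
    refine (isClosed_quorum_knows i (fun j => Msg.next n q j none)).union ?_
    apply isClosed_exists_of_unique
    · intro v; exact isClosed_quorum_knows i (fun j => Msg.next n q j (some v))
    · intro v v' x y hx hy
      exact E.nextQuorum_some_unique hi hi hx hy

theorem Fair.ready_nonneg (E : Fair S O R) {i : Node} {n p : ℕ} {t : ℝ}
    (h : Ready S R i n p t) : 0 ≤ t := by
  cases p with
  | zero =>
    cases n with
    | zero => exact h
    | succ n =>
      obtain ⟨v, p, hc⟩ := h
      linarith [E.certQuorum_nonneg hc, E.e_pos]
  | succ q =>
    obtain ⟨w, hw⟩ := ready_succ_iff.1 h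
    obtain ⟨j, -, -, hk⟩ := E.quorum_honest hw
    exact_mod_cast (E.adm.recv_nonneg i _).trans hk

/-- An honest checkpointer that is ready for a period of an undecided iteration has started this
period or a later one of the same iteration. -/
theorem Fair.exists_start (E : Fair S O R) {i : Node} (hi : i ∈ S.honest) (hic : i ∈ S.ckpt)
    {n p : ℕ} {x : ℝ} (hr : Ready S R i n p x) (hd : ¬ Decided S R n x) :
    ∃ p', p ≤ p' ∧ ∃ s : ℝ, R.start i n p' = (s : WithTop ℝ) ∧ s ≤ x := by
  have hbdd : BddBelow {t : ℝ | Ready S R i n p t} := ⟨0, fun t ht => E.ready_nonneg ht⟩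
  have hleast := (E.isClosed_ready hi n p).isLeast_csInf ⟨x, hr⟩ hbdd
  set t := sInf {t : ℝ | Ready S R i n p t}
  have htx : t ≤ x := hleast.2 hr
  -- The start may be pre-empted by a later period. One of a later iteration would mean that
  -- iteration `n` is decided, so it belongs to the same iteration.
  by_cases hlater : ∃ n' p', Later n p n' p' ∧ R.start i n' p' ≤ (t : WithTop ℝ)
  · obtain ⟨n', p', hl, hs⟩ := hlater
    rcases hl with hl | ⟨rfl, hl⟩
    · exact absurd ((E.decided_of_start_later hi hic hl hs).mono htx) hd
    · obtain ⟨s, hs, hle⟩ := exists_start_of_le hs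
      exact ⟨p', hl.le, s, hs, hle.trans htx⟩
  · push Not at hlater
    refine ⟨p, le_rfl, t, (E.adm.start_rule i hi hic n p t).2 ⟨hleast, ?_, ?_⟩, htx⟩
    · intro n' p' hl; exact not_le.2 (hlater n' p' hl)
    · rintro ⟨y, hy, v, hv⟩
      exact hd ⟨i, hi, v, hv.mono (hy.le.trans htx)⟩

theorem Fair.inPeriod (E : Fair S O R) {i : Node} (hi : i ∈ S.honest) (hic : i ∈ S.ckpt)
    {n p : ℕ} {s t : ℝ} (hs : R.start i n p = (s : WithTop ℝ)) (hst : s ≤ t)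
    (hd : ¬ Decided S R n t)
    (hlater : ∀ p' > p, ∀ s' : ℝ, R.start i n p' = (s' : WithTop ℝ) → t ≤ s') :
    InPeriod S R i n p t := by
  refine ⟨by rw [hs]; exact WithTop.coe_le_coe.2 hst, ?_, ?_⟩
  · rintro n' p' (hl | ⟨rfl, hl⟩) hlt
    · exact hd (E.decided_of_start_later hi hic hl hlt.le)
    · obtain ⟨s', hs', -⟩ := exists_start_of_le hlt.le
      rw [hs'] at hlt
      exact absurd (hlater p' hl s' hs') (not_le.2 (WithTop.coe_lt_coe.1 hlt))
  · rintro ⟨y, hy, v, hv⟩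
    exact hd ⟨i, hi, v, hv.mono hy.le⟩

end

section

variable {Node : Type u} {S : Setting Node} {O : Oracle Node} {R : Run Node}

/-! ### Duration of periods after stabilization -/

theorem Fair.startVal_of_no_bot (E : Fair S O R) {i : Node} (hi : i ∈ S.honest) (hic : i ∈ S.ckpt)
    {n p : ℕ} {s t : ℝ} (hs : R.start i n (p + 1) = (s : WithTop ℝ)) (hst : s ≤ t)
    (hn : ¬ PrevNext S R i t n (p + 1) none) :
    ∃ v, R.startVal i n (p + 1) = some v ∧ PrevNext S R i s n (p + 1) (some v) := by
  have h1 := (E.adm.startVal_rule i hi hic n (p + 1) s hs).2 p rfl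
  cases hv : R.startVal i n (p + 1) with
  | none => rw [hv] at h1; exact absurd ⟨p, rfl, h1.mono hst⟩ hn
  | some v => exact ⟨v, rfl, p, rfl, hv ▸ h1⟩

/-- If nobody moved on, everybody would have entered the period by `x + Δ` and passed clock `4Δ` by
`x + 5Δ`. One more `Δ` spreads whatever soft-quorum or `⊥`-quorum somebody has seen, and another one
delivers unanimous next-votes. These are for the cert-voted value if there is one, otherwise for `⊥`
if somebody has seen it win, and otherwise for the starting value, which is then common to all. -/
theorem Fair.progress (E : Fair S O R) {n p : ℕ} {x : ℝ} (hx : R.gst ≤ x)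
    (hnd : ¬ Decided S R n (x + 7 * S.Δ))
    (hall : ∀ i ∈ S.honest, i ∈ S.ckpt →
      ∃ p, ∃ s : ℝ, R.start i n p = (s : WithTop ℝ) ∧ s ≤ x)
    {j : Node} (hj : j ∈ S.honest) (hjc : j ∈ S.ckpt) {sj : ℝ}
    (hsj : R.start j n p = (sj : WithTop ℝ)) (hsjx : sj ≤ x) :
    ∃ i ∈ S.honest, i ∈ S.ckpt ∧ ∃ p' > p, ∃ s : ℝ, R.start i n p' = (s : WithTop ℝ) ∧
      s ≤ x + 7 * S.Δ := by
  have hΔ := E.Δ_pos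
  by_contra hcon
  push Not at hcon
  have hnd' : ∀ {y : ℝ}, y ≤ x + 7 * S.Δ → ¬ Decided S R n y := fun hy h => hnd (h.mono hy)
  -- everybody has started the period
  have hst : ∀ i ∈ S.honest, i ∈ S.ckpt →
      ∃ s : ℝ, R.start i n p = (s : WithTop ℝ) ∧ s ≤ x + S.Δ := by
    intro i hi hic
    have key : ∃ p', p ≤ p' ∧ ∃ s : ℝ, R.start i n p' = (s : WithTop ℝ) ∧ s ≤ x + S.Δ := by
      cases p with
      | zero =>
        obtain ⟨p', s, hs, hle⟩ := hall i hi hic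
        exact ⟨p', Nat.zero_le _, s, hs, by linarith⟩
      | succ q =>
        obtain ⟨w, hw⟩ := ready_succ_iff.1 (E.ready_of_start hj hjc hsj)
        have hr : Ready S R i n (q + 1) (x + S.Δ) :=
          ready_succ_iff.2 ⟨w, E.nextQuorum_relay hj hi hw (by linarith) (by linarith)⟩
        exact E.exists_start hi hic hr (hnd' (by linarith))
    obtain ⟨p', hp', s, hs, hle⟩ := key
    rcases hp'.eq_or_lt with rfl | hlt
    · exact ⟨s, hs, hle⟩
    · linarith [hcon i hi hic p' hlt s hs]
  have hin : ∀ i ∈ S.honest, i ∈ S.ckpt → ∀ s : ℝ, R.start i n p = (s : WithTop ℝ) →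
      ∀ t, s ≤ t → t ≤ x + 7 * S.Δ → InPeriod S R i n p t := by
    intro i hi hic s hs t h1 h2
    exact E.inPeriod hi hic hs h1 (hnd' h2) fun p' hp' s' hs' =>
      h2.trans (hcon i hi hic p' hp' s' hs').le
  -- a common next-vote leads to the next period
  have hfin : ∀ w, (∀ i ∈ S.honest, i ∈ S.ckpt → ∃ t ≤ x + 6 * S.Δ, NextVotes S R i n p w t) →
      False := by
    intro w hw
    have hq : NextQuorum S R j (x + 7 * S.Δ) n p w := by
      refine E.quorum_of_honest fun i hi hic => ?_
      obtain ⟨t, ht, hn⟩ := hw i hi hic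
      exact E.knows_relay hi hj (E.adm.own_messages i hi hic t (Msg.next n p i w) ⟨rfl, hn⟩)
        (by linarith) (by linarith)
    obtain ⟨p', hp', s, hs, hle⟩ := E.exists_start hj hjc (ready_succ_iff.2 ⟨w, hq⟩) hnd
    linarith [hcon j hj hjc p' (by omega) s hs]
  by_cases hcert : ∃ i ∈ S.honest, i ∈ S.ckpt ∧ ∃ v, HasCertVoted S R i n p v
  · obtain ⟨i, hi, hic, v, t, -, s, hs, -, ht, hq⟩ := hcert
    obtain ⟨s', hs', hle⟩ := hst i hi hic
    rw [hs] at hs'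
    obtain rfl := WithTop.coe_inj.1 hs'
    refine hfin (some v) fun l hl hlc => ⟨x + 6 * S.Δ, le_rfl, ?_⟩
    obtain ⟨sl, hsl, hlel⟩ := hst l hl hlc
    exact ⟨hin l hl hlc sl hsl _ (by linarith) (by linarith), sl, hsl, Or.inr ⟨by linarith,
      Or.inl ⟨v, E.softQuorum_relay hi hl hq (by linarith) (by linarith), rfl⟩⟩⟩
  push Not at hcert
  by_cases hbot : ∃ i ∈ S.honest, i ∈ S.ckpt ∧ PrevNext S R i (x + 5 * S.Δ) n p none
  · obtain ⟨i, hi, hic, hb⟩ := hbot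
    refine hfin none fun l hl hlc => ⟨x + 6 * S.Δ, le_rfl, ?_⟩
    obtain ⟨sl, hsl, hlel⟩ := hst l hl hlc
    exact ⟨hin l hl hlc sl hsl _ (by linarith) (by linarith), sl, hsl, Or.inr ⟨by linarith,
      Or.inr ⟨E.prevNext_relay hi hl hb (by linarith) (by linarith), hcert l hl hlc, rfl⟩⟩⟩
  push Not at hbot
  refine hfin (R.startVal j n p) fun l hl hlc => ?_
  obtain ⟨sl, hsl, hlel⟩ := hst l hl hlc
  refine ⟨sl + 4 * S.Δ, by linarith,
    hin l hl hlc sl hsl _ (by linarith) (by linarith), sl, hsl, Or.inl ⟨rfl, Or.inr (Or.inr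
      ⟨hcert l hl hlc, fun h => hbot l hl hlc (h.mono (by linarith)), ?_⟩)⟩⟩
  cases p with
  | zero =>
    rw [(E.adm.startVal_rule j hj hjc n 0 sj hsj).1 rfl,
      (E.adm.startVal_rule l hl hlc n 0 sl hsl).1 rfl]
  | succ q =>
    obtain ⟨v, hv, hpv⟩ := E.startVal_of_no_bot hj hjc hsj (by linarith) (hbot j hj hjc)
    obtain ⟨v', hv', hpv'⟩ := E.startVal_of_no_bot hl hlc hsl (by linarith) (hbot l hl hlc)
    rw [hv, hv', E.prevNext_some_unique hj hl hpv hpv']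

theorem Fair.progress_iter (E : Fair S O R) {n p : ℕ} {x : ℝ} (hx : R.gst ≤ x)
    (hall : ∀ i ∈ S.honest, i ∈ S.ckpt →
      ∃ p, ∃ s : ℝ, R.start i n p = (s : WithTop ℝ) ∧ s ≤ x)
    {j : Node} (hj : j ∈ S.honest) (hjc : j ∈ S.ckpt) {sj : ℝ}
    (hsj : R.start j n p = (sj : WithTop ℝ)) (hsjx : sj ≤ x) (d : ℕ) :
    ¬ Decided S R n (x + 7 * S.Δ * d) →
    ∃ i ∈ S.honest, i ∈ S.ckpt ∧ ∃ p', p + d ≤ p' ∧ ∃ s : ℝ, R.start i n p' = (s : WithTop ℝ) ∧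
      s ≤ x + 7 * S.Δ * d := by
  have hΔ := E.Δ_pos
  induction d with
  | zero => intro _; exact ⟨j, hj, hjc, p, le_rfl, sj, hsj, by simpa using hsjx⟩
  | succ d ih =>
    intro hnd
    have hstep : x + 7 * S.Δ * ((d + 1 : ℕ) : ℝ) = x + 7 * S.Δ * d + 7 * S.Δ := by
      push_cast; ring
    have hd0 : 0 ≤ 7 * S.Δ * (d : ℝ) := by positivity
    rw [hstep] at hnd ⊢
    obtain ⟨i, hi, hic, p', hp', s, hs, hle⟩ := ih fun h => hnd (h.mono (by linarith))
    obtain ⟨i', hi', hic', p'', hp'', s', hs', hle'⟩ :=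
      E.progress (x := x + 7 * S.Δ * d) (by linarith) hnd
        (fun i hi hic => by
          obtain ⟨p, s, hs, h⟩ := hall i hi hic
          exact ⟨p, s, hs, by linarith⟩) hi hic hs hle
    exact ⟨i', hi', hic', p'', by omega, s', hs', hle'⟩

/-! ### Periods with an honest leader -/

theorem exists_first_start {i : Node} (hi : i ∈ S.honest)
    (hic : i ∈ S.ckpt) {n p : ℕ} {t : ℝ} (h : R.start i n p = (t : WithTop ℝ)) :
    ∃ j ∈ S.honest, j ∈ S.ckpt ∧ ∃ s : ℝ, R.start j n p = (s : WithTop ℝ) ∧ s ≤ t ∧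
      ∀ l ∈ S.honest, l ∈ S.ckpt → ∀ s' : ℝ, R.start l n p = (s' : WithTop ℝ) → s ≤ s' := by
  classical
  obtain ⟨j, hj, hmin⟩ := Finset.exists_min_image
    (S.ckpt.filter (fun l => l ∈ S.honest)) (fun l => R.start l n p)
    ⟨i, Finset.mem_filter.2 ⟨hic, hi⟩⟩
  obtain ⟨hjc, hj⟩ := Finset.mem_filter.1 hj
  have h1 := hmin i (Finset.mem_filter.2 ⟨hic, hi⟩)
  rw [h] at h1
  obtain ⟨s, hs, hle⟩ := exists_start_of_le h1
  refine ⟨j, hj, hjc, s, hs, hle, fun l hl hlc s' hs' => ?_⟩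
  have h2 := hmin l (Finset.mem_filter.2 ⟨hlc, hl⟩)
  rw [hs, hs'] at h2
  exact WithTop.coe_le_coe.1 h2

/-- In a period after stabilization that has an honest leader and does not decide the iteration,
every honest checkpointer sees in time that new proposals are admitted. -/
theorem Fair.honest_leader (E : Fair S O R) {n q : ℕ} {s : ℝ} (hgst : R.gst ≤ s)
    (hnd : ¬ Decided S R n (s + 5 * S.Δ)) (hl : O.leader n (q + 1) ∈ S.honest)
    (hlc : O.leader n (q + 1) ∈ S.ckpt) {j : Node} (hj : j ∈ S.honest) (hjc : j ∈ S.ckpt)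
    (hsj : R.start j n (q + 1) = (s : WithTop ℝ))
    (hfirst : ∀ i ∈ S.honest, i ∈ S.ckpt → ∀ s' : ℝ,
      R.start i n (q + 1) = (s' : WithTop ℝ) → s ≤ s') :
    ∃ sl : ℝ, s ≤ sl ∧ sl ≤ s + S.Δ ∧ R.start (O.leader n (q + 1)) n (q + 1) = (sl : WithTop ℝ) ∧
      PrevNext S R (O.leader n (q + 1)) sl n (q + 1) none ∧
      ∀ i ∈ S.honest, i ∈ S.ckpt → ∀ s' : ℝ, R.start i n (q + 1) = (s' : WithTop ℝ) →
        PrevNext S R i (s' + 2 * S.Δ) n (q + 1) none := by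
  have hΔ := E.Δ_pos
  have hnd' : ∀ {y : ℝ}, y ≤ s + 5 * S.Δ → ¬ Decided S R n y := fun hy h => hnd (h.mono hy)
  -- Nobody can leave the period early, since next-votes are cast at clock `4Δ` at the earliest and
  -- no honest clock started before `s`.
  have hlate : ∀ i ∈ S.honest, i ∈ S.ckpt → ∀ p' > q + 1, ∀ s' : ℝ,
      R.start i n p' = (s' : WithTop ℝ) → s + 4 * S.Δ ≤ s' := by
    intro i hi hic p' hp' s' hs'
    obtain ⟨l, hl, hlc, x, hx, hle⟩ := E.start_pred_of_le hp'.le hi hic hs'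
    have h1 := hfirst l hl hlc x hx
    have h2 : (1 : ℝ) ≤ (p' : ℝ) - ((q + 1 : ℕ) : ℝ) := by
      have : ((q + 1 + 1 : ℕ) : ℝ) ≤ p' := by exact_mod_cast hp'
      push_cast at this ⊢; linarith
    nlinarith
  obtain ⟨w, hw⟩ := ready_succ_iff.1 (E.ready_of_start hj hjc hsj)
  have hst : ∀ i ∈ S.honest, i ∈ S.ckpt →
      ∃ s' : ℝ, R.start i n (q + 1) = (s' : WithTop ℝ) ∧ s' ≤ s + S.Δ := by
    intro i hi hic
    have hr : Ready S R i n (q + 1) (s + S.Δ) :=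
      ready_succ_iff.2 ⟨w, E.nextQuorum_relay hj hi hw le_rfl (by linarith)⟩
    obtain ⟨p', hp', s', hs', hle⟩ := E.exists_start hi hic hr (hnd' (by linarith))
    rcases hp'.eq_or_lt with rfl | hlt
    · exact ⟨s', hs', hle⟩
    · linarith [hlate i hi hic p' hlt s' hs']
  obtain ⟨sl, hsl, hsle⟩ := hst _ hl hlc
  have hssl := hfirst _ hl hlc sl hsl
  by_cases hbot : PrevNext S R (O.leader n (q + 1)) sl n (q + 1) none
  · refine ⟨sl, hssl, hsle, hsl, hbot, fun i hi hic s' hs' => ?_⟩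
    have := hfirst i hi hic s' hs'
    exact E.prevNext_relay hl hi hbot (by linarith) (by linarith)
  -- If the leader had not seen `⊥` win, it would re-propose the unique `v` with a quorum. Proposal
  -- by `s + Δ`, soft-votes by `s + 3Δ`, cert-votes by `s + 4Δ` and their delivery by `s + 5Δ` would
  -- then decide the iteration.
  exfalso
  have hnf : ¬ Fresh S R (O.leader n (q + 1)) sl n (q + 1) := by
    rintro (h | h)
    · omega
    · exact hbot h
  obtain ⟨v, -, hpv⟩ := E.startVal_of_no_bot hl hlc hsl le_rfl hbot
  have hprop : Knows R (O.leader n (q + 1)) sl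
      (Msg.proposal n (q + 1) (O.leader n (q + 1)) v) :=
    E.adm.own_messages _ hl hlc sl _ ⟨rfl, rfl, hsl, Or.inr ⟨hnf, hpv⟩⟩
  -- all honest checkpointers soft-vote `v`
  have hsoft : ∀ i ∈ S.honest, i ∈ S.ckpt → Knows R i (s + 3 * S.Δ) (Msg.soft n (q + 1) i v) := by
    intro i hi hic
    obtain ⟨si, hsi, hsie⟩ := hst i hi hic
    have hssi := hfirst i hi hic si hsi
    have hel : SoftEligible S O R i n (q + 1) v := by
      refine ⟨si, hsi, E.inPeriod hi hic hsi (by linarith) (hnd' (by linarith))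
        fun p' hp' s' hs' => by linarith [hlate i hi hic p' hp' s' hs'], ?_⟩
      have hpi : PrevNext S R i (si + 2 * S.Δ) n (q + 1) (some v) :=
        E.prevNext_relay hl hi hpv (by linarith) (by linarith)
      -- Both branches of the soft-vote rule lead to `v`: as the only proposal of the leader, or as
      -- the only value with a quorum.
      by_cases hf : Fresh S R i (si + 2 * S.Δ) n (q + 1)
      · exact Or.inl ⟨hf, E.knows_relay hl hi hprop (by linarith) (by linarith), Or.inr hpi⟩
      · exact Or.inr ⟨hf, hpi⟩
    obtain ⟨hr1, hr2⟩ := E.adm.softVal_rule i hi hic n (q + 1)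
    cases hv' : R.softVal i n (q + 1) with
    | none => exact absurd hel (hr2 hv' v)
    | some v' =>
      have hvote : SoftVotes S R i n (q + 1) v' (si + 2 * S.Δ) := ⟨si, hsi, rfl, hv'⟩
      have : v' = v := by
        obtain ⟨-, -, -, ⟨-, hk, -⟩ | ⟨-, h2⟩⟩ := E.softVotes_cases hi hic hvote
        · obtain ⟨-, t', -, -, -, hs', h3⟩ := E.adm.unforgeable i hi _ hl _ _ rfl hk
          rw [hsl] at hs'
          obtain rfl := WithTop.coe_inj.1 hs'
          rcases h3 with ⟨h3, -⟩ | ⟨-, h3⟩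
          · exact absurd h3 hnf
          · exact E.prevNext_some_unique hl hl h3 hpv
        · exact E.prevNext_some_unique hi hl h2 hpv
      subst this
      exact (E.adm.own_messages i hi hic _ (Msg.soft n (q + 1) i v') ⟨rfl, hvote⟩).mono
        (by linarith)
  have hcert : ∀ i ∈ S.honest, i ∈ S.ckpt → Knows R i (s + 4 * S.Δ) (Msg.cert n (q + 1) i v) := by
    intro i hi hic
    obtain ⟨si, hsi, hsie⟩ := hst i hi hic
    have hssi := hfirst i hi hic si hsi
    refine E.adm.own_messages i hi hic _ _ ⟨rfl, ?_, si, hsi, by linarith, by linarith, ?_⟩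
    -- A checkpointer may leave exactly at `s + 4Δ`; the vote still counts because a node can act at
    -- the instant of leaving a period.
    · exact E.inPeriod hi hic hsi (by linarith) (hnd' (by linarith))
        fun p' hp' s' hs' => by linarith [hlate i hi hic p' hp' s' hs']
    · exact E.quorum_of_honest fun l hl hlc =>
        E.knows_relay hl hi (hsoft l hl hlc) (by linarith) (by linarith)
  refine hnd ⟨j, hj, v, q + 1, E.quorum_of_honest fun l hl hlc =>
    E.knows_relay hl hj (hcert l hl hlc) (by linarith) (by linarith)⟩

/-! ### Origin of certified values -/

theorem ValidChain.mono {t t' : ℝ} {c : Chain} (h : ValidChain O R t c) (htt : t ≤ t') :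
    ValidChain O R t' c :=
  ⟨h.1, h.2.1, fun b hb => ⟨(h.2.2 b hb).1, (h.2.2 b hb).2.imp id fun h => h.trans htt⟩⟩

theorem Fair.knowsChain_chain (E : Fair S O R) {h : Node} (hh : h ∈ S.honest) {t : ℝ}
    (ht : 0 ≤ t) : KnowsChain R h t (R.chain h t) := (E.adm.chain_rule h hh t ht).1

theorem Fair.validChain_chain (E : Fair S O R) {h : Node} (hh : h ∈ S.honest) {t : ℝ}
    (ht : 0 ≤ t) : ValidChain O R t (R.chain h t) :=
  E.adm.recv_valid h hh t _ (E.knowsChain_chain hh ht)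

/-- The `k`-deep block of `v` is in a chain that was held by an honest checkpointer at the start
of a period `≥ q` of iteration `n`, at least `Δ` before time `t`. -/
def Endorsed (S : Setting Node) (O : Oracle Node) (R : Run Node) (n q : ℕ) (t : ℝ) (v : Chain) :
    Prop :=
  ∀ B, ckptBlock S v = some B → ∃ i ∈ S.honest, i ∈ S.ckpt ∧ ∃ p, q ≤ p ∧ ∃ s : ℝ,
    R.start i n p = (s : WithTop ℝ) ∧ s + S.Δ ≤ t ∧ B ∈ R.chain i s ∧ ValidChain O R (s + 2 * S.Δ) v

theorem Endorsed.mono {n q : ℕ} {t t' : ℝ} {v : Chain} (h : Endorsed S O R n q t v)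
    (htt : t ≤ t') : Endorsed S O R n q t' v := by
  intro B hB
  obtain ⟨i, hi, hic, p, hp, s, hs, hle, h1⟩ := h B hB
  exact ⟨i, hi, hic, p, hp, s, hs, hle.trans htt, h1⟩

/-- Period `q` acts as a fresh beginning: its honest soft-votes are endorsed, and any chain as
starting value is given up for `⊥` by clock `4Δ`. From then on a value enters only through
validation by an honest checkpointer and is otherwise handed down by quorums. -/
theorem Fair.endorsed_of_votes (E : Fair S O R) {n q : ℕ}
    (hbase : ∀ j ∈ S.honest, j ∈ S.ckpt → ∀ t v, SoftVotes S R j n q v t → Endorsed S O R n q t v)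
    (hstart : ∀ j ∈ S.honest, j ∈ S.ckpt → ∀ s : ℝ, R.start j n q = (s : WithTop ℝ) →
      ∀ v, R.startVal j n q = some v → PrevNext S R j (s + 4 * S.Δ) n q none) (d : ℕ) :
    (∀ j ∈ S.honest, j ∈ S.ckpt → ∀ t v, SoftVotes S R j n (q + d) v t →
      Endorsed S O R n q t v) ∧
    (∀ h ∈ S.honest, ∀ t v, NextQuorum S R h t n (q + d) (some v) → Endorsed S O R n q t v) := by
  have hΔ := E.Δ_pos
  induction d with
  | zero =>
    refine ⟨hbase, fun h hh t v hq => ?_⟩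
    obtain ⟨j, hj, hjc, t', ht', hn⟩ := E.nextQuorum_voter hh hq
    rcases nextVotes_some hn with h1 | ⟨s, hs, -, hnp, h1⟩
    · obtain ⟨i, hi, hic, t'', ht'', hv⟩ := E.softQuorum_voter hj h1
      exact (hbase i hi hic t'' v hv).mono (ht''.trans ht')
    · exact absurd (hstart j hj hjc s hs v h1) hnp
  | succ d ih =>
    have hprev : ∀ i ∈ S.honest, ∀ t v, PrevNext S R i t n (q + d + 1) (some v) →
        Endorsed S O R n q t v := by
      rintro i hi t v ⟨q', hq1, hq2⟩
      obtain rfl : q + d = q' := by omega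
      exact ih.2 i hi t v hq2
    have hsoft : ∀ j ∈ S.honest, j ∈ S.ckpt → ∀ t v, SoftVotes S R j n (q + d + 1) v t →
        Endorsed S O R n q t v := by
      intro j hj hjc t v hv
      obtain ⟨s, hs, rfl, h⟩ := E.softVotes_cases hj hjc hv
      rcases h with ⟨-, hk, ⟨⟨B', hB', hmem⟩, -⟩ | h⟩ | ⟨-, h⟩
      · intro B hB
        rw [hB] at hB'
        obtain rfl := Option.some.inj hB'
        exact ⟨j, hj, hjc, q + d + 1, by omega, s, hs, by linarith, hmem,
          E.adm.recv_valid j hj _ v ⟨_, hk, rfl⟩⟩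
      · exact hprev j hj _ v h
      · exact hprev j hj _ v h
    refine ⟨hsoft, fun h hh t v hq => ?_⟩
    obtain ⟨j, hj, hjc, t', ht', hn⟩ := E.nextQuorum_voter hh hq
    rcases nextVotes_some hn with h1 | ⟨s, hs, rfl, hnp, h1⟩
    · obtain ⟨i, hi, hic, t'', ht'', hv⟩ := E.softQuorum_voter hj h1
      exact (hsoft i hi hic t'' v hv).mono (ht''.trans ht')
    · exact (hprev j hj s v (E.startVal_prev hj hjc hs h1)).mono (by linarith)

theorem Fair.endorsed_of_certQuorum (E : Fair S O R) {n q p : ℕ}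
    (hbase : ∀ j ∈ S.honest, j ∈ S.ckpt → ∀ t v, SoftVotes S R j n q v t → Endorsed S O R n q t v)
    (hstart : ∀ j ∈ S.honest, j ∈ S.ckpt → ∀ s : ℝ, R.start j n q = (s : WithTop ℝ) →
      ∀ v, R.startVal j n q = some v → PrevNext S R j (s + 4 * S.Δ) n q none) (hqp : q ≤ p)
    {g : Node} (hg : g ∈ S.honest) {t : ℝ} {v : Chain} (hc : CertQuorum S R g t n p v) :
    Endorsed S O R n q t v := by
  obtain ⟨d, rfl⟩ := Nat.exists_eq_add_of_le hqp
  obtain ⟨j, hj, hjc, t', ht', -, s, hs, -, -, hq⟩ := E.certQuorum_voter hg hc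
  obtain ⟨i, hi, hic, t'', ht'', hv⟩ := E.softQuorum_voter hj hq
  exact ((E.endorsed_of_votes hbase hstart d).1 i hi hic t'' v hv).mono (ht''.trans ht')

/-- Every certified value has been validated by an honest checkpointer. -/
theorem Fair.endorsed_of_certified (E : Fair S O R) {n : ℕ} {g : Node} (hg : g ∈ S.honest)
    {t : ℝ} {v : Chain} (hc : Certified S R g t n v) : Endorsed S O R n 0 t v := by
  have hΔ := E.Δ_pos
  obtain ⟨p, hp⟩ := hc
  refine E.endorsed_of_certQuorum ?_ ?_ (Nat.zero_le p) hg hp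
  · intro j hj hjc t v hv
    obtain ⟨s, hs, rfl, h⟩ := E.softVotes_cases hj hjc hv
    rcases h with ⟨-, hk, ⟨⟨B', hB', hmem⟩, -⟩ | ⟨q, hq, -⟩⟩ | ⟨-, ⟨q, hq, -⟩⟩
    · intro B hB
      rw [hB] at hB'
      obtain rfl := Option.some.inj hB'
      exact ⟨j, hj, hjc, 0, le_rfl, s, hs, by linarith, hmem,
        E.adm.recv_valid j hj _ v ⟨_, hk, rfl⟩⟩
    · omega
    · omega
  · intro j hj hjc s hs v hv
    rw [(E.adm.startVal_rule j hj hjc n 0 s hs).1 rfl] at hv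
    simp at hv

theorem ckptBlock_mem {v : Chain} {B : Block} (h : ckptBlock S v = some B) : B ∈ v := by
  have h1 : B ∈ v.rdrop S.k := List.mem_of_getLast? h
  exact List.mem_of_mem_take (i := v.length - S.k) h1

/-- The value certified by an iteration has recently been held by an honest checkpointer, unless
the iteration ends soon after all honest checkpointers could start it. -/
theorem Fair.certified_fresh (E : Fair S O R) {n M : ℕ} (hM : 1 ≤ M) {σ : ℝ} (hσ : R.gst ≤ σ)
    (hready : ∀ i ∈ S.honest, i ∈ S.ckpt → Ready S R i n 0 σ)
    {g : Node} (hg : g ∈ S.honest) {t : ℝ} {v : Chain} (hc : Certified S R g t n v)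
    (hlead : ∀ p : ℕ, 4 * S.Δ * p ≤ t →
      ∃ q, p ≤ q ∧ q < p + M ∧ O.leader n q ∈ S.honest ∧ O.leader n q ∈ S.ckpt) {B : Block}
    (hB : ckptBlock S v = some B) :
    Decided S R n (σ + 7 * S.Δ * (M + 1)) ∨
    ∃ i ∈ S.honest, ∃ s : ℝ, σ ≤ s ∧ s + S.Δ ≤ t ∧ B ∈ R.chain i s ∧
      Decided S R n (s + 7 * S.Δ * (M + 1)) := by
  classical
  have hΔ := E.Δ_pos
  set W := 7 * S.Δ * ((M : ℝ) + 1) with hW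
  by_cases hdσ : Decided S R n (σ + W)
  · exact Or.inl hdσ
  right
  have hdt : Decided S R n t := ⟨g, hg, v, hc⟩
  -- a time `y` at distance `W` from the decision
  obtain ⟨y, hσy, hny, hy⟩ :
      ∃ y, σ ≤ y ∧ ¬ Decided S R n (y + W - S.Δ) ∧ Decided S R n (y + W) := by
    have hex : ∃ j : ℕ, Decided S R n (σ + W + j * S.Δ) := by
      obtain ⟨j, hj⟩ := exists_nat_gt ((t - σ - W) / S.Δ)
      rw [div_lt_iff₀ hΔ] at hj
      exact ⟨j, hdt.mono (by linarith)⟩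
    have h1 := Nat.find_spec hex
    have h2 : Nat.find hex ≠ 0 := by
      intro h0
      rw [h0] at h1
      exact hdσ (by simpa using h1)
    obtain ⟨j, hj⟩ := Nat.exists_eq_succ_of_ne_zero h2
    have h3 := Nat.find_min hex (m := j) (by omega)
    rw [hj] at h1
    refine ⟨σ + (j + 1) * S.Δ, ?_, ?_, ?_⟩
    · have : 0 ≤ ((j : ℝ) + 1) * S.Δ := by positivity
      linarith
    · intro h; apply h3; convert h using 1; ring
    · convert h1 using 1; push_cast; ring
  have hMr : (1 : ℝ) ≤ M := by exact_mod_cast hM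
  have hyt : y + W - S.Δ < t := by
    by_contra hcon
    push Not at hcon
    exact hny (hdt.mono hcon)
  have hnd : ∀ {x : ℝ}, x ≤ y + W - S.Δ → ¬ Decided S R n x := fun hx h => hny (h.mono hx)
  have hall : ∀ i ∈ S.honest, i ∈ S.ckpt →
      ∃ p, ∃ s : ℝ, R.start i n p = (s : WithTop ℝ) ∧ s ≤ y := by
    intro i hi hic
    obtain ⟨p, -, s, hs, hle⟩ := E.exists_start hi hic (hready i hi hic) (hnd (by nlinarith))
    exact ⟨p, s, hs, hle.trans hσy⟩
  -- the first period that nobody has started by time `y`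
  let P : ℕ → Prop := fun p => ∃ i ∈ S.honest, i ∈ S.ckpt ∧
    ∃ s : ℝ, R.start i n p = (s : WithTop ℝ) ∧ s ≤ y
  have hPdown : ∀ p q, p ≤ q → P q → P p := by
    rintro p q hpq ⟨i, hi, hic, s, hs, hle⟩
    obtain ⟨j, hj, hjc, s', hs', hle'⟩ := E.start_pred_of_le hpq hi hic hs
    have : (0 : ℝ) ≤ 4 * S.Δ * ((q : ℝ) - p) := by
      have : (p : ℝ) ≤ q := by exact_mod_cast hpq
      have := sub_nonneg.2 this
      positivity
    exact ⟨j, hj, hjc, s', hs', by linarith⟩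
  have hP0 : P 0 := by
    obtain ⟨i, hi, hic⟩ := E.exists_honest
    obtain ⟨p, s, hs, hle⟩ := hall i hi hic
    exact hPdown 0 p (Nat.zero_le p) ⟨i, hi, hic, s, hs, hle⟩
  have hPex : ∃ p, ¬ P p := by
    obtain ⟨p, hp⟩ := exists_nat_gt (y / (4 * S.Δ))
    rw [div_lt_iff₀ (by positivity)] at hp
    refine ⟨p, ?_⟩
    rintro ⟨i, hi, hic, s, hs, hle⟩
    have h1 := E.start_time hi hic hs
    have h2 : 0 ≤ (n : ℝ) * S.e := mul_nonneg n.cast_nonneg E.e_pos.le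
    linarith
  have hp0 := Nat.find_spec hPex
  obtain ⟨p, hp⟩ : ∃ p, Nat.find hPex = p + 1 := by
    refine Nat.exists_eq_succ_of_ne_zero fun h0 => ?_
    rw [h0] at hp0
    exact hp0 hP0
  have hPp : P p := not_not.1 (Nat.find_min hPex (m := p) (by omega))
  rw [hp] at hp0
  obtain ⟨j, hj, hjc, sj, hsj, hsjy⟩ := hPp
  obtain ⟨i, hi, hic, p', hp', s', hs', hle'⟩ := E.progress_iter (hσ.trans hσy) hall hj hjc hsj hsjy
    M (hnd (by rw [hW]; nlinarith))
  -- Periods `p + 1, …, p + M` all start after `y`, and by `y + 7ΔM` period `p + M` or a later one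
  -- has begun, so one of them has an honest leader in the right time window.
  obtain ⟨q, hpq, hqM, hlh, hlc⟩ : ∃ q, p + 1 ≤ q ∧ q < p + 1 + M ∧
      O.leader n q ∈ S.honest ∧ O.leader n q ∈ S.ckpt := by
    apply hlead
    have h1 := E.start_time hi hic hs'
    have h2 : 0 ≤ (n : ℝ) * S.e := mul_nonneg n.cast_nonneg E.e_pos.le
    have h3 : ((p + 1 : ℕ) : ℝ) ≤ p' := by exact_mod_cast (by omega : p + 1 ≤ p')
    nlinarith
  obtain ⟨i₁, hi₁, hic₁, s₁, hs₁, hle₁⟩ :=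
    E.start_pred_of_le (by omega : q ≤ p') hi hic hs'
  have hs₁' : s₁ ≤ s' := by
    have : (0 : ℝ) ≤ 4 * S.Δ * ((p' : ℝ) - q) := by
      have : (q : ℝ) ≤ p' := by exact_mod_cast (by omega : q ≤ p')
      have := sub_nonneg.2 this
      positivity
    linarith
  obtain ⟨i₀, hi₀, hic₀, s, hs, hss₁, hfirst⟩ := exists_first_start hi₁ hic₁ hs₁
  have hys : y < s := by
    by_contra hcon
    push Not at hcon
    exact hp0 (hPdown _ _ hpq ⟨i₀, hi₀, hic₀, s, hs, hcon⟩)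
  obtain ⟨q, rfl⟩ : ∃ q', q = q' + 1 := ⟨q - 1, by omega⟩
  -- The period starts by `y + 7ΔM`, so it has `5Δ` to go before `y + W - Δ`, when the iteration is
  -- still undecided.
  obtain ⟨sl, hssl, hsle, hsl, hbot, hfr⟩ := E.honest_leader (by linarith)
    (hnd (by rw [hW]; nlinarith)) hlh hlc hi₀ hic₀ hs hfirst
  obtain ⟨pc, hpc⟩ := hc
  -- A certificate in period `q` or earlier would be locked and contradict the `⊥`-quorum for period
  -- `q`.
  have hqc : q + 1 ≤ pc := by
    by_contra hcon
    obtain ⟨d, rfl⟩ : ∃ d, q = pc + d := ⟨q - pc, by omega⟩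
    obtain ⟨q', hq1, hq2⟩ := hbot
    obtain rfl : pc + d = q' := by omega
    exact absurd (E.certQuorum_lock hg hpc d hlh hq2) (by simp)
  -- In this period every honest checkpointer knows that new proposals are admitted, so its
  -- soft-vote is for the chain that the honest leader held at `sl`.
  have hend : Endorsed S O R n (q + 1) t v := by
    refine E.endorsed_of_certQuorum ?_ ?_ hqc hg hpc
    · intro l hl hlc' x v hv B hB
      obtain ⟨sl', hsl', rfl, h⟩ := E.softVotes_cases hl hlc' hv
      have hk : Knows R l (sl' + 2 * S.Δ) (Msg.proposal n (q + 1) (O.leader n (q + 1)) v) := by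
        rcases h with ⟨-, hk, -⟩ | ⟨h, -⟩
        · exact hk
        · exact absurd (Or.inr (hfr l hl hlc' sl' hsl')) h
      obtain ⟨-, t', -, -, -, hs', h3⟩ := E.adm.unforgeable l hl _ hlh _ _ rfl hk
      rw [hsl] at hs'
      obtain rfl := WithTop.coe_inj.1 hs'
      have hvc : v = R.chain (O.leader n (q + 1)) sl := by
        rcases h3 with ⟨-, h3⟩ | ⟨h3, -⟩
        · exact h3
        · exact absurd (Or.inr hbot) h3
      have := hfirst l hl hlc' sl' hsl'
      refine ⟨_, hlh, hlc, q + 1, le_rfl, sl, hsl, by linarith, hvc ▸ ckptBlock_mem hB,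
        hvc ▸ (E.validChain_chain hlh ?_).mono (by linarith)⟩
      linarith [E.adm.gst_nonneg]
    · intro l hl hlc' x hx v hv
      exact (hfr l hl hlc' x hx).mono (by linarith)
  obtain ⟨i₂, hi₂, hic₂, p₂, hp₂, s₂, hs₂, hle₂, hmem, -⟩ := hend B hB
  have hss₂ : s ≤ s₂ := by
    obtain ⟨l, hl, hlc, x, hx, hle⟩ := E.start_pred_of_le hp₂ hi₂ hic₂ hs₂
    have : (0 : ℝ) ≤ 4 * S.Δ * ((p₂ : ℝ) - (q + 1 : ℕ)) := by
      have : ((q + 1 : ℕ) : ℝ) ≤ p₂ := by exact_mod_cast hp₂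
      have := sub_nonneg.2 this
      positivity
    linarith [hfirst l hl hlc x hx]
  exact ⟨i₂, hi₂, s₂, by linarith, hle₂, hmem, hy.mono (by linarith)⟩

end

section

variable {Node : Type u} {S : Setting Node} {O : Oracle Node} {R : Run Node}

/-! ### Positions of blocks in chains -/

theorem ValidChain.getElem_zero {t : ℝ} {C : Chain} (h : ValidChain O R t C) :
    C[0]? = some Block.genesis := by
  rw [← List.head?_eq_getElem?]; exact h.1

theorem ValidChain.parent_eq {t : ℝ} {C : Chain} (h : ValidChain O R t C) {i : ℕ} {b : Block}
    (hb : C[i + 1]? = some b) : b ≠ Block.genesis ∧ C[i]? = some (R.parent b) := by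
  obtain ⟨hlt, hb⟩ := List.getElem?_eq_some_iff.1 hb
  have := List.isChain_iff_getElem.1 h.2.1 i hlt
  rw [hb] at this
  refine ⟨this.1, ?_⟩
  rw [List.getElem?_eq_getElem (by omega), this.2]

theorem ValidChain.mem_mined {t : ℝ} {C : Chain} (h : ValidChain O R t C) {i : ℕ} {b : Block}
    (hb : C[i]? = some b) : Mined O b :=
  (h.2.2 b (List.mem_of_getElem? hb)).1

theorem ValidChain.time_le {t : ℝ} {C : Chain} (h : ValidChain O R t C) {i : ℕ} {b : Block}
    (hb : C[i + 1]? = some b) : b.time ≤ t :=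
  ((h.2.2 b (List.mem_of_getElem? hb)).2).resolve_left (h.parent_eq hb).1

/-- Following parents down to genesis, a block determines its whole past and in particular its
height. -/
theorem ValidChain.take_eq {t t' : ℝ} {C C' : Chain} (h : ValidChain O R t C)
    (h' : ValidChain O R t' C') {i : ℕ} :
    ∀ {j : ℕ} {b : Block}, C[i]? = some b → C'[j]? = some b →
      i = j ∧ C.take (i + 1) = C'.take (i + 1) := by
  induction i with
  | zero =>
    intro j b hb hb'
    rw [h.getElem_zero] at hb
    obtain rfl := Option.some.inj hb
    cases j with
    | zero =>
      refine ⟨rfl, ?_⟩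
      rw [List.take_add_one, List.take_add_one, h.getElem_zero, h'.getElem_zero]
      simp
    | succ j => exact absurd rfl (h'.parent_eq hb').1
  | succ i ih =>
    intro j b hb hb'
    cases j with
    | zero =>
      rw [h'.getElem_zero] at hb'
      obtain rfl := Option.some.inj hb'
      exact absurd rfl (h.parent_eq hb).1
    | succ j =>
      obtain ⟨rfl, h2⟩ := ih (h.parent_eq hb).2 (h'.parent_eq hb').2
      refine ⟨rfl, ?_⟩
      rw [List.take_add_one, List.take_add_one (l := C'), h2, hb, hb']

/-- `b` is at position `i` of some blockchain. -/
def BlockAt (O : Oracle Node) (R : Run Node) (b : Block) (i : ℕ) : Prop :=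
  ∃ t C, ValidChain O R t C ∧ C[i]? = some b

theorem BlockAt.unique {b : Block} {i j : ℕ} (h : BlockAt O R b i) (h' : BlockAt O R b j) :
    i = j := by
  obtain ⟨t, C, hc, hb⟩ := h
  obtain ⟨t', C', hc', hb'⟩ := h'
  exact (hc.take_eq hc' hb hb').1

theorem ValidChain.getElem_eq {t t' : ℝ} {C C' : Chain} (h : ValidChain O R t C)
    (h' : ValidChain O R t' C') {i j : ℕ} {b : Block} (hb : C[i]? = some b) (hb' : C'[i]? = some b)
    (hji : j ≤ i) : C[j]? = C'[j]? := by
  have := (h.take_eq h' hb hb').2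
  rw [← List.getElem?_take_of_lt (l := C) (by omega : j < i + 1), this,
    List.getElem?_take_of_lt (by omega)]

theorem Fair.time_lt (E : Fair S O R) {t : ℝ} {C : Chain} (h : ValidChain O R t C) {i : ℕ} :
    ∀ {j : ℕ} {b b' : Block}, C[i]? = some b → C[j]? = some b' → i < j → b.time < b'.time := by
  intro j
  induction j with
  | zero => intro b b' _ _ h; omega
  | succ j ih =>
    intro b b' hb hb' hij
    have h1 := h.parent_eq hb'
    have h2 := (E.adm.parent_mined b' h1.1 (h.mem_mined hb')).2
    rcases (Nat.lt_succ_iff.1 hij).eq_or_lt with rfl | hlt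
    · rw [h1.2] at hb
      obtain rfl := Option.some.inj hb
      exact h2
    · exact (ih hb h1.2 hlt).trans h2

theorem Fair.time_pos (E : Fair S O R) {t : ℝ} {C : Chain} (h : ValidChain O R t C) {i : ℕ}
    {b : Block} (hb : C[i]? = some b) (hi : 1 ≤ i) : 0 < b.time :=
  E.time_lt h h.getElem_zero hb hi

theorem Fair.time_nonneg (E : Fair S O R) {t : ℝ} {C : Chain} (h : ValidChain O R t C)
    {b : Block} (hb : b ∈ C) : 0 ≤ b.time := by
  obtain ⟨i, hi⟩ := List.mem_iff_getElem?.1 hb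
  rcases Nat.eq_zero_or_pos i with rfl | hpos
  · rw [h.getElem_zero] at hi
    obtain rfl := Option.some.inj hi
    exact le_rfl
  · exact (E.time_pos h hi hpos).le

/-! ### Growth of the chains of honest nodes -/

/-- Values certified by iteration `m` up to time `N` have been held by honest nodes at most `W`
before the iteration was decided. -/
def Recent (S : Setting Node) (R : Run Node) (W N : ℝ) (m : ℕ) : Prop :=
  ∀ g ∈ S.honest, ∀ t ≤ N, ∀ v, Certified S R g t m v → ∀ B, ckptBlock S v = some B →
    ∃ i ∈ S.honest, ∃ s : ℝ, R.gst ≤ s ∧ s + S.Δ ≤ t ∧ B ∈ R.chain i s ∧ Decided S R m (s + W)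

/-- No iteration is decided shortly before or within `W + Δ` after time `u`. -/
def Quiet (S : Setting Node) (R : Run Node) (W u : ℝ) : Prop :=
  ∀ n, Decided S R n (u + (W + S.Δ)) → Decided S R n (u - 2 * S.Δ)

/-- From time `T₀` on, newly certified values are recent. -/
structure Settled (S : Setting Node) (O : Oracle Node) (R : Run Node) (W T₀ N : ℝ) : Prop
    extends Fair S O R where
  gst_le : R.gst ≤ T₀
  W_nonneg : 0 ≤ W
  recent : ∀ m, Decided S R m N → Decided S R m T₀ ∨ Recent S R W N m

/-- Certified values are unique per iteration, so one certificate of the last iteration suffices. -/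
theorem Fair.extendsLast_of_last (E : Fair S O R) {g : Node} (hg : g ∈ S.honest) {t : ℝ} {m : ℕ}
    {v : Chain} (hc : Certified S R g t m v)
    (hmax : ∀ n' v', Certified S R g t n' v' → n' ≤ m) {c : Chain}
    (hB : ∀ B, ckptBlock S v = some B → B ∈ c) : ExtendsLast S R g t c := by
  intro n v' hc' hmax' B hB'
  obtain rfl : n = m := le_antisymm (hmax n v' hc') (hmax' m v hc)
  rw [E.certified_unique hg hg hc' hc] at hB'
  exact hB B hB'

variable {W T₀ N : ℝ}

/-- At time `t` node `g` can choose a chain at least as long as that of `h` at `u`. The quiet time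
`u` leaves two cases for the last checkpoint of `g`: it is old enough that `h` already respected it,
or so new that it was taken from an honest chain held after `u + Δ`. The second case is reduced to
that earlier chain by induction in steps of `Δ`. -/
theorem Settled.growth (E : Settled S O R W T₀ N) {u : ℝ} (hu : T₀ + 2 * S.Δ ≤ u)
    (hquiet : Quiet S R W u) {h : Node} (hh : h ∈ S.honest) (k : ℕ) :
    ∀ g ∈ S.honest, ∀ t, u + S.Δ ≤ t → t ≤ N → t ≤ u + k * S.Δ →
      (R.chain h u).length ≤ (R.chain g t).length := by
  have hΔ := E.Δ_pos
  have hT₀ := E.gst_le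
  have hg0 := E.adm.gst_nonneg
  have hW := E.W_nonneg
  induction k with
  | zero => intro g hg t h1 h2 h3; simp at h3; linarith
  | succ k ih =>
    intro g hg t hut htN htk
    have hku : KnowsChain R g t (R.chain h u) :=
      E.knowsChain_relay hh hg (E.knowsChain_chain hh (by linarith)) hut (by linarith)
    obtain ⟨-, -, hlong⟩ := E.adm.chain_rule g hg t (by linarith)
    by_cases hlast : ∃ m v, Certified S R g t m v ∧ ∀ n' v', Certified S R g t n' v' → n' ≤ m
    · obtain ⟨m, v, hc, hmax⟩ := hlast
      by_cases hd : Decided S R m (u - 2 * S.Δ)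
      · refine hlong _ hku (E.extendsLast_of_last hg hc hmax ?_)
        obtain ⟨v', hv'⟩ := E.decided_relay hh hd (t' := u) (by linarith) (by linarith)
        rw [E.certified_unique hg hh hc hv']
        refine (E.adm.chain_rule h hh u (by linarith)).2.1 m v' hv' fun n' v'' h'' => ?_
        exact hmax n' v'' (E.certified_relay hh hg h'' hut (by linarith))
      · have hd' : ¬ Decided S R m (u + (W + S.Δ)) := fun h => hd (hquiet m h)
        have hrec : Recent S R W N m := by
          refine (E.recent m ⟨g, hg, v, hc.mono htN⟩).resolve_left fun h => hd (h.mono ?_)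
          linarith
        cases hB : ckptBlock S v with
        | none =>
          exact hlong _ hku (E.extendsLast_of_last hg hc hmax fun B h => by simp [hB] at h)
        | some B =>
          obtain ⟨i, hi, s, hgs, hst, hmem, hds⟩ := hrec g hg t htN v hc B hB
          -- The decision comes later than `u + W + Δ` and at most `W` after `s`.
          have hus : u + S.Δ ≤ s := by
            by_contra hcon
            push Not at hcon
            exact hd' (hds.mono (by linarith))
          have h1 := ih i hi s hus (by linarith) (by push_cast at htk; linarith)
          refine h1.trans (hlong _ ?_ (E.extendsLast_of_last hg hc hmax fun B' h => ?_))
          · exact E.knowsChain_relay hi hg (E.knowsChain_chain hi (by linarith)) hst (by linarith)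
          · rw [hB] at h
            obtain rfl := Option.some.inj h
            exact hmem
    · push Not at hlast
      refine hlong _ hku fun n v hc hmax => ?_
      obtain ⟨n', v', h1, h2⟩ := hlast n v hc
      exact absurd (hmax n' v' h1) (by omega)

theorem Settled.length_le (E : Settled S O R W T₀ N) {u : ℝ} (hu : T₀ + 2 * S.Δ ≤ u)
    (hquiet : Quiet S R W u) {h g : Node} (hh : h ∈ S.honest) (hg : g ∈ S.honest) {t : ℝ}
    (hut : u + S.Δ ≤ t) (htN : t ≤ N) : (R.chain h u).length ≤ (R.chain g t).length := by
  obtain ⟨k, hk⟩ := exists_nat_gt ((t - u) / S.Δ)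
  rw [div_lt_iff₀ E.Δ_pos] at hk
  exact E.growth hu hquiet hh k g hg t hut htN (by linarith)

/-! ### Blocks at convergence opportunities -/

/-- `τ` is the mining time of an honest block that is isolated and mined in a quiet time. -/
structure GoodTime (S : Setting Node) (O : Oracle Node) (R : Run Node) (W T₀ N τ : ℝ) :
    Prop where
  mem : τ ∈ O.honestTimes
  isolated : ∀ τ' ∈ O.honestTimes, τ' ≠ τ → S.Δ < |τ' - τ|
  quiet : Quiet S R W τ
  late : T₀ + 2 * S.Δ ≤ τ
  le : τ ≤ N

/-- The chain with which the block mined at time `τ` is broadcast. -/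
theorem Settled.mined_chain (E : Settled S O R W T₀ N) {τ : ℝ} (hτ : GoodTime S O R W T₀ N τ)
    {y : ℝ} (hy : y < τ) :
    ∃ c : Chain, 1 ≤ c.length ∧ BlockAt O R (Block.honest τ) c.length ∧
      (∃ s, y < s ∧ s < τ ∧ R.chain (R.miner τ) s = c) ∧
      c.length + 1 ≤ (R.chain (R.miner τ) τ).length := by
  have hΔ := E.Δ_pos
  have hT₀ := E.gst_le
  have hg0 := E.adm.gst_nonneg
  have hW := E.W_nonneg
  have hlate := hτ.late
  have hm := E.adm.miner_honest τ hτ.mem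
  obtain ⟨c, hev, hlast, hk⟩ := E.adm.mining_rule τ hτ.mem
  have hkc : KnowsChain R (R.miner τ) τ (c ++ [Block.honest τ]) := ⟨_, hk, rfl⟩
  have hvalid := E.adm.recv_valid _ hm τ _ hkc
  have hev' : ∀ᶠ s in 𝓝[<] τ, (R.chain (R.miner τ) s = c ∧ max y (τ - S.Δ) < s) ∧ s < τ :=
    (hev.and (eventually_nhdsWithin_of_eventually_nhds
      (lt_mem_nhds (max_lt hy (by linarith))))).and eventually_mem_nhdsWithin
  obtain ⟨s, ⟨hsc, hs1⟩, hs2⟩ := hev'.exists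
  have hys := (le_max_left _ _).trans_lt hs1
  have hΔs := (le_max_right _ _).trans_lt hs1
  refine ⟨c, ?_, ⟨τ, _, hvalid, by simp⟩, ⟨s, hys, hs2, hsc⟩, ?_⟩
  · by_contra hcon
    have : c = [] := List.eq_nil_of_length_eq_zero (by omega)
    rw [this] at hlast
    simp at hlast
  have := (E.adm.chain_rule _ hm τ (by linarith)).2.2 _ hkc ?_
  · simpa using this
  -- The new block must not be lost to a checkpoint arriving at `τ`. Since `τ` is quiet, the miner
  -- already knew its last checkpoint at the slightly earlier time `s`, and `c` contains it.
  intro n v hc hmax B hB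
  have hd : Decided S R n (τ - 2 * S.Δ) :=
    hτ.quiet n ⟨_, hm, v, hc.mono (by linarith)⟩
  obtain ⟨v', hv'⟩ := E.decided_relay hm hd (t' := s) (by linarith) (by linarith)
  rw [E.certified_unique hm hm hc hv'] at hB
  have := (E.adm.chain_rule _ hm s (by linarith)).2.1 n v' hv' (fun n' v'' h => ?_) B hB
  · rw [hsc] at this
    simp [this]
  · exact hmax n' v'' (h.mono hs2.le)

theorem Settled.good_position (E : Settled S O R W T₀ N) {τ : ℝ} (hτ : GoodTime S O R W T₀ N τ) :
    ∃ i, 1 ≤ i ∧ BlockAt O R (Block.honest τ) i ∧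
      ∀ g ∈ S.honest, ∀ t, τ + S.Δ ≤ t → t ≤ N → i < (R.chain g t).length := by
  obtain ⟨c, h1, h2, -, h3⟩ := E.mined_chain hτ (sub_one_lt τ)
  refine ⟨c.length, h1, h2, fun g hg t ht htN => ?_⟩
  have := E.length_le hτ.late hτ.quiet (E.adm.miner_honest τ hτ.mem) hg ht htN
  omega

/-- The later block is more than `Δ` younger, so its miner already held a chain longer than the
height of the earlier one. -/
theorem Settled.good_position_lt (E : Settled S O R W T₀ N) {τ τ' : ℝ}
    (hτ : GoodTime S O R W T₀ N τ) (hτ' : GoodTime S O R W T₀ N τ') (hlt : τ < τ') {i j : ℕ}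
    (hi : BlockAt O R (Block.honest τ) i) (hj : BlockAt O R (Block.honest τ') j) : i < j := by
  have hsep := hτ.isolated τ' hτ'.mem hlt.ne'
  rw [abs_of_pos (by linarith)] at hsep
  obtain ⟨i', -, h2, h3⟩ := E.good_position hτ
  obtain rfl := hi.unique h2
  obtain ⟨c, -, h5, ⟨s, hs1, hs2, hsc⟩, -⟩ := E.mined_chain hτ' (y := τ + S.Δ) (by linarith)
  obtain rfl := hj.unique h5
  rw [← hsc]
  exact h3 _ (E.adm.miner_honest τ' hτ'.mem) s hs1.le (hs2.le.trans hτ'.le)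

theorem Settled.good_position_inj (E : Settled S O R W T₀ N) {τ τ' : ℝ}
    (hτ : GoodTime S O R W T₀ N τ) (hτ' : GoodTime S O R W T₀ N τ') {i : ℕ}
    (hi : BlockAt O R (Block.honest τ) i) (hj : BlockAt O R (Block.honest τ') i) : τ = τ' := by
  rcases lt_trichotomy τ τ' with h | h | h
  · exact absurd (E.good_position_lt hτ hτ' h hi hj) (lt_irrefl _)
  · exact h
  · exact absurd (E.good_position_lt hτ' hτ h hj hi) (lt_irrefl _)

/-- The block is the honest block of a good time. -/
def GoodBlock (S : Setting Node) (O : Oracle Node) (R : Run Node) (W T₀ N : ℝ) (b : Block) :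
    Prop := ∃ τ, b = Block.honest τ ∧ GoodTime S O R W T₀ N τ

/-- If each good block in an interval is matched by another block at the same position, then at
most half of the blocks are good. -/
theorem Settled.two_mul_good_le (E : Settled S O R W T₀ N) {τ₀ x z : ℝ} (hxz : x ≤ z)
    (hH : (O.honestTimes ∩ Set.Iic z).Finite) (hA : (O.advTimes ∩ Set.Iic z).Finite)
    (hmatch : ∀ τ, GoodTime S O R W T₀ N τ → τ₀ < τ → τ ≤ x → ∃ b, b ≠ Block.genesis ∧
      Mined O b ∧ τ₀ < b.time ∧ b.time ≤ z ∧ ¬ GoodBlock S O R W T₀ N b ∧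
      ∃ i, BlockAt O R (Block.honest τ) i ∧ BlockAt O R b i) :
    2 * {τ | GoodTime S O R W T₀ N τ ∧ τ₀ < τ ∧ τ ≤ x}.ncard ≤
      (O.honestTimes ∩ Set.Ioc τ₀ z).ncard + (O.advTimes ∩ Set.Ioc τ₀ z).ncard := by
  classical
  set G := {τ | GoodTime S O R W T₀ N τ ∧ τ₀ < τ ∧ τ ≤ x}
  set U : Set Block := Block.honest '' (O.honestTimes ∩ Set.Ioc τ₀ z) ∪
    Block.adversarial '' (O.advTimes ∩ Set.Ioc τ₀ z)
  have hHf : (O.honestTimes ∩ Set.Ioc τ₀ z).Finite :=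
    hH.subset (Set.inter_subset_inter_right _ Set.Ioc_subset_Iic_self)
  have hAf : (O.advTimes ∩ Set.Ioc τ₀ z).Finite :=
    hA.subset (Set.inter_subset_inter_right _ Set.Ioc_subset_Iic_self)
  have hUf : U.Finite := (hHf.image _).union (hAf.image _)
  have hGsub : G ⊆ O.honestTimes ∩ Set.Ioc τ₀ z := fun τ hτ =>
    ⟨hτ.1.mem, hτ.2.1, hτ.2.2.trans hxz⟩
  have hGf : G.Finite := hHf.subset hGsub
  have hchoice : ∀ τ : G, ∃ b, b ≠ Block.genesis ∧
      Mined O b ∧ τ₀ < b.time ∧ b.time ≤ z ∧ ¬ GoodBlock S O R W T₀ N b ∧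
      ∃ i, BlockAt O R (Block.honest τ) i ∧ BlockAt O R b i :=
    fun τ => hmatch τ τ.2.1 τ.2.2.1 τ.2.2.2
  choose f hf1 hf2 hf3 hf4 hf5 hf6 using hchoice
  -- Matched blocks share heights with good blocks, and different good blocks have different
  -- heights.
  have hfinj : Function.Injective f := by
    intro τ τ' h
    obtain ⟨i, h1, h2⟩ := hf6 τ
    obtain ⟨j, h3, h4⟩ := hf6 τ'
    rw [h] at h2
    obtain rfl := h2.unique h4
    exact Subtype.ext (E.good_position_inj τ.2.1 τ'.2.1 h1 h3)
  have hrange : (Set.range f).ncard = G.ncard := by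
    rw [← Set.image_univ, Set.ncard_image_of_injective _ hfinj, Set.ncard_univ,
      Nat.card_coe_set_eq]
  have hhinj : Function.Injective Block.honest := fun a b h => by injection h
  have hainj : Function.Injective Block.adversarial := fun a b h => by injection h
  have hdisj : Disjoint (Block.honest '' G) (Set.range f) := by
    rw [Set.disjoint_left]
    rintro _ ⟨τ, hτ, rfl⟩ ⟨τ', h⟩
    exact hf5 τ' ⟨τ, h, hτ.1⟩
  have hsub : Block.honest '' G ∪ Set.range f ⊆ U := by
    rintro b (⟨τ, hτ, rfl⟩ | ⟨τ, rfl⟩)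
    · exact Or.inl ⟨τ, hGsub hτ, rfl⟩
    · have h1 := hf1 τ
      have h2 := hf2 τ
      have h3 := hf3 τ
      have h4 := hf4 τ
      cases hb : f τ with
      | genesis => exact absurd hb h1
      | honest y => rw [hb] at h2 h3 h4; exact Or.inl ⟨y, ⟨h2, h3, h4⟩, rfl⟩
      | adversarial y => rw [hb] at h2 h3 h4; exact Or.inr ⟨y, ⟨h2, h3, h4⟩, rfl⟩
  have hcard := Set.ncard_le_ncard hsub hUf
  rw [Set.ncard_union_eq hdisj (hGf.image _) (hUf.subset (Set.subset_union_right.trans hsub)),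
    Set.ncard_image_of_injective _ hhinj, hrange] at hcard
  have h5 : U.ncard ≤ (O.honestTimes ∩ Set.Ioc τ₀ z).ncard + (O.advTimes ∩ Set.Ioc τ₀ z).ncard := by
    refine (Set.ncard_union_le _ _).trans ?_
    rw [Set.ncard_image_of_injective _ hhinj, Set.ncard_image_of_injective _ hainj]
  omega

end

section

variable {Node : Type u} {S : Setting Node} {O : Oracle Node} {R : Run Node}
variable {W T₀ N T₁ ℓ : ℝ}

/-! ### Common prefix and chain quality from dominance of good blocks -/

/-- In intervals of length at least `ℓ` that end after time `T₁`, more than half of the blocks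
are good. -/
structure Dominant (S : Setting Node) (O : Oracle Node) (R : Run Node) (W T₀ N T₁ ℓ : ℝ) : Prop
    extends Settled S O R W T₀ N where
  finite_honest : ∀ z, (O.honestTimes ∩ Set.Iic z).Finite
  finite_adv : ∀ z, (O.advTimes ∩ Set.Iic z).Finite
  lt_two_mul : ∀ τ₀ z, (τ₀ = 0 ∨ GoodTime S O R W T₀ N τ₀) → τ₀ + ℓ ≤ z → T₁ ≤ z → z ≤ N →
    (O.honestTimes ∩ Set.Ioc τ₀ z).ncard + (O.advTimes ∩ Set.Ioc τ₀ z).ncard <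
      2 * {τ | GoodTime S O R W T₀ N τ ∧ τ₀ < τ ∧ τ ≤ z - 2 * S.Δ}.ncard

/-- The last position below `n` with the property `P`, if there is any. -/
theorem exists_last_or_none (P : ℕ → Prop) (n : ℕ) :
    (∀ i < n, ¬ P i) ∨ ∃ i < n, P i ∧ ∀ j < n, P j → j ≤ i := by
  classical
  by_cases h : ∃ i < n, P i
  · right
    obtain ⟨i, hi, hPi⟩ := h
    obtain ⟨m, hm, hmax⟩ := Finset.exists_max_image ((Finset.range n).filter P) id
      ⟨i, Finset.mem_filter.2 ⟨Finset.mem_range.2 hi, hPi⟩⟩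
    obtain ⟨h1, h2⟩ := Finset.mem_filter.1 hm
    exact ⟨m, Finset.mem_range.1 h1, h2, fun j hj hPj =>
      hmax j (Finset.mem_filter.2 ⟨Finset.mem_range.2 hj, hPj⟩)⟩
  · left
    push Not at h
    exact h

/-- Let `τ₀` be the time of the last good block on both chains, or `0`. It is at most the time of
`B`, as otherwise the shared past would contain `B`. Above `τ₀` a good block lies on at most one of
the two chains, so the other one supplies a block that is not good at the same height, against
dominance. -/
theorem Dominant.mem_step (D : Dominant S O R W T₀ N T₁ ℓ) {x y : ℝ} (hx : 0 ≤ x) (hxy : x ≤ y)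
    (hyx : y ≤ x + S.Δ) (hyN : y ≤ N) (hyT : T₁ ≤ y) {i j : Node} (hi : i ∈ S.honest)
    (hj : j ∈ S.honest) {B : Block} (hB : B ∈ R.chain i x) (hBy : B.time + ℓ ≤ y) :
    B ∈ R.chain j y := by
  by_contra hcon
  have hΔ := D.Δ_pos
  set C := R.chain i x
  set C' := R.chain j y
  have hC : ValidChain O R x C := D.validChain_chain hi hx
  have hC' : ValidChain O R y C' := D.validChain_chain hj (hx.trans hxy)
  obtain ⟨iB, hiB⟩ := List.mem_iff_getElem?.1 hB
  obtain ⟨τ₀, hτ₀, hτB, hlow⟩ : ∃ τ₀, (τ₀ = 0 ∨ GoodTime S O R W T₀ N τ₀) ∧ τ₀ ≤ B.time ∧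
      ∀ τ, GoodTime S O R W T₀ N τ → τ₀ < τ → ∀ m, 1 ≤ m → BlockAt O R (Block.honest τ) m →
        ¬ (C[m]? = some (Block.honest τ) ∧ C'[m]? = some (Block.honest τ)) ∧
        (∀ b, C[m]? = some b → τ₀ < b.time) ∧ (∀ b, C'[m]? = some b → τ₀ < b.time) := by
    rcases exists_last_or_none (fun m => ∃ τ, GoodTime S O R W T₀ N τ ∧
      C[m]? = some (Block.honest τ) ∧ C'[m]? = some (Block.honest τ)) C.length with h | h
    · refine ⟨0, Or.inl rfl, D.time_nonneg hC hB, fun τ hτ _ m hm _ => ⟨fun h2 => ?_,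
        fun b hb => D.time_pos hC hb hm, fun b hb => D.time_pos hC' hb hm⟩⟩
      exact h m (List.getElem?_eq_some_iff.1 h2.1).1 ⟨τ, hτ, h2⟩
    · obtain ⟨i₀, -, ⟨τ₀, hτ₀, h1, h2⟩, hmax⟩ := h
      refine ⟨τ₀, Or.inr hτ₀, ?_, fun τ hτ hlt m hm hat => ?_⟩
      · rcases lt_or_ge i₀ iB with hlt | hge
        · exact (D.time_lt hC h1 hiB hlt).le
        · exfalso
          apply hcon
          rw [hC.getElem_eq hC' h1 h2 hge] at hiB
          exact List.mem_of_getElem? hiB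
      · have hlt' : i₀ < m := D.good_position_lt hτ₀ hτ hlt ⟨_, _, hC, h1⟩ hat
        refine ⟨fun h3 => ?_, fun b hb => D.time_lt hC h1 hb hlt',
          fun b hb => D.time_lt hC' h2 hb hlt'⟩
        have := hmax m (List.getElem?_eq_some_iff.1 h3.1).1 ⟨τ, hτ, h3⟩
        omega
  have h1 := D.lt_two_mul τ₀ y hτ₀ (by linarith) hyT hyN
  refine absurd h1 (not_lt.2 (D.two_mul_good_le (by linarith) (D.finite_honest y)
    (D.finite_adv y) ?_))
  intro τ hτ hτ₀τ hτy
  obtain ⟨m, hm, hat, hlen⟩ := D.good_position hτ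
  obtain ⟨hn, ht, ht'⟩ := hlow τ hτ hτ₀τ m hm hat
  -- The margin `2Δ` in the range of good times ensures `τ + Δ ≤ y - Δ ≤ x`, so both chains reach
  -- the height in question.
  have hl := hlen i hi x (by linarith) (by linarith)
  have hl' := hlen j hj y (by linarith) hyN
  obtain ⟨b, hb⟩ : ∃ b, C[m]? = some b := ⟨_, List.getElem?_eq_getElem hl⟩
  obtain ⟨b', hb'⟩ : ∃ b, C'[m]? = some b := ⟨_, List.getElem?_eq_getElem hl'⟩
  obtain ⟨m', rfl⟩ : ∃ m', m = m' + 1 := ⟨m - 1, by omega⟩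
  by_cases hg : GoodBlock S O R W T₀ N b
  · by_cases hg' : GoodBlock S O R W T₀ N b'
    · exfalso
      obtain ⟨σ, rfl, hσ⟩ := hg
      obtain ⟨σ', rfl, hσ'⟩ := hg'
      obtain rfl := D.good_position_inj hτ hσ hat ⟨_, _, hC, hb⟩
      obtain rfl := D.good_position_inj hτ hσ' hat ⟨_, _, hC', hb'⟩
      exact hn ⟨hb, hb'⟩
    · exact ⟨b', (hC'.parent_eq hb').1, hC'.mem_mined hb', ht' b' hb', hC'.time_le hb', hg',
        m' + 1, hat, _, _, hC', hb'⟩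
  · exact ⟨b, (hC.parent_eq hb).1, hC.mem_mined hb, ht b hb, (hC.time_le hb).trans hxy, hg,
      m' + 1, hat, _, _, hC, hb⟩

/-- A sufficiently old block in the chain of an honest node stays in all honest chains. -/
theorem Dominant.mem_stable (D : Dominant S O R W T₀ N T₁ ℓ) {t₁ t₂ : ℝ} (ht₁ : 0 ≤ t₁)
    (hT : T₁ ≤ t₁) (h12 : t₁ ≤ t₂) (htN : t₂ ≤ N) {i j : Node} (hi : i ∈ S.honest)
    (hj : j ∈ S.honest) {B : Block} (hB : B ∈ R.chain i t₁) (hBt : B.time + ℓ ≤ t₁) :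
    B ∈ R.chain j t₂ := by
  have hΔ := D.Δ_pos
  have key : ∀ k : ℕ, ∀ j ∈ S.honest, ∀ t, t₁ ≤ t → t ≤ t₁ + k * S.Δ → t ≤ N →
      B ∈ R.chain j t := by
    intro k
    induction k with
    | zero =>
      intro j hj t h1 h2 h3
      simp only [Nat.cast_zero, zero_mul, add_zero] at h2
      obtain rfl : t₁ = t := le_antisymm h1 h2
      exact D.mem_step ht₁ le_rfl (by linarith) h3 hT hi hj hB hBt
    | succ k ih =>
      intro j hj t h1 h2 h3
      push_cast at h2
      have hk : 0 ≤ (k : ℝ) * S.Δ := by positivity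
      have hx : max t₁ (t - S.Δ) ≤ t := max_le h1 (by linarith)
      have hx1 := le_max_left t₁ (t - S.Δ)
      have hx2 := le_max_right t₁ (t - S.Δ)
      refine D.mem_step (by linarith) hx (by linarith) h3 (by linarith) hj hj
        (ih j hj _ hx1 (max_le (by linarith) (by linarith)) (hx.trans h3)) (by linarith)
  obtain ⟨k, hk⟩ := exists_nat_gt ((t₂ - t₁) / S.Δ)
  rw [div_lt_iff₀ hΔ] at hk
  exact key k j hj t₂ h12 (by linarith) htN

/-- The number of blocks mined in the interval `(a, b]`. -/
noncomputable def mined (O : Oracle Node) (a b : ℝ) : ℕ :=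
  (O.honestTimes ∩ Set.Ioc a b).ncard + (O.advTimes ∩ Set.Ioc a b).ncard

/-- The blocks of a chain at positions `[a, a + k)` are counted by `mined`. -/
theorem ValidChain.le_mined {t : ℝ} {C : Chain} (hC : ValidChain O R t C)
    (hH : ∀ z, (O.honestTimes ∩ Set.Iic z).Finite) (hA : ∀ z, (O.advTimes ∩ Set.Iic z).Finite)
    {a k : ℕ} (hlen : a + k ≤ C.length)
    {x z : ℝ} (ha : 1 ≤ a)
    (htime : ∀ m b, a ≤ m → m < a + k → C[m]? = some b → x < b.time ∧ b.time ≤ z) :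
    k ≤ mined O x z := by
  classical
  set U : Set Block := Block.honest '' (O.honestTimes ∩ Set.Ioc x z) ∪
    Block.adversarial '' (O.advTimes ∩ Set.Ioc x z)
  have hHf : (O.honestTimes ∩ Set.Ioc x z).Finite :=
    (hH z).subset (Set.inter_subset_inter_right _ Set.Ioc_subset_Iic_self)
  have hAf : (O.advTimes ∩ Set.Ioc x z).Finite :=
    (hA z).subset (Set.inter_subset_inter_right _ Set.Ioc_subset_Iic_self)
  have hUf : U.Finite := (hHf.image _).union (hAf.image _)
  have hhinj : Function.Injective Block.honest := fun a b h => by injection h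
  have hainj : Function.Injective Block.adversarial := fun a b h => by injection h
  let f : Fin k → Block := fun m => C[a + m.1]'(by omega)
  have hfget : ∀ m : Fin k, C[a + m.1]? = some (f m) := fun m => List.getElem?_eq_getElem _
  have hfinj : Function.Injective f := by
    intro m m' h
    have h1 := hfget m
    have h2 := hfget m'
    rw [h] at h1
    have := (hC.take_eq hC h1 h2).1
    exact Fin.ext (by omega)
  have hsub : Set.range f ⊆ U := by
    rintro _ ⟨m, rfl⟩
    have h1 := hfget m
    obtain ⟨h3, h4⟩ := htime _ _ (by omega) (by omega) h1
    have h2 := hC.mem_mined h1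
    obtain ⟨q, hq⟩ : ∃ q, a + m.1 = q + 1 := ⟨a + m.1 - 1, by omega⟩
    rw [hq] at h1
    have h5 := (hC.parent_eq h1).1
    cases hb : f m with
    | genesis => exact absurd hb h5
    | honest y => rw [hb] at h2 h3 h4; exact Or.inl ⟨y, ⟨h2, h3, h4⟩, rfl⟩
    | adversarial y => rw [hb] at h2 h3 h4; exact Or.inr ⟨y, ⟨h2, h3, h4⟩, rfl⟩
  have hcard := Set.ncard_le_ncard hsub hUf
  rw [← Set.image_univ, Set.ncard_image_of_injective _ hfinj, Set.ncard_univ, Nat.card_fin]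
    at hcard
  refine hcard.trans ((Set.ncard_union_le _ _).trans ?_)
  rw [Set.ncard_image_of_injective _ hhinj, Set.ncard_image_of_injective _ hainj]
  rfl

/-- Blocks that are `k`-deep are old. -/
theorem Fair.ckptBlock_old (E : Fair S O R)
    (hH : ∀ z, (O.honestTimes ∩ Set.Iic z).Finite) (hA : ∀ z, (O.advTimes ∩ Set.Iic z).Finite)
    {t : ℝ} {C : Chain} (hC : ValidChain O R t C) {B : Block} (hB : ckptBlock S C = some B) :
    0 ≤ B.time ∧ S.k ≤ mined O B.time t ∧ ∃ m, C[m]? = some B ∧ m + S.k + 1 = C.length := by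
  have h1 : (C.take (C.length - S.k)).getLast? = some B := hB
  have hpos : 0 < C.length - S.k := by
    by_contra hcon
    have : C.length - S.k = 0 := by omega
    rw [this] at h1
    simp at h1
  rw [List.getLast?_eq_getElem?, List.length_take, min_eq_left (Nat.sub_le _ _),
    List.getElem?_take_of_lt (by omega)] at h1
  refine ⟨E.time_nonneg hC (ckptBlock_mem hB), ?_, _, h1, by omega⟩
  refine hC.le_mined hH hA (a := C.length - S.k) (by omega) (by omega) ?_
  intro m b hm _ hb
  refine ⟨E.time_lt hC h1 hb (by omega), ?_⟩
  obtain ⟨q, rfl⟩ : ∃ q, m = q + 1 := ⟨m - 1, by omega⟩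
  exact hC.time_le hb

/-- By the density of blocks the `k`-deep block is old, hence stable, and a shared block carries its
whole past along. -/
theorem Dominant.common_prefix (D : Dominant S O R W T₀ N T₁ ℓ)
    (hdense : ∀ x z, 0 ≤ x → z ≤ N → S.k ≤ mined O x z → x + ℓ ≤ z) {t₁ t₂ : ℝ} (ht₁ : 0 ≤ t₁)
    (hT : S.k ≤ mined O 0 t₁ → T₁ ≤ t₁) (h12 : t₁ ≤ t₂) (htN : t₂ ≤ N) {i j : Node}
    (hi : i ∈ S.honest) (hj : j ∈ S.honest) :
    (R.chain i t₁).rdrop S.k <+: R.chain j t₂ := by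
  have hC := D.validChain_chain hi ht₁
  have hC' := D.validChain_chain hj (ht₁.trans h12)
  cases hB : ckptBlock S (R.chain i t₁) with
  | none =>
    have : (R.chain i t₁).rdrop S.k = [] := List.getLast?_eq_none_iff.1 hB
    rw [this]
    exact List.nil_prefix
  | some B =>
    obtain ⟨h0, h1, m, hm, hlen⟩ := D.ckptBlock_old D.finite_honest D.finite_adv hC hB
    have hmem := D.mem_stable ht₁ (hT ?_) h12 htN hi hj (ckptBlock_mem hB)
      (hdense _ _ h0 (h12.trans htN) h1)
    · obtain ⟨m', hm'⟩ := List.mem_iff_getElem?.1 hmem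
      obtain ⟨-, h2⟩ := hC.take_eq hC' hm hm'
      have : (R.chain i t₁).rdrop S.k = (R.chain i t₁).take (m + 1) := by
        rw [List.rdrop]; congr 1; omega
      rw [this, h2]
      exact List.take_prefix _ _
    · refine hC.le_mined D.finite_honest D.finite_adv (a := m + 1) (by omega) (by omega) ?_
      intro m' b hm' _ hb
      refine ⟨D.time_pos hC hb (by omega), ?_⟩
      obtain ⟨q, rfl⟩ : ∃ q, m' = q + 1 := ⟨m' - 1, by omega⟩
      exact hC.time_le hb

/-- A segment without honest blocks is extended to the nearest good blocks of the chain on both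
sides. Good blocks mined in between have heights strictly inside this stretch, where the chain has
no good block at all, so the chain itself supplies the matching. -/
theorem Dominant.chain_quality (D : Dominant S O R W T₀ N T₁ ℓ) {k : ℕ} (hk : 1 ≤ k)
    (hdense : ∀ x z, 0 ≤ x → z ≤ N → k ≤ mined O x z → x + ℓ ≤ z) {t : ℝ} (ht : 0 ≤ t)
    (htN : t ≤ N) {h : Node} (hh : h ∈ S.honest) {L : List Block} (hL : L <:+: R.chain h t)
    (hLk : L.length = k) (hgen : ∀ b ∈ L, b ≠ Block.genesis)
    (hT : ∀ z ≤ N, (∀ b ∈ L, b.time ≤ z) → k ≤ mined O 0 z → T₁ ≤ z) :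
    ∃ b ∈ L, b.IsHonest := by
  by_contra hcon
  push Not at hcon
  have hΔ := D.Δ_pos
  have hC := D.validChain_chain hh ht
  set C := R.chain h t
  obtain ⟨pre, post, hC_eq⟩ := hL
  set a := pre.length with ha
  have hCl : C.length = a + k + post.length := by rw [← hC_eq]; simp [hLk, ha, add_assoc]
  have hLget : ∀ m b, a ≤ m → m < a + k → C[m]? = some b → b ∈ L := by
    intro m b h1 h2 h3
    rw [← hC_eq, List.getElem?_append_left (by simp; omega),
      List.getElem?_append_right (by omega)] at h3
    exact List.mem_of_getElem? h3
  have hLget' : ∀ b ∈ L, ∃ m, a ≤ m ∧ m < a + k ∧ C[m]? = some b := by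
    intro b hb
    obtain ⟨m, hm⟩ := List.mem_iff_getElem?.1 hb
    have hlt := (List.getElem?_eq_some_iff.1 hm).1
    refine ⟨a + m, by omega, by omega, ?_⟩
    rw [← hC_eq, List.getElem?_append_left (by simp; omega),
      List.getElem?_append_right (by omega)]
    simpa [ha] using hm
  have ha1 : 1 ≤ a := by
    by_contra hcon'
    have h0 : C[0]? = some Block.genesis := hC.getElem_zero
    exact hgen _ (hLget 0 _ (by omega) (by omega) h0) rfl
  let P : ℕ → Prop := fun m => ∃ τ, GoodTime S O R W T₀ N τ ∧ C[m]? = some (Block.honest τ)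
  -- the last good block before the segment
  obtain ⟨τ₀, hτ₀, hτ₀0, hlow⟩ : ∃ τ₀, (τ₀ = 0 ∨ GoodTime S O R W T₀ N τ₀) ∧ 0 ≤ τ₀ ∧
      ((∀ m b, a ≤ m → C[m]? = some b → τ₀ < b.time) ∧
      ∀ τ, GoodTime S O R W T₀ N τ → τ₀ < τ → ∀ m, 1 ≤ m → BlockAt O R (Block.honest τ) m →
        (m < a → ¬ P m) ∧ (∀ b, C[m]? = some b → τ₀ < b.time)) := by
    rcases exists_last_or_none P a with h1 | ⟨i₀, hi₀, ⟨τ₀, hτ₀, h1⟩, hmax⟩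
    · refine ⟨0, Or.inl rfl, le_rfl, fun m b hm hb => D.time_pos hC hb (by omega),
        fun τ _ _ m hm _ => ⟨h1 m, fun b hb => D.time_pos hC hb hm⟩⟩
    · refine ⟨τ₀, Or.inr hτ₀, D.time_nonneg hC (List.mem_of_getElem? h1),
        fun m b hm hb => D.time_lt hC h1 hb (by omega), fun τ hτ hlt m hm hat => ?_⟩
      have hlt' : i₀ < m := D.good_position_lt hτ₀ hτ hlt ⟨_, _, hC, h1⟩ hat
      refine ⟨fun hma hP => ?_, fun b hb => D.time_lt hC h1 hb hlt'⟩
      have := hmax m hma hP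
      omega
  -- the first good block after the segment
  obtain ⟨z, hzN, hzL, hup⟩ : ∃ z, z ≤ N ∧ (∀ b ∈ L, b.time ≤ z) ∧
      ∀ τ, GoodTime S O R W T₀ N τ → τ ≤ z - 2 * S.Δ → ∀ m, BlockAt O R (Block.honest τ) m →
        m < C.length ∧ (a + k ≤ m → ¬ P m) ∧ (∀ b, 1 ≤ m → C[m]? = some b → b.time ≤ z) := by
    classical
    by_cases hex : ∃ m, a + k ≤ m ∧ P m
    · obtain ⟨hj₀, τ₁, hτ₁, h1⟩ := Nat.find_spec hex
      set j₀ := Nat.find hex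
      refine ⟨τ₁, hτ₁.le, fun b hb => ?_, fun τ hτ hle m hat => ?_⟩
      · obtain ⟨m, -, hm, hb⟩ := hLget' b hb
        exact (D.time_lt hC hb h1 (by omega)).le
      · have hlt : m < j₀ := D.good_position_lt hτ hτ₁ (by linarith) hat ⟨_, _, hC, h1⟩
        refine ⟨hlt.trans (List.getElem?_eq_some_iff.1 h1).1, fun hm hP => ?_,
          fun b _ hb => (D.time_lt hC hb h1 hlt).le⟩
        exact Nat.find_min hex hlt ⟨hm, hP⟩
    · push Not at hex
      refine ⟨t, htN, fun b hb => ?_, fun τ hτ hle m hat => ?_⟩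
      · obtain ⟨m, hm, -, hb⟩ := hLget' b hb
        obtain ⟨q, rfl⟩ : ∃ q, m = q + 1 := ⟨m - 1, by omega⟩
        exact hC.time_le hb
      · obtain ⟨m', -, h2, h3⟩ := D.good_position hτ
        obtain rfl := hat.unique h2
        refine ⟨h3 h hh t (by linarith) htN, hex m, fun b hm hb => ?_⟩
        obtain ⟨q, rfl⟩ : ∃ q, m = q + 1 := ⟨m - 1, by omega⟩
        exact hC.time_le hb
  have hmz : ∀ x, 0 ≤ x → x ≤ τ₀ → k ≤ mined O x z := by
    intro x hx hxτ
    refine hC.le_mined D.finite_honest D.finite_adv (a := a) (by omega) ha1 ?_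
    intro m b h1 h2 h3
    exact ⟨hxτ.trans_lt (hlow.1 m b h1 h3), hzL b (hLget m b h1 h2 h3)⟩
  have h1 := D.lt_two_mul τ₀ z hτ₀ (hdense _ _ hτ₀0 hzN (hmz τ₀ hτ₀0 le_rfl))
    (hT z hzN hzL (hmz 0 le_rfl hτ₀0)) hzN
  refine absurd h1 (not_lt.2 (D.two_mul_good_le (by linarith) (D.finite_honest z)
    (D.finite_adv z) ?_))
  intro τ hτ hτ₀τ hτz
  obtain ⟨m, hm, hat, -⟩ := D.good_position hτ
  obtain ⟨hl1, hl2⟩ := hlow.2 τ hτ hτ₀τ m hm hat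
  obtain ⟨hu1, hu2, hu3⟩ := hup τ hτ hτz m hat
  obtain ⟨b, hb⟩ : ∃ b, C[m]? = some b := ⟨_, List.getElem?_eq_getElem hu1⟩
  obtain ⟨m', rfl⟩ : ∃ m', m = m' + 1 := ⟨m - 1, by omega⟩
  refine ⟨b, (hC.parent_eq hb).1, hC.mem_mined hb, hl2 b hb, hu3 b hm hb, ?_, m' + 1, hat, _, _,
    hC, hb⟩
  -- A good block at this height would lie before, inside or after the segment; the choice of `τ₀`,
  -- the lack of honest blocks and the choice of `z` exclude these in turn.
  rintro ⟨σ, rfl, hσ⟩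
  rcases lt_or_ge (m' + 1) a with h2 | h2
  · exact hl1 h2 ⟨σ, hσ, hb⟩
  · rcases lt_or_ge (m' + 1) (a + k) with h3 | h3
    · exact hcon _ (hLget _ _ h2 h3 hb) trivial
    · exact hu2 h3 ⟨σ, hσ, hb⟩

end

section

variable {Node : Type u} {S : Setting Node} {O : Oracle Node} {R : Run Node}

/-! ### Typical outcomes of the oracle -/

/-- Exactly one honest block is mined in `((j + 1) Δ, (j + 2) Δ]`, and none in the two adjacent
slots. -/
def Converges (H : Set ℝ) (Δ : ℝ) (j : ℕ) : Prop :=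
  (H ∩ Set.Ioc (j * Δ) ((j + 1 : ℕ) * Δ)).ncard = 0 ∧
  (H ∩ Set.Ioc ((j + 1 : ℕ) * Δ) ((j + 2 : ℕ) * Δ)).ncard = 1 ∧
  (H ∩ Set.Ioc ((j + 2 : ℕ) * Δ) ((j + 3 : ℕ) * Δ)).ncard = 0

open Classical in
/-- Up to slot `b`, convergence opportunities and blocks have the right frequencies in all
intervals of at least `κ / 4` slots, and among `M` consecutive leaders there is an honest one. -/
structure Typical (S : Setting Node) (O : Oracle Node) (κ b M : ℕ) (y ρ : ℝ) : Prop where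
  finite_honest : ∀ z, (O.honestTimes ∩ Set.Iic z).Finite
  finite_adv : ∀ z, (O.advTimes ∩ Set.Iic z).Finite
  conv : ∀ a m : ℕ, a ≤ b → m ≤ b → κ ≤ 4 * m →
    y * m ≤ ((Finset.range m).filter fun i => Converges O.honestTimes S.Δ (a + 3 * i)).card
  total : ∀ a m : ℕ, a ≤ b → m ≤ b → κ ≤ 4 * m →
    (mined O (a * S.Δ) ((a + m : ℕ) * S.Δ) : ℝ) ≤ ρ * m
  lead : ∀ n p : ℕ, n ≤ b → p ≤ b →
    ∃ q, p ≤ q ∧ q < p + M ∧ O.leader n q ∈ S.honest ∧ O.leader n q ∈ S.ckpt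

theorem Converges.exists_isolated {H : Set ℝ} {Δ : ℝ} (hfin : ∀ z, (H ∩ Set.Iic z).Finite)
    {j : ℕ} (h : Converges H Δ j) :
    ∃ τ ∈ H, (j + 1) * Δ < τ ∧ τ ≤ (j + 2) * Δ ∧ ∀ τ' ∈ H, τ' ≠ τ → Δ < |τ' - τ| := by
  obtain ⟨h0, h1, h2⟩ := h
  have hf : ∀ x z, (H ∩ Set.Ioc x z).Finite := fun x z =>
    (hfin z).subset (Set.inter_subset_inter_right _ Set.Ioc_subset_Iic_self)
  rw [Set.ncard_eq_zero (hf _ _)] at h0 h2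
  obtain ⟨τ, hτ⟩ := Set.ncard_eq_one.1 h1
  have hmem : τ ∈ H ∩ Set.Ioc ((j + 1 : ℕ) * Δ) ((j + 2 : ℕ) * Δ) := by rw [hτ]; rfl
  obtain ⟨hH, ha, hb⟩ := hmem
  push_cast at ha hb
  refine ⟨τ, hH, ha, hb, fun τ' hτ' hne => ?_⟩
  rcases le_or_gt τ' (j * Δ) with h3 | h3
  · rw [abs_sub_comm]
    exact lt_of_lt_of_le (by linarith) (le_abs_self _)
  rcases le_or_gt τ' ((j + 1) * Δ) with h4 | h4
  · have : τ' ∈ H ∩ Set.Ioc (j * Δ) ((j + 1 : ℕ) * Δ) := ⟨hτ', h3, by push_cast; exact h4⟩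
    rw [h0] at this
    exact this.elim
  rcases le_or_gt τ' ((j + 2) * Δ) with h5 | h5
  · have : τ' ∈ H ∩ Set.Ioc ((j + 1 : ℕ) * Δ) ((j + 2 : ℕ) * Δ) :=
      ⟨hτ', by push_cast; exact h4, by push_cast; exact h5⟩
    rw [hτ] at this
    exact absurd this hne
  rcases le_or_gt τ' ((j + 3) * Δ) with h6 | h6
  · have : τ' ∈ H ∩ Set.Ioc ((j + 2 : ℕ) * Δ) ((j + 3 : ℕ) * Δ) :=
      ⟨hτ', by push_cast; exact h5, by push_cast; exact h6⟩
    rw [h2] at this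
    exact this.elim
  · exact lt_of_lt_of_le (by linarith) (le_abs_self _)

theorem mined_mono {κ b M : ℕ} {y ρ : ℝ} (hT : Typical S O κ b M y ρ) {x x' z z' : ℝ}
    (hx : x' ≤ x) (hz : z ≤ z') : mined O x z ≤ mined O x' z' := by
  refine Nat.add_le_add (Set.ncard_le_ncard ?_ ?_) (Set.ncard_le_ncard ?_ ?_)
  · exact Set.inter_subset_inter_right _ (Set.Ioc_subset_Ioc hx hz)
  · exact (hT.finite_honest z').subset (Set.inter_subset_inter_right _ Set.Ioc_subset_Iic_self)
  · exact Set.inter_subset_inter_right _ (Set.Ioc_subset_Ioc hx hz)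
  · exact (hT.finite_adv z').subset (Set.inter_subset_inter_right _ Set.Ioc_subset_Iic_self)

/-- A finite set of natural numbers of diameter less than `d` has at most `d` elements. -/
theorem card_le_of_diam (s : Finset ℕ) (d : ℝ) (hd : 0 ≤ d)
    (h : ∀ i ∈ s, ∀ j ∈ s, i ≤ j → (j : ℝ) - i ≤ d) : (s.card : ℝ) ≤ d + 1 := by
  rcases s.eq_empty_or_nonempty with rfl | hne
  · simp; linarith
  · have hsub : s ⊆ Finset.Icc (s.min' hne) (s.max' hne) := fun i hi =>
      Finset.mem_Icc.2 ⟨s.min'_le i hi, s.le_max' i hi⟩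
    have h1 := Finset.card_le_card hsub
    rw [Nat.card_Icc] at h1
    have hle : s.min' hne ≤ s.max' hne := s.min'_le _ (s.max'_mem hne)
    have h2 := h _ (s.min'_mem hne) _ (s.max'_mem hne) hle
    have h3 : (s.card : ℝ) + (s.min' hne : ℝ) ≤ (s.max' hne : ℝ) + 1 := by
      have : s.card + s.min' hne ≤ s.max' hne + 1 := by omega
      exact_mod_cast this
    linarith

/-- Few slots are close to a decision, as decisions are at least `e` apart. -/
theorem Fair.card_not_quiet (E : Fair S O R) {W len : ℝ} (hW : 0 ≤ W) (hlen : 0 ≤ len)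
    (s : Finset ℕ) (τ : ℕ → ℝ)
    (hτ : ∀ j ∈ s, (j + 1) * S.Δ < τ j ∧ τ j ≤ (j + 2) * S.Δ ∧ ¬ Quiet S R W (τ j))
    (hdiam : ∀ i ∈ s, ∀ j ∈ s, τ j - τ i ≤ len * S.Δ) :
    (s.card : ℝ) ≤ (W / S.Δ + 5) * ((len * S.Δ + W + 3 * S.Δ) / S.e + 1) := by
  classical
  have hΔ := E.Δ_pos
  have he := E.e_pos
  have hex : ∀ j : ℕ, ∃ n : ℕ, j ∈ s → Decided S R n (τ j + (W + S.Δ)) ∧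
      ¬ Decided S R n (τ j - 2 * S.Δ) := by
    intro j
    by_cases hj : j ∈ s
    · have := (hτ j hj).2.2
      unfold Quiet at this
      push Not at this
      obtain ⟨n, h1, h2⟩ := this
      exact ⟨n, fun _ => ⟨h1, h2⟩⟩
    · exact ⟨0, fun h => absurd h hj⟩
  choose f hf using hex
  -- One decision spoils only slots within a window of about `W` around it.
  have h1 : ∀ n ∈ s.image f, ((s.filter (fun j => f j = n)).card : ℝ) ≤ W / S.Δ + 5 := by
    intro n _
    have := card_le_of_diam (s.filter (fun j => f j = n)) (W / S.Δ + 4) (by positivity) ?_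
    · linarith
    intro i hi j hj _
    obtain ⟨his, rfl⟩ := Finset.mem_filter.1 hi
    obtain ⟨hjs, hji⟩ := Finset.mem_filter.1 hj
    have h2 := (hf i his).1
    have h3 := (hf j hjs).2
    rw [hji] at h3
    have h4 : τ j - 2 * S.Δ < τ i + (W + S.Δ) := by
      by_contra hcon
      push Not at hcon
      exact h3 (h2.mono hcon)
    have h5 := (hτ i his).2.1
    have h6 := (hτ j hjs).1
    have h7 : ((j : ℝ) - i) * S.Δ ≤ W + 4 * S.Δ := by nlinarith
    have h8 : W / S.Δ + 4 = (W + 4 * S.Δ) / S.Δ := by field_simp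
    rw [h8, le_div_iff₀ hΔ]
    exact h7
  -- The iterations responsible are decided at least `e` apart, so few of them fit into the
  -- interval.
  have h2 : ((s.image f).card : ℝ) ≤ (len * S.Δ + W + 3 * S.Δ) / S.e + 1 := by
    refine card_le_of_diam _ _ (by positivity) ?_
    intro n hn n' hn' hle
    obtain ⟨i, hi, rfl⟩ := Finset.mem_image.1 hn
    obtain ⟨j, hj, rfl⟩ := Finset.mem_image.1 hn'
    obtain ⟨d, hd⟩ := Nat.exists_eq_add_of_le hle
    have h3 := (hf j hj).1
    rw [hd] at h3 ⊢
    have h4 := E.decided_sub d h3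
    have h5 := (hf i hi).2
    have h6 : τ i - 2 * S.Δ < τ j + (W + S.Δ) - d * S.e := by
      by_contra hcon
      push Not at hcon
      exact h5 (h4.mono hcon)
    have h7 := hdiam i hi j hj
    rw [le_div_iff₀ he]
    push_cast
    linarith
  have h3 : (s.card : ℝ) ≤ (W / S.Δ + 5) * (s.image f).card := by
    have h4 : s.card = ∑ n ∈ s.image f, (s.filter (fun j => f j = n)).card :=
      Finset.card_eq_sum_card_image f s
    rw [h4]
    push_cast
    calc _ ≤ ∑ n ∈ s.image f, (W / S.Δ + 5) := Finset.sum_le_sum h1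
      _ = _ := by rw [Finset.sum_const, nsmul_eq_mul]; ring
  refine h3.trans ?_
  gcongr

variable {T₀ N : ℝ} {κ b M : ℕ} {y ρ : ℝ}

-- Adjacent slot patterns overlap, so typicality controls starting slots of one residue class mod
-- `3` at a time; the three classes are added up here.
open Classical in
theorem Typical.card_converges (hT : Typical S O κ b M y ρ) {a m : ℕ} (ha : a + 2 ≤ b)
    (hm : m ≤ b) (hκ : κ ≤ 4 * m) :
    y * (3 * m) ≤ ((Finset.Ico a (a + 3 * m)).filter
      fun j => Converges O.honestTimes S.Δ j).card := by
  let A : ℕ → Finset ℕ := fun r => ((Finset.range m).filter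
    fun i => Converges O.honestTimes S.Δ (a + r + 3 * i)).image (fun i => a + r + 3 * i)
  have hAcard : ∀ r ≤ 2, y * m ≤ ((A r).card : ℝ) := by
    intro r hr
    have : (A r).card = _ := Finset.card_image_of_injective _ (fun i j h => by simpa using h)
    rw [this]
    exact hT.conv (a + r) m (by omega) hm hκ
  have hmod : ∀ r ≤ 2, ∀ j ∈ A r, (j - a) % 3 = r ∧ a ≤ j ∧ j < a + 3 * m ∧
      Converges O.honestTimes S.Δ j := by
    intro r hr j hj
    obtain ⟨i, hi, rfl⟩ := Finset.mem_image.1 hj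
    obtain ⟨h1, h2⟩ := Finset.mem_filter.1 hi
    have := Finset.mem_range.1 h1
    exact ⟨by omega, by omega, by omega, h2⟩
  have hd01 : Disjoint (A 0) (A 1) := Finset.disjoint_left.2 fun j h0 h1 => by
    have := (hmod 0 (by omega) j h0).1
    have := (hmod 1 (by omega) j h1).1
    omega
  have hd2 : Disjoint (A 0 ∪ A 1) (A 2) := Finset.disjoint_left.2 fun j h0 h1 => by
    have h2 := (hmod 2 (by omega) j h1).1
    rcases Finset.mem_union.1 h0 with h | h
    · have := (hmod 0 (by omega) j h).1
      omega
    · have := (hmod 1 (by omega) j h).1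
      omega
  have hsub : A 0 ∪ A 1 ∪ A 2 ⊆ (Finset.Ico a (a + 3 * m)).filter
      fun j => Converges O.honestTimes S.Δ j := by
    intro j hj
    rw [Finset.mem_filter, Finset.mem_Ico]
    simp only [Finset.mem_union] at hj
    rcases hj with (h | h) | h
    · have := hmod 0 (by omega) j h; tauto
    · have := hmod 1 (by omega) j h; tauto
    · have := hmod 2 (by omega) j h; tauto
  have hcard := Finset.card_le_card hsub
  rw [Finset.card_union_of_disjoint hd2, Finset.card_union_of_disjoint hd01] at hcard
  have h0 := hAcard 0 (by omega)
  have h1 := hAcard 1 (by omega)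
  have h2 := hAcard 2 (by omega)
  have : ((A 0).card : ℝ) + (A 1).card + (A 2).card ≤ ((Finset.Ico a (a + 3 * m)).filter
      fun j => Converges O.honestTimes S.Δ j).card := by exact_mod_cast hcard
  linarith

set_option maxHeartbeats 1000000 in
/-- In typical outcomes, good blocks dominate. -/
theorem Settled.dominant (E : Settled S O R (7 * S.Δ * (M + 2)) T₀ N)
    (hT : Typical S O κ b M y ρ) (hN : N ≤ (b - 5 : ℝ) * S.Δ) (hκ : 28 ≤ κ) (hy : 0 ≤ y)
    (hρ : 0 ≤ ρ) {C' : ℝ} (hC' : 0 < C')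
    (hnum : ∀ len : ℝ, (κ : ℝ) ≤ len → ρ * (len + 2) +
      2 * ((7 * M + 19) * ((len + 7 * M + 17) * S.Δ / S.e + 1)) + 2 * (len / C' + 3)
        < 2 * (y * (len - 7))) :
    Dominant S O R (7 * S.Δ * (M + 2)) T₀ N (C' * T₀) (κ * S.Δ) := by
  classical
  refine { toSettled := E, finite_honest := hT.finite_honest, finite_adv := hT.finite_adv,
           lt_two_mul := ?_ }
  intro τ₀ z hτ₀ hz hT₁ hzN
  set W := 7 * S.Δ * ((M : ℝ) + 2) with hW
  have hΔ := E.Δ_pos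
  have hT₀0 : 0 ≤ T₀ := E.adm.gst_nonneg.trans E.gst_le
  have hτ₀0 : 0 ≤ τ₀ := by
    rcases hτ₀ with rfl | h
    · exact le_rfl
    · linarith [h.late]
  set len := (z - τ₀) / S.Δ with hlen
  have hlenΔ : len * S.Δ = z - τ₀ := by rw [hlen]; field_simp
  have hκlen : (κ : ℝ) ≤ len := by
    rw [hlen, le_div_iff₀ hΔ]; linarith
  have hκr : (28 : ℝ) ≤ κ := by exact_mod_cast hκ
  have hz0 : 0 ≤ z := by nlinarith
  have hbz : z / S.Δ ≤ b - 5 := by rw [div_le_iff₀ hΔ]; linarith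
  have hzτ : z / S.Δ = τ₀ / S.Δ + len := by rw [hlen]; ring
  have hτ₀d : 0 ≤ τ₀ / S.Δ := by positivity
  -- total number of blocks
  have htotal : (mined O τ₀ z : ℝ) ≤ ρ * (len + 2) := by
    set a := ⌊τ₀ / S.Δ⌋₊
    set c := ⌈z / S.Δ⌉₊
    have ha1 : (a : ℝ) ≤ τ₀ / S.Δ := Nat.floor_le hτ₀d
    have ha2 : τ₀ / S.Δ < a + 1 := Nat.lt_floor_add_one _
    have hc1 : z / S.Δ ≤ c := Nat.le_ceil _
    have hc2 : (c : ℝ) < z / S.Δ + 1 := Nat.ceil_lt_add_one (by positivity)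
    have hac : a ≤ c := by
      have : (a : ℝ) ≤ c := by linarith
      exact_mod_cast this
    obtain ⟨m, hm⟩ := Nat.exists_eq_add_of_le hac
    have hmr : (c : ℝ) = a + m := by rw [hm]; push_cast; ring
    have hcb : c ≤ b := by
      have : (c : ℝ) ≤ b := by linarith
      exact_mod_cast this
    have h1 := hT.total a m (by omega) (by omega) (by
      have : (κ : ℝ) ≤ 4 * m := by linarith
      exact_mod_cast this)
    rw [← hm] at h1
    have h2 : mined O τ₀ z ≤ mined O (a * S.Δ) (c * S.Δ) := by
      apply mined_mono hT
      · rwa [le_div_iff₀ hΔ] at ha1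
      · rwa [div_le_iff₀ hΔ] at hc1
    calc (mined O τ₀ z : ℝ) ≤ mined O (a * S.Δ) (c * S.Δ) := by exact_mod_cast h2
      _ ≤ ρ * m := h1
      _ ≤ _ := by apply mul_le_mul_of_nonneg_left _ hρ; linarith
  -- convergence opportunities
  set a := ⌈τ₀ / S.Δ⌉₊
  set c := ⌊z / S.Δ⌋₊
  have ha1 : τ₀ / S.Δ ≤ a := Nat.le_ceil _
  have ha2 : (a : ℝ) < τ₀ / S.Δ + 1 := Nat.ceil_lt_add_one hτ₀d
  have hc1 : (c : ℝ) ≤ z / S.Δ := Nat.floor_le (by positivity)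
  have hc2 : z / S.Δ < c + 1 := Nat.lt_floor_add_one _
  have hcb : c + 5 ≤ b := by
    have : (c : ℝ) + 5 ≤ b := by linarith
    exact_mod_cast this
  have hac : a + 26 ≤ c + 1 := by
    have : (a : ℝ) + 26 ≤ c + 1 := by linarith
    exact_mod_cast this
  -- The subtracted `3` gives `j + 4 ≤ c` for all slots considered, so that the block of pattern
  -- `j`, mined by `(j + 2)Δ`, comes at least `2Δ` before `z`.
  set m := (c - a - 3) / 3 with hm
  have hm1 : 3 * m ≤ c - a - 3 := by omega
  have hm2 : c - a - 5 ≤ 3 * m := by omega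
  have hm2r : len - 7 ≤ 3 * (m : ℝ) := by
    have : (c : ℝ) ≤ 3 * m + a + 5 := by
      have : c ≤ 3 * m + a + 5 := by omega
      exact_mod_cast this
    linarith
  -- Here `κ ≥ 28` enters: it turns `3m ≥ len - 7` into `4m ≥ κ`.
  have hκm : κ ≤ 4 * m := by
    have : (κ : ℝ) ≤ 4 * m := by linarith
    exact_mod_cast this
  set J := (Finset.Ico a (a + 3 * m)).filter fun j => Converges O.honestTimes S.Δ j
  have hJcard : y * (len - 7) ≤ (J.card : ℝ) :=
    (mul_le_mul_of_nonneg_left hm2r hy).trans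
      (hT.card_converges (by omega) (by omega) hκm)
  have hex : ∀ j : ℕ, ∃ τ : ℝ, j ∈ J → τ ∈ O.honestTimes ∧ (j + 1) * S.Δ < τ ∧
      τ ≤ (j + 2) * S.Δ ∧ ∀ τ' ∈ O.honestTimes, τ' ≠ τ → S.Δ < |τ' - τ| := by
    intro j
    by_cases hj : j ∈ J
    · obtain ⟨τ, h1, h2⟩ := (Finset.mem_filter.1 hj).2.exists_isolated hT.finite_honest
      exact ⟨τ, fun _ => ⟨h1, h2⟩⟩
    · exact ⟨0, fun h => absurd h hj⟩
  choose τ hτ using hex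
  have hτlo : ∀ j ∈ J, τ₀ < τ j := by
    intro j hj
    have h1 : a ≤ j := (Finset.mem_Ico.1 (Finset.mem_filter.1 hj).1).1
    have h2 : (a : ℝ) ≤ j := by exact_mod_cast h1
    have h3 := (hτ j hj).2.1
    rw [div_le_iff₀ hΔ] at ha1
    nlinarith
  have hτhi : ∀ j ∈ J, τ j ≤ z - 2 * S.Δ := by
    intro j hj
    have h1 : j + 4 ≤ c := by
      have := (Finset.mem_Ico.1 (Finset.mem_filter.1 hj).1).2
      omega
    have h2 : (j : ℝ) + 4 ≤ c := by exact_mod_cast h1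
    have h3 := (hτ j hj).2.2.1
    rw [le_div_iff₀ hΔ] at hc1
    nlinarith
  -- Opportunities are lost near decisions (`J₁`) and before `T₀ + 2Δ` (`J₂`); the rest is good.
  set J₁ := J.filter fun j => ¬ Quiet S R W (τ j)
  set J₂ := J.filter fun j => τ j < T₀ + 2 * S.Δ
  set J₃ := (J \ J₁) \ J₂
  have hJ₁ : (J₁.card : ℝ) ≤ (7 * M + 19) * ((len + 7 * M + 17) * S.Δ / S.e + 1) := by
    have h1 := E.card_not_quiet E.W_nonneg (len := len) (by linarith) J₁ τ
      (fun j hj => by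
        obtain ⟨h1, h2⟩ := Finset.mem_filter.1 hj
        exact ⟨(hτ j h1).2.1, (hτ j h1).2.2.1, h2⟩)
      (fun i hi j hj => by
        have h1 := hτlo i (Finset.mem_filter.1 hi).1
        have h2 := hτhi j (Finset.mem_filter.1 hj).1
        linarith)
    have h2 : W / S.Δ + 5 = 7 * M + 19 := by rw [hW]; field_simp; ring
    have h3 : len * S.Δ + W + 3 * S.Δ = (len + 7 * M + 17) * S.Δ := by rw [hW]; ring
    rwa [h2, h3] at h1
  -- Early opportunities matter only if the interval begins at `0`. It then ends after `C'T₀`, so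
  -- they make up a fraction of about `1 / C'`.
  have hJ₂ : (J₂.card : ℝ) ≤ len / C' + 3 := by
    rcases hτ₀ with h0 | h0
    · have hlen0 : len * S.Δ = z := by rw [hlenΔ, h0, sub_zero]
      have hT₀len : T₀ ≤ len / C' * S.Δ := by
        rw [div_mul_eq_mul_div, hlen0, le_div_iff₀ hC']; linarith
      have hl0 : 0 ≤ len / C' := div_nonneg (by linarith) hC'.le
      have h1 := card_le_of_diam J₂ (len / C' + 2) (by linarith) (fun i hi j hj _ => ?_)
      · linarith
      obtain ⟨h1, h2⟩ := Finset.mem_filter.1 hj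
      have h3 := (hτ j h1).2.1
      have h4 : ((j : ℝ) + 1) * S.Δ ≤ (len / C' + 2) * S.Δ := by linarith
      have h5 := le_of_mul_le_mul_right h4 hΔ
      have h6 : (0 : ℝ) ≤ i := i.cast_nonneg
      linarith
    · have hempty : J₂ = ∅ := by
        refine Finset.filter_eq_empty_iff.2 fun j hj => ?_
        have := hτlo j hj
        have := h0.late
        linarith
      rw [hempty, Finset.card_empty, Nat.cast_zero]
      have : 0 ≤ len / C' := div_nonneg (by linarith) hC'.le
      linarith
  have hJ₃ : (J.card : ℝ) ≤ J₃.card + J₁.card + J₂.card := by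
    have h1 : J ⊆ J₃ ∪ J₁ ∪ J₂ := by
      intro j hj
      simp only [J₃, Finset.mem_union, Finset.mem_sdiff]
      tauto
    have h2 := (Finset.card_le_card h1).trans ((Finset.card_union_le _ _).trans
      (Nat.add_le_add_right (Finset.card_union_le _ _) _))
    exact_mod_cast h2
  have hinj : Set.InjOn τ J := by
    have key : ∀ i ∈ J, ∀ j ∈ J, i < j → τ i < τ j := by
      intro i hi j hj hij
      have h1 := (hτ i hi).2.2.1
      have h2 := (hτ j hj).2.1
      have h3 : (i : ℝ) + 1 ≤ j := by exact_mod_cast hij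
      nlinarith
    intro i hi j hj h
    rcases lt_trichotomy i j with h1 | h1 | h1
    · exact absurd h (key i hi j hj h1).ne
    · exact h1
    · exact absurd h (key j hj i hi h1).ne'
  have hgood : J₃.card ≤
      {τ | GoodTime S O R W T₀ N τ ∧ τ₀ < τ ∧ τ ≤ z - 2 * S.Δ}.ncard := by
    have hsub : ((J₃.image τ : Finset ℝ) : Set ℝ) ⊆
        {τ | GoodTime S O R W T₀ N τ ∧ τ₀ < τ ∧ τ ≤ z - 2 * S.Δ} := by
      intro x hx
      obtain ⟨j, hj, rfl⟩ := Finset.mem_image.1 (Finset.mem_coe.1 hx)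
      simp only [J₃, J₁, J₂, Finset.mem_sdiff, Finset.mem_filter, not_and, not_not, not_lt] at hj
      obtain ⟨⟨hjJ, hq⟩, hl⟩ := hj
      exact ⟨⟨(hτ j hjJ).1, (hτ j hjJ).2.2.2, hq hjJ, hl hjJ, by linarith [hτhi j hjJ]⟩,
        hτlo j hjJ, hτhi j hjJ⟩
    have hcard : (J₃.image τ).card = J₃.card := Finset.card_image_of_injOn
      (hinj.mono fun j hj => (Finset.mem_sdiff.1 (Finset.mem_sdiff.1 hj).1).1)
    rw [← hcard, ← Set.ncard_coe_finset]
    refine Set.ncard_le_ncard hsub ((hT.finite_honest z).subset ?_)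
    rintro x ⟨h1, -, h2⟩
    exact ⟨h1.mem, Set.mem_Iic.2 (h2.trans (by linarith))⟩
  have hnum' := hnum len hκlen
  have hgr : (J₃.card : ℝ) ≤
      ({τ | GoodTime S O R W T₀ N τ ∧ τ₀ < τ ∧ τ ≤ z - 2 * S.Δ}.ncard : ℝ) := by
    exact_mod_cast hgood
  have : (mined O τ₀ z : ℝ) <
      2 * ({τ | GoodTime S O R W T₀ N τ ∧ τ₀ < τ ∧ τ ≤ z - 2 * S.Δ}.ncard : ℝ) := by
    linarith
  exact_mod_cast this

/-- A shorter interval is covered by `κ + 4` slots, which contain too few blocks. -/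
theorem Typical.dense (hT : Typical S O κ b M y ρ) (hΔ : 0 < S.Δ) (hN : N ≤ (b - 5 : ℝ) * S.Δ)
    (hκb : κ + 4 ≤ b) {k : ℕ} (hk : ρ * (κ + 4) < k) {x z : ℝ} (hx : 0 ≤ x) (hz : z ≤ N)
    (h : k ≤ mined O x z) (hρ : 0 ≤ ρ) : x + (κ + 2) * S.Δ ≤ z := by
  by_contra hcon
  push Not at hcon
  have hk0 : 0 < k := by
    have : (0 : ℝ) < k := lt_of_le_of_lt (by positivity) hk
    exact_mod_cast this
  rcases lt_or_ge z x with hzx | hzx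
  · have : mined O x z = 0 := by
      unfold mined
      rw [Set.Ioc_eq_empty (not_lt.2 hzx.le)]
      simp
    omega
  set a := ⌊x / S.Δ⌋₊
  have ha1 : (a : ℝ) ≤ x / S.Δ := Nat.floor_le (by positivity)
  have ha2 : x / S.Δ < a + 1 := Nat.lt_floor_add_one _
  rw [le_div_iff₀ hΔ] at ha1
  rw [div_lt_iff₀ hΔ] at ha2
  have hab : a ≤ b := by
    have : (a : ℝ) * S.Δ ≤ b * S.Δ := by nlinarith
    exact_mod_cast le_of_mul_le_mul_right this hΔ
  have h1 := hT.total a (κ + 4) hab hκb (by omega)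
  have h2 : mined O x z ≤ mined O (a * S.Δ) ((a + (κ + 4) : ℕ) * S.Δ) := by
    refine mined_mono hT ha1 ?_
    push_cast
    nlinarith
  have h3 : (k : ℝ) ≤ mined O (a * S.Δ) ((a + (κ + 4) : ℕ) * S.Δ) := by
    exact_mod_cast h.trans h2
  push_cast at h1 h3
  linarith

end

section

variable {Node : Type u} {S : Setting Node} {O : Oracle Node} {R : Run Node}
variable {κ b M : ℕ} {y ρ T C' : ℝ}

/-! ### Security in typical outcomes -/

/-- Numerical conditions on the parameters under which typical outcomes are secure up to time
`T`. -/
structure Suitable (S : Setting Node) (κ b M : ℕ) (y ρ T C' : ℝ) : Prop where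
  y_nonneg : 0 ≤ y
  ρ_nonneg : 0 ≤ ρ
  one_le_M : 1 ≤ M
  one_le_C' : 1 ≤ C'
  κ_large : 28 ≤ κ
  κ_le : κ + 4 ≤ b
  Δ_le_e : S.Δ ≤ S.e
  time_le : T ≤ (b - 5 : ℝ) * S.Δ
  depth : ρ * (κ + 4) < S.k
  M_small : 2 * C' * (7 * M + 8) ≤ κ
  rate : ∀ len : ℝ, (κ : ℝ) ≤ len → ρ * (len + 2) +
      2 * ((7 * M + 19) * ((len + 7 * M + 17) * S.Δ / S.e + 1)) + 2 * (len / C' + 3)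
        < 2 * (y * (len - 7))

theorem Typical.lead_of_le (hT : Typical S O κ b M y ρ) (hP : Suitable S κ b M y ρ T C')
    (E : Fair S O R) {n : ℕ} {t : ℝ} (htT : t ≤ T) (hd : Decided S R n t) (p : ℕ)
    (hp : 4 * S.Δ * p ≤ t) :
    ∃ q, p ≤ q ∧ q < p + M ∧ O.leader n q ∈ S.honest ∧ O.leader n q ∈ S.ckpt := by
  have hΔ := E.Δ_pos
  have hb := hP.time_le
  apply hT.lead
  · have h1 := E.decided_time hd
    have h2 := hP.Δ_le_e
    have h3 : (n : ℝ) * S.Δ ≤ b * S.Δ := by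
      have : (n : ℝ) * S.Δ ≤ n * S.e := mul_le_mul_of_nonneg_left h2 n.cast_nonneg
      nlinarith
    exact_mod_cast le_of_mul_le_mul_right h3 hΔ
  · have h0 : (0 : ℝ) ≤ p := p.cast_nonneg
    have h3 : (p : ℝ) * S.Δ ≤ b * S.Δ := by nlinarith
    exact_mod_cast le_of_mul_le_mul_right h3 hΔ

/-- An iteration that can be started only after stabilization is soon decided. -/
theorem Typical.recent_succ (hT : Typical S O κ b M y ρ) (hP : Suitable S κ b M y ρ T C')
    (E : Fair S O R) {n : ℕ} (hn : ¬ Decided S R n R.gst) :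
    Recent S R (7 * S.Δ * (M + 2)) T (n + 1) := by
  have hΔ := E.Δ_pos
  have hW : 7 * S.Δ * ((M : ℝ) + 2) = 7 * S.Δ * (M + 1) + 7 * S.Δ := by ring
  intro g hg t htT v hc B hB
  obtain ⟨i, hi, hic, p, -, s, hs, hst, hmem, -⟩ := E.endorsed_of_certified hg hc B hB
  have hds := E.decided_of_start hi hic hs
  have hgs : R.gst < s - S.e := by
    by_contra hcon
    push Not at hcon
    exact hn (hds.mono hcon)
  have he := E.e_pos
  rcases E.certified_fresh (n := n + 1) hP.one_le_M (σ := s + S.Δ) (by linarith)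
    (fun j hj _ => E.decided_relay hj hds (t' := s + S.Δ - S.e) (by linarith) (by linarith)) hg hc
    (hT.lead_of_le hP E htT ⟨g, hg, v, hc⟩) hB with h | ⟨j, hj, s', hs', hst', hmem', h⟩
  · exact ⟨i, hi, s, by linarith, hst, hmem, h.mono (by linarith)⟩
  · exact ⟨j, hj, s', by linarith, hst', hmem', h.mono (by linarith)⟩

/-- As long as the iteration pending at stabilization stays undecided, no new checkpoint appears and
recency is vacuous. -/
theorem Typical.settled_gst (E : Fair S O R) {x : ℝ} {m : ℕ}
    (hm : ¬ Decided S R m x) (hpred : ∀ n, m = n + 1 → Decided S R n R.gst) :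
    Settled S O R (7 * S.Δ * (M + 2)) R.gst x where
  toFair := E
  gst_le := le_rfl
  W_nonneg := by have := E.Δ_pos; positivity
  recent := by
    intro n hn
    left
    have hnm : n < m := by
      by_contra hcon
      push Not at hcon
      exact hm (E.decided_of_le hcon hn)
    obtain ⟨d, rfl⟩ : ∃ d, m = d + 1 := ⟨m - 1, by omega⟩
    exact E.decided_of_le (by omega) (hpred d rfl)

/-- Iterations with `m = 0` or with a predecessor undecided at stabilization are recent by
`Fair.certified_fresh`. If the predecessor was already decided, that lemma also allows a decision
soon after `gst + Δ + e` on an old value. In this case the value is shown to survive in honest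
chains until shortly before the decision. -/
theorem Typical.settled (hT : Typical S O κ b M y ρ) (hP : Suitable S κ b M y ρ T C')
    (E : Fair S O R) :
    Settled S O R (7 * S.Δ * (M + 2)) ((C' + 1) * R.gst + S.Δ * (7 * M + 8)) T where
  toFair := E
  gst_le := by
    have h1 := E.adm.gst_nonneg
    have h2 := hP.one_le_C'
    have h3 := E.Δ_pos
    have h4 : 0 ≤ S.Δ * (7 * (M : ℝ) + 8) := by positivity
    nlinarith
  W_nonneg := by have := E.Δ_pos; positivity
  recent := by
    classical
    intro m hmT
    have hΔ := E.Δ_pos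
    have he := E.e_pos
    have hg0 := E.adm.gst_nonneg
    have hC' := hP.one_le_C'
    have hM : (1 : ℝ) ≤ M := by exact_mod_cast hP.one_le_M
    have hMΔ : S.Δ ≤ S.Δ * M := by nlinarith
    have hC'g : R.gst ≤ C' * R.gst := by nlinarith
    by_cases hd : Decided S R m ((C' + 1) * R.gst + S.Δ * (7 * M + 8))
    · exact Or.inl hd
    right
    cases m with
    | zero =>
      intro g hg t htT v hc B hB
      rcases E.certified_fresh (n := 0) hP.one_le_M (le_refl R.gst) (fun j hj _ => hg0) hg hc
        (hT.lead_of_le hP E htT ⟨g, hg, v, hc⟩) hB with h | ⟨j, hj, s', hs', hst', hmem', h⟩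
      · exact absurd (h.mono (by nlinarith)) hd
      · exact ⟨j, hj, s', by linarith, hst', hmem', h.mono (by nlinarith)⟩
    | succ n =>
      by_cases hn : Decided S R n R.gst
      swap
      · exact hT.recent_succ hP E hn
      intro g hg t htT v hc B hB
      rcases E.certified_fresh (n := n + 1) hP.one_le_M (σ := R.gst + S.Δ + S.e) (by linarith)
        (fun j hj _ => E.decided_relay hj hn (t' := R.gst + S.Δ + S.e - S.e)
          (by linarith) (by linarith)) hg hc
        (hT.lead_of_le hP E htT ⟨g, hg, v, hc⟩) hB with h | ⟨j, hj, s', hs', hst', hmem', h⟩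
      swap
      · exact ⟨j, hj, s', by linarith, hst', hmem', h.mono (by nlinarith)⟩
      obtain ⟨i, hi, hic, p, -, s, hs, hst, hmem, hvalid⟩ := E.endorsed_of_certified hg hc B hB
      have hes : S.e ≤ s := by
        linarith [E.decided_nonneg (E.decided_of_start hi hic hs)]
      -- Since `e ≤ s`, an earlier `s` would bound `e` by `C' * gst` and place the decision before
      -- `T₀`. This explains the terms `C' + 1` and `7M + 8`.
      have hsT : C' * R.gst ≤ s := by
        by_contra hcon
        push Not at hcon
        exact hd (h.mono (by nlinarith))
      set W := 7 * S.Δ * ((M : ℝ) + 2) with hW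
      have hW2 : 2 * S.Δ ≤ W := by rw [hW]; nlinarith
      by_cases hsW : Decided S R (n + 1) (s + W)
      · exact ⟨i, hi, s, by linarith, hst, hmem, hsW⟩
      -- the value is stable up to the decision
      have hex : ∃ j : ℕ, Decided S R (n + 1) (s + W + j * S.Δ) := by
        obtain ⟨j, hj⟩ := exists_nat_gt ((t - s - W) / S.Δ)
        rw [div_lt_iff₀ hΔ] at hj
        exact ⟨j, g, hg, v, hc.mono (by linarith)⟩
      have h1 := Nat.find_spec hex
      have h2 : Nat.find hex ≠ 0 := by
        intro h0
        rw [h0] at h1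
        exact hsW (by simpa using h1)
      obtain ⟨j, hj⟩ := Nat.exists_eq_succ_of_ne_zero h2
      have h3 := Nat.find_min hex (m := j) (by omega)
      rw [hj] at h1
      have hj0 : 0 ≤ (j : ℝ) * S.Δ := by positivity
      set x := s + W + j * S.Δ
      have hxt : x < t := by
        by_contra hcon
        push Not at hcon
        exact h3 ⟨g, hg, v, hc.mono hcon⟩
      have hxN : x ≤ (b - 5 : ℝ) * S.Δ := by linarith [hP.time_le]
      -- Here `x` is within `Δ` before the decision. Up to `x` there is no decision that was not
      -- made by stabilization, so good blocks already dominate from `C' * gst` on.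
      have hset : Settled S O R W R.gst x := Typical.settled_gst E h3
        (fun n' hn' => by obtain rfl : n = n' := by omega
                          exact hn)
      have hdom : Dominant S O R W R.gst x (C' * R.gst) (κ * S.Δ) :=
        hset.dominant hT hxN hP.κ_large hP.y_nonneg hP.ρ_nonneg (by linarith) hP.rate
      obtain ⟨hB0, hBk, -⟩ := E.ckptBlock_old hT.finite_honest hT.finite_adv hvalid hB
      have hold := hT.dense hΔ hxN hP.κ_le hP.depth hB0 (by linarith) hBk hP.ρ_nonneg
      refine ⟨i, hi, x - S.Δ, by linarith, by linarith, ?_, h1.mono ?_⟩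
      -- The checkpoint block was `k`-deep, hence old, so it stays in the chain until `x - Δ`. That
      -- is recent enough.
      · exact hdom.mem_stable (by linarith) hsT (by linarith) (by linarith) hi hi hmem
          (by linarith)
      · push_cast
        linarith

/-- The extra slot in `gstSlot` absorbs the rounding in `slot`. -/
theorem lt_of_slot_lt (hΔ : 0 < S.Δ) (hg : 0 ≤ R.gst) {C t : ℝ} (hC : 1 ≤ C)
    (h : C * gstSlot S R < slot S t) : 0 < t ∧ C * R.gst < t := by
  have hg1 : R.gst / S.Δ + 1 ≤ gstSlot S R := by
    unfold gstSlot
    push_cast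
    linarith [Nat.le_ceil (R.gst / S.Δ)]
  have hgd : 0 ≤ R.gst / S.Δ := by positivity
  have h0 : 0 < slot S t := by
    have : (0 : ℝ) < slot S t := lt_of_le_of_lt (by positivity) h
    exact_mod_cast this
  have ht : 0 < t / S.Δ := Nat.ceil_pos.1 h0
  have ht' : 0 < t := by
    by_contra hcon
    push Not at hcon
    exact absurd ht (not_lt.2 (div_nonpos_of_nonpos_of_nonneg hcon hΔ.le))
  refine ⟨ht', ?_⟩
  have h1 : (slot S t : ℝ) < t / S.Δ + 1 := Nat.ceil_lt_add_one ht.le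
  have h2 : C * (R.gst / S.Δ) < t / S.Δ := by nlinarith
  rw [← mul_div_assoc, div_lt_div_iff_of_pos_right hΔ] at h2
  exact h2

/-- Dominance is available after `C'T₀`. Half of the elapsed time covers the part of `C'T₀`
proportional to `gst`, by the choice of `C`. The other half covers the part with `M`, because `k`
blocks need at least `κ + 2` slots. -/
theorem Typical.secure (hT : Typical S O κ b M y ρ) (hP : Suitable S κ b M y ρ T C')
    (E : Fair S O R) {C : ℝ} (hC : 2 * C' * (C' + 1) ≤ C) :
    CommonPrefixAfter S R S.k (C * gstSlot S R) T ∧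
      ChainQualityAfter S R S.k (C * gstSlot S R) (C * gstSlot S R) T := by
  have hΔ := E.Δ_pos
  have hg0 := E.adm.gst_nonneg
  have hC' := hP.one_le_C'
  have hC1 : 1 ≤ C := by nlinarith
  have D := (hT.settled hP E).dominant hT hP.time_le hP.κ_large hP.y_nonneg hP.ρ_nonneg
    (by linarith : 0 < C') hP.rate
  have hdense : ∀ x z, 0 ≤ x → z ≤ T → S.k ≤ mined O x z → x + (κ + 2) * S.Δ ≤ z :=
    fun x z hx hz h => hT.dense hΔ hP.time_le hP.κ_le hP.depth hx hz h hP.ρ_nonneg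
  have hdense' : ∀ x z, 0 ≤ x → z ≤ T → S.k ≤ mined O x z → x + κ * S.Δ ≤ z :=
    fun x z hx hz h => by linarith [hdense x z hx hz h]
  have hlate : ∀ z, C * R.gst < z → (κ + 2) * S.Δ ≤ z →
      C' * ((C' + 1) * R.gst + S.Δ * (7 * M + 8)) ≤ z := by
    intro z h1 h2
    have h3 := mul_le_mul_of_nonneg_right hP.M_small hΔ.le
    have h4 := mul_le_mul_of_nonneg_right hC hg0
    nlinarith
  have hk : 1 ≤ S.k := by
    have : (0 : ℝ) < S.k := lt_of_le_of_lt
      (mul_nonneg hP.ρ_nonneg (by positivity)) hP.depth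
    exact_mod_cast this
  constructor
  · intro h₁ hh₁ h₂ hh₂ t₁ t₂ hs h12 h2T
    obtain ⟨ht0, htg⟩ := lt_of_slot_lt hΔ hg0 hC1 hs
    refine D.common_prefix hdense' ht0.le (fun hm => hlate _ htg ?_) h12 h2T hh₁ hh₂
    linarith [hdense 0 t₁ le_rfl (h12.trans h2T) hm]
  · intro h hh t hs htT L hL hLk hLb
    obtain ⟨ht0, -⟩ := lt_of_slot_lt hΔ hg0 hC1 hs
    have hLne : L ≠ [] := by rintro rfl; simp at hLk; omega
    obtain ⟨b₀, hb₀⟩ := List.exists_mem_of_ne_nil L hLne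
    obtain ⟨-, hbg⟩ := lt_of_slot_lt hΔ hg0 hC1 (hLb b₀ hb₀).2
    refine D.chain_quality hk hdense' ht0.le htT hh hL hLk (fun b hb => (hLb b hb).1) ?_
    intro z hzT hz hm
    refine hlate z (hbg.trans_le (hz b₀ hb₀)) ?_
    linarith [hdense 0 z le_rfl hzT hm]

end

/-! ### Tail bounds -/

/-- Chernoff's bound: the indicator is at most `exp(θ(n - x))`, whose expectation is an exponential
series. -/
theorem poissonMeasure_tail (r : NNReal) (x θ : ℝ) (hθ : 0 ≤ θ) :
    poissonMeasure r {n : ℕ | x ≤ n} ≤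
      ENNReal.ofReal (Real.exp (r * (Real.exp θ - 1) - θ * x)) := by
  have h1 : poissonMeasure r {n : ℕ | x ≤ n} ≤
      ∫⁻ n : ℕ, ENNReal.ofReal (Real.exp (θ * (n - x))) ∂(poissonMeasure r) := by
    rw [← lintegral_indicator_one (MeasurableSet.of_discrete)]
    refine lintegral_mono fun n => ?_
    by_cases hn : n ∈ {n : ℕ | x ≤ n}
    · rw [Set.indicator_of_mem hn]
      simp only [Pi.one_apply, ENNReal.one_le_ofReal]
      apply Real.one_le_exp
      have : x ≤ n := hn
      exact mul_nonneg hθ (by linarith)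
    · rw [Set.indicator_of_notMem hn]; exact zero_le
  refine h1.trans (le_of_eq ?_)
  unfold poissonMeasure
  rw [lintegral_sum_measure]
  simp_rw [lintegral_smul_measure, lintegral_dirac, smul_eq_mul]
  have h2 := (NormedSpace.expSeries_div_hasSum_exp ((r : ℝ) * Real.exp θ)).mul_left
    (Real.exp (-r) * Real.exp (-(θ * x)))
  have h3 : ∀ n : ℕ, ENNReal.ofReal (Real.exp (-r) * r ^ n / (n.factorial)) *
      ENNReal.ofReal (Real.exp (θ * (n - x))) = ENNReal.ofReal
      (Real.exp (-r) * Real.exp (-(θ * x)) * (((r : ℝ) * Real.exp θ) ^ n / n.factorial)) := by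
    intro n
    rw [← ENNReal.ofReal_mul (by positivity)]
    congr 1
    have : θ * ((n : ℝ) - x) = n * θ + -(θ * x) := by ring
    rw [this, Real.exp_add, Real.exp_nat_mul, mul_pow]
    ring
  simp_rw [h3]
  rw [← ENNReal.ofReal_tsum_of_nonneg (fun n => by positivity) h2.summable, h2.tsum_eq,
    ← Real.exp_eq_exp_ℝ, ← Real.exp_add, ← Real.exp_add]
  congr 2
  ring

theorem exists_poisson_rate {ρ ε : ℝ} (hρ : 0 ≤ ρ) (hε : 0 < ε) :
    ∃ c > 0, ∀ m : ℕ, poissonMeasure (Real.toNNReal (ρ * m)) {n : ℕ | (ρ + ε) * m ≤ n} ≤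
      ENNReal.ofReal (Real.exp (-c * m)) := by
  -- `θ ≤ 1` gives `exp θ - 1 ≤ θ + θ²`, and the second bound makes the quadratic term at most half
  -- of the gain `θεm`.
  set θ := min 1 (ε / (2 * (ρ + 1)))
  have hθ0 : 0 < θ := lt_min one_pos (by positivity)
  have hθ1 : θ ≤ 1 := min_le_left _ _
  have hθ2 : θ * (2 * (ρ + 1)) ≤ ε := by
    rw [← le_div_iff₀ (by positivity)]; exact min_le_right _ _
  refine ⟨θ * ε / 2, by positivity, fun m => ?_⟩
  refine (poissonMeasure_tail _ _ θ hθ0.le).trans (ENNReal.ofReal_le_ofReal ?_)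
  rw [Real.exp_le_exp, Real.coe_toNNReal _ (by positivity)]
  have h1 : Real.exp θ - 1 ≤ θ + θ ^ 2 := by
    have := (abs_le.1 (Real.abs_exp_sub_one_sub_id_le (x := θ)
      (by rw [abs_of_pos hθ0]; exact hθ1))).2
    linarith
  have hm : (0 : ℝ) ≤ m := m.cast_nonneg
  have h2 : ρ * m * (Real.exp θ - 1) ≤ ρ * m * (θ + θ ^ 2) := by gcongr
  have h3 : ρ * θ ≤ ε / 2 := by nlinarith
  have h4 : (m * θ) * (ρ * θ) ≤ (m * θ) * (ε / 2) := by gcongr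
  nlinarith

/-! ### Concentration for the mining processes and the leaders. -/

section

variable {Ω : Type v} [MeasurableSpace Ω] {μ : Measure Ω}

theorem IsPoissonProcess.count_tail {r : ℝ} {A : Ω → Set ℝ} (hA : IsPoissonProcess μ r A)
    {Δ ε c : ℝ} (hΔ : 0 ≤ Δ)
    (hc : ∀ m : ℕ, poissonMeasure (Real.toNNReal (r * Δ * m)) {n : ℕ | (r * Δ + ε) * m ≤ n} ≤
      ENNReal.ofReal (Real.exp (-c * m))) (a m : ℕ) :
    μ {ω | (r * Δ + ε) * m < count A (a * Δ) ((a + m : ℕ) * Δ) ω} ≤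
      ENNReal.ofReal (Real.exp (-c * m)) := by
  have h0 : (0 : ℝ) ≤ a * Δ := by positivity
  have h1 : (a : ℝ) * Δ ≤ (a + m : ℕ) * Δ := by
    push_cast; nlinarith [mul_nonneg (Nat.cast_nonneg (α := ℝ) m) hΔ]
  have hlaw := hA.law _ _ h0 h1
  have h2 : r * (((a + m : ℕ) : ℝ) * Δ - a * Δ) = r * Δ * m := by push_cast; ring
  rw [h2] at hlaw
  refine le_trans ?_ (hc m)
  rw [← hlaw, Measure.map_apply (hA.measurable_count _ _) MeasurableSet.of_discrete]
  refine measure_mono fun ω hω => ?_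
  have h : (r * Δ + ε) * m < count A (a * Δ) ((a + m : ℕ) * Δ) ω := hω
  exact h.le

theorem measurableSet_converges {r : ℝ} {H : Ω → Set ℝ} (hH : IsPoissonProcess μ r H) (Δ : ℝ)
    (j : ℕ) : MeasurableSet {ω | Converges (H ω) Δ j} := by
  have h : ∀ a b (n : ℕ), MeasurableSet {ω | count H a b ω = n} := fun a b n =>
    hH.measurable_count a b (measurableSet_singleton n)
  exact (h _ _ 0).inter ((h _ _ 1).inter (h _ _ 0))

theorem IsPoissonProcess.count_eq {r : ℝ} {H : Ω → Set ℝ} (hH : IsPoissonProcess μ r H) {Δ : ℝ}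
    (hr : 0 ≤ r) (hΔ : 0 ≤ Δ) (j n : ℕ) :
    μ {ω | count H (j * Δ) ((j + 1 : ℕ) * Δ) ω = n} =
      ENNReal.ofReal (Real.exp (-(r * Δ)) * (r * Δ) ^ n / n.factorial) := by
  have h0 : (0 : ℝ) ≤ j * Δ := by positivity
  have h1 : (j : ℝ) * Δ ≤ (j + 1 : ℕ) * Δ := by push_cast; linarith
  have hlaw := hH.law _ _ h0 h1
  have h2 : r * (((j + 1 : ℕ) : ℝ) * Δ - j * Δ) = r * Δ := by push_cast; ring
  rw [h2] at hlaw
  have := poissonMeasure_singleton (Real.toNNReal (r * Δ)) n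
  rw [← hlaw, Measure.map_apply (hH.measurable_count _ _) (measurableSet_singleton n),
    Real.coe_toNNReal _ (by positivity)] at this
  exact this

/-- Patterns that start three slots apart use disjoint slots, so independent increments factor the
probability. Each pattern contributes the product of the probabilities of counts `0`, `1`, `0`. -/
theorem IsPoissonProcess.converges_inter {r : ℝ} {H : Ω → Set ℝ} (hH : IsPoissonProcess μ r H)
    {Δ : ℝ} (hr : 0 ≤ r) (hΔ : 0 ≤ Δ) (a : ℕ) (F : Finset ℕ) :
    μ (⋂ i ∈ F, {ω | Converges (H ω) Δ (a + 3 * i)}) =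
      ∏ _i ∈ F, ENNReal.ofReal (r * Δ * Real.exp (-3 * (r * Δ))) := by
  have hind := hH.indep_increments (fun j => (j : ℝ) * Δ) (by simp)
    (fun i j hij => mul_le_mul_of_nonneg_right (by exact_mod_cast hij) hΔ)
  have hinj : Function.Injective (fun x : ℕ × Fin 3 => a + 3 * x.1 + x.2.1) := by
    rintro ⟨i, s⟩ ⟨j, t⟩ h
    simp only at h
    have h1 := s.2
    have h2 := t.2
    ext
    · simp; omega
    · simp; omega
  have hind2 := hind.precomp hinj
  let val : Fin 3 → ℕ := fun s => if s = 1 then 1 else 0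
  have hm := hind2.measure_inter_preimage_eq_mul (F ×ˢ Finset.univ)
    (sets := fun x => {val x.2}) (fun _ _ => MeasurableSet.of_discrete)
  rw [Finset.prod_product] at hm
  have hset : (⋂ i ∈ F, {ω | Converges (H ω) Δ (a + 3 * i)}) =
      ⋂ x ∈ F ×ˢ (Finset.univ : Finset (Fin 3)),
        (fun ω => count H (((a + 3 * x.1 + x.2.1 : ℕ) : ℝ) * Δ)
          (((a + 3 * x.1 + x.2.1 + 1 : ℕ) : ℝ) * Δ) ω) ⁻¹' {val x.2} := by
    ext ω
    simp only [Set.mem_iInter, Finset.mem_product, Finset.mem_univ, and_true, Prod.forall,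
      Set.mem_preimage, Set.mem_singleton_iff]
    refine forall_congr' fun i => ?_
    rw [forall_comm]
    refine forall_congr' fun _ => ?_
    rw [Fin.forall_fin_succ, Fin.forall_fin_two]
    rfl
  rw [hset]
  refine hm.trans (Finset.prod_congr rfl fun i _ => ?_)
  rw [Fin.prod_univ_three]
  have key : ∀ s : Fin 3, μ ((fun ω => count H (((a + 3 * i + s.1 : ℕ) : ℝ) * Δ)
      (((a + 3 * i + s.1 + 1 : ℕ) : ℝ) * Δ) ω) ⁻¹' {val s}) =
      ENNReal.ofReal (Real.exp (-(r * Δ)) * (r * Δ) ^ (val s) / (val s).factorial) :=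
    fun s => hH.count_eq hr hΔ _ _
  refine (congrArg₂ (· * ·) (congrArg₂ (· * ·) (key 0) (key 1)) (key 2)).trans ?_
  have hrΔ : 0 ≤ r * Δ := mul_nonneg hr hΔ
  rw [← ENNReal.ofReal_mul (by positivity), ← ENNReal.ofReal_mul (by positivity)]
  congr 1
  have : Real.exp (-3 * (r * Δ)) =
      Real.exp (-(r * Δ)) * Real.exp (-(r * Δ)) * Real.exp (-(r * Δ)) := by
    rw [← Real.exp_add, ← Real.exp_add]; congr 1; ring
  rw [this]
  simp [val]
  ring

-- Hoeffding's inequality for independent indicators; values in an interval of length one give the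
-- rate `2ε²`.
open Classical in
theorem IsPoissonProcess.converges_tail [IsProbabilityMeasure μ] {r : ℝ}
    {H : Ω → Set ℝ} (hH : IsPoissonProcess μ r H)
    {Δ : ℝ} (hr : 0 ≤ r) (hΔ : 0 ≤ Δ) {ε : ℝ} (hε : 0 ≤ ε) (a m : ℕ) :
    μ {ω | (((Finset.range m).filter fun i => Converges (H ω) Δ (a + 3 * i)).card : ℝ) <
        (r * Δ * Real.exp (-3 * (r * Δ)) - ε) * m} ≤
      ENNReal.ofReal (Real.exp (-(2 * ε ^ 2) * m)) := by
  set p := r * Δ * Real.exp (-3 * (r * Δ)) with hp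
  have hp0 : 0 ≤ p := by positivity
  set s : ℕ → Set Ω := fun i => {ω | Converges (H ω) Δ (a + 3 * i)} with hs
  have hsm : ∀ i, MeasurableSet (s i) := fun i => measurableSet_converges hH Δ _
  have hmeas : ∀ i, μ (s i) = ENNReal.ofReal p := by
    intro i
    have := hH.converges_inter hr hΔ a {i}
    rw [Finset.prod_singleton] at this
    simpa only [Finset.mem_singleton, Set.iInter_iInter_eq_left] using this
  have hind : iIndepSet s μ := by
    rw [iIndepSet_iff_meas_biInter hsm]
    intro F
    rw [hH.converges_inter hr hΔ a F]
    exact Finset.prod_congr rfl fun i _ => (hmeas i).symm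
  have hX : iIndepFun (fun i => (s i).indicator (fun _ => (1 : ℝ))) μ := hind.iIndepFun_indicator
  -- The signs are changed to turn the lower tail into an upper tail.
  set Y : ℕ → Ω → ℝ := fun i ω => -((s i).indicator (fun _ => (1 : ℝ)) ω) with hY
  have hYm : ∀ i, Measurable (Y i) := fun i => (measurable_const.indicator (hsm i)).neg
  have hYint : ∀ i, μ[Y i] = -p := by
    intro i
    simp only [hY, integral_neg]
    rw [integral_indicator_const _ (hsm i), measureReal_def, hmeas i,
      ENNReal.toReal_ofReal hp0]
    simp
  have hZ : iIndepFun (fun i ω => Y i ω - μ[Y i]) μ :=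
    hX.comp (fun i (x : ℝ) => -x - ∫ ω, Y i ω ∂μ) (fun i => by fun_prop)
  have hsub : ∀ i < m, HasSubgaussianMGF (fun ω => Y i ω - μ[Y i])
      ((‖(0 : ℝ) - (-1)‖₊ / 2) ^ 2) μ := by
    intro i _
    refine hasSubgaussianMGF_of_mem_Icc (hYm i).aemeasurable (ae_of_all _ fun ω => ?_)
    simp only [hY, Set.indicator_apply]
    split_ifs <;> simp
  rcases Nat.eq_zero_or_pos m with rfl | hm
  · simp
  have hmr : (0 : ℝ) < m := by exact_mod_cast hm
  have hhoeff := HasSubgaussianMGF.measure_sum_range_ge_le_of_iIndepFun hZ hsub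
    (ε := ε * m) (by positivity)
  have hexp : -(ε * m) ^ 2 / (2 * m * (((‖(0 : ℝ) - (-1)‖₊ / 2) ^ 2 : NNReal) : ℝ)) =
      -(2 * ε ^ 2) * m := by
    have : (((‖(0 : ℝ) - (-1)‖₊ / 2) ^ 2 : NNReal) : ℝ) = 1 / 4 := by
      push_cast; norm_num
    rw [this]; field_simp; ring
  rw [hexp] at hhoeff
  rw [← ofReal_measureReal]
  refine ENNReal.ofReal_le_ofReal (le_trans (measureReal_mono fun ω hω => ?_) hhoeff)
  have h1 : (((Finset.range m).filter fun i => Converges (H ω) Δ (a + 3 * i)).card : ℝ) =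
      ∑ i ∈ Finset.range m, (s i).indicator (fun _ => (1 : ℝ)) ω := by
    rw [Finset.card_filter]
    push_cast
    refine Finset.sum_congr rfl fun i _ => ?_
    simp only [hs, Set.indicator_apply, Set.mem_ofPred_eq]
  have h2 : (((Finset.range m).filter fun i => Converges (H ω) Δ (a + 3 * i)).card : ℝ) <
        (p - ε) * m := hω
  rw [h1] at h2
  change ε * m ≤ ∑ i ∈ Finset.range m, (Y i ω - μ[Y i])
  rw [Finset.sum_sub_distrib]
  simp only [hYint, Finset.sum_const, Finset.card_range, nsmul_eq_mul]
  simp only [hY, Finset.sum_neg_distrib]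
  linarith

variable {Node : Type u} {S : Setting Node}

/-- Each leader is corrupted with probability at most `1 / 3`, independently of the others. -/
theorem no_honest_leader_prob
    (hbad : 3 * {i ∈ (S.ckpt : Set Node) | i ∉ S.honest}.ncard < S.ckpt.card)
    {ld : ℕ × ℕ → Ω → S.ckpt}
    (hu : ∀ x i, μ {ω | ld x ω = i} = (S.ckpt.card : ENNReal)⁻¹)
    (hind : iIndepFun (m := fun _ => ⊤) ld μ) (n p M : ℕ) :
    μ {ω | ∀ q, p ≤ q → q < p + M → (ld (n, q) ω : Node) ∉ S.honest} ≤
      ENNReal.ofReal ((1 / 3 : ℝ) ^ M) := by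
  classical
  set bad : Finset S.ckpt := Finset.univ.filter (fun i => (i : Node) ∉ S.honest) with hbaddef
  have hcard : 3 * bad.card ≤ S.ckpt.card := by
    have : {i ∈ (S.ckpt : Set Node) | i ∉ S.honest} = ((bad.map (Function.Embedding.subtype _) :
        Finset Node) : Set Node) := by
      ext i
      simp [hbaddef, and_comm]
    rw [this, Set.ncard_coe_finset, Finset.card_map] at hbad
    exact hbad.le
  have hpos : S.ckpt.card ≠ 0 := by omega
  have hone : ∀ x, μ (ld x ⁻¹' (bad : Set S.ckpt)) ≤ ENNReal.ofReal (1 / 3) := by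
    intro x
    have h1 : ld x ⁻¹' (bad : Set S.ckpt) = ⋃ i ∈ bad, {ω | ld x ω = i} := by
      ext ω; simp
    rw [h1]
    refine (measure_biUnion_finset_le _ _).trans ?_
    simp_rw [hu]
    rw [Finset.sum_const, nsmul_eq_mul]
    have h2 : (bad.card : ENNReal) * (S.ckpt.card : ENNReal)⁻¹ =
        ENNReal.ofReal (bad.card / S.ckpt.card) := by
      rw [ENNReal.ofReal_div_of_pos (by positivity), ENNReal.ofReal_natCast,
        ENNReal.ofReal_natCast, div_eq_mul_inv]
    rw [h2]
    refine ENNReal.ofReal_le_ofReal ?_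
    rw [div_le_iff₀ (by positivity)]
    have : (3 : ℝ) * bad.card ≤ S.ckpt.card := by exact_mod_cast hcard
    linarith
  have hprod := hind.measure_inter_preimage_eq_mul
    ((Finset.range M).image fun i => (n, p + i)) (sets := fun _ => (bad : Set S.ckpt))
    (fun _ _ => trivial)
  rw [Finset.prod_image (fun i _ j _ h => by simpa using h)] at hprod
  calc _ ≤ μ (⋂ x ∈ (Finset.range M).image fun i => (n, p + i), ld x ⁻¹' (bad : Set S.ckpt)) := by
        refine measure_mono fun ω hω => ?_
        simp only [Set.mem_iInter, Finset.mem_image, Finset.mem_range]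
        rintro x ⟨i, hi, rfl⟩
        simpa [hbaddef] using hω (p + i) (by omega) (by omega)
    _ = _ := hprod
    _ ≤ ∏ _i ∈ Finset.range M, ENNReal.ofReal (1 / 3) :=
        Finset.prod_le_prod' fun i _ => hone _
    _ = _ := by
        rw [Finset.prod_const, Finset.card_range, ENNReal.ofReal_pow (by norm_num)]

end

/-! ### Probability of atypical outcomes and choice of parameters. -/

section

variable {Node : Type u} {S : Setting Node} {Ω : Type v} [MeasurableSpace Ω] {μ : Measure Ω}

/-- The atypical outcomes are rare. -/
theorem typical_prob [Fintype Node] [IsProbabilityMeasure μ]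
    {β lam ε cH cA c : ℝ} (hβ : β ≤ 1) (hlam : 0 ≤ lam)
    (hε : 0 ≤ ε) (hΔ : 0 ≤ S.Δ)
    (hbad : 3 * {i ∈ (S.ckpt : Set Node) | i ∉ S.honest}.ncard < S.ckpt.card)
    {H A : Ω → Set ℝ} {ld : ℕ × ℕ → Ω → S.ckpt} (hO : IsOracle μ S β lam H A ld)
    (hH : ∀ m : ℕ, poissonMeasure (Real.toNNReal ((1 - β) * lam * S.Δ * m))
      {n : ℕ | ((1 - β) * lam * S.Δ + ε) * m ≤ n} ≤ ENNReal.ofReal (Real.exp (-cH * m)))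
    (hA : ∀ m : ℕ, poissonMeasure (Real.toNNReal (β * lam * S.Δ * m))
      {n : ℕ | (β * lam * S.Δ + ε) * m ≤ n} ≤ ENNReal.ofReal (Real.exp (-cA * m)))
    (hc0 : 0 ≤ c) (hcH : 4 * c ≤ cH) (hcA : 4 * c ≤ cA) (hcε : 4 * c ≤ 2 * ε ^ 2) (κ b M : ℕ) :
    μ {ω | ¬ Typical S (oracleAt H A ld ω) κ b M (ybar β lam S.Δ - ε) (lam * S.Δ + 2 * ε)} ≤
      ENNReal.ofReal ((b + 1) ^ 2 * (3 * Real.exp (-c * κ) + (1 / 3) ^ M)) := by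
  classical
  set r := (1 - β) * lam with hr
  have hr0 : 0 ≤ r := mul_nonneg (by linarith) hlam
  have hexp : ∀ {d : ℝ} {m : ℕ}, 4 * c ≤ d → κ ≤ 4 * m →
      ENNReal.ofReal (Real.exp (-d * m)) ≤ ENNReal.ofReal (Real.exp (-c * κ)) := by
    intro d m hd hm
    have hm' : (κ : ℝ) ≤ 4 * m := by exact_mod_cast hm
    refine ENNReal.ofReal_le_ofReal (Real.exp_le_exp.2 ?_)
    nlinarith [mul_le_mul_of_nonneg_left hm' hc0,
      mul_le_mul_of_nonneg_right hd (Nat.cast_nonneg (α := ℝ) m)]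
  set few : ℕ → ℕ → Set Ω := fun a m =>
    {ω | (((Finset.range m).filter fun i => Converges (H ω) S.Δ (a + 3 * i)).card : ℝ) <
        (r * S.Δ * Real.exp (-3 * (r * S.Δ)) - ε) * m}
  set manyH : ℕ → ℕ → Set Ω := fun a m =>
    {ω | (r * S.Δ + ε) * m < count H (a * S.Δ) ((a + m : ℕ) * S.Δ) ω}
  set manyA : ℕ → ℕ → Set Ω := fun a m =>
    {ω | (β * lam * S.Δ + ε) * m < count A (a * S.Δ) ((a + m : ℕ) * S.Δ) ω}
  set nolead : ℕ → ℕ → Set Ω := fun n p =>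
    {ω | ∀ q, p ≤ q → q < p + M → (ld (n, q) ω : Node) ∉ S.honest}
  -- The index pair has two roles: first slot and number of slots for mining, iteration and period
  -- for the leaders.
  set Z : ℕ → ℕ → Set Ω := fun a m =>
    (if κ ≤ 4 * m then (few a m ∪ manyH a m) ∪ manyA a m else ∅) ∪ nolead a m with hZ
  have hsub : {ω | ¬ Typical S (oracleAt H A ld ω) κ b M (ybar β lam S.Δ - ε)
      (lam * S.Δ + 2 * ε)} ⊆ ⋃ a ∈ Finset.range (b + 1), ⋃ m ∈ Finset.range (b + 1), Z a m := by
    intro ω hω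
    by_contra hno
    simp only [Set.mem_iUnion, not_exists, Finset.mem_range, Nat.lt_succ_iff] at hno
    refine hω ⟨hO.honest_poisson.locallyFinite ω, hO.adv_poisson.locallyFinite ω, ?_, ?_, ?_⟩
    · intro a m ha hm hκ
      have h := hno a ha m hm
      simp only [hZ, if_pos hκ, Set.mem_union, not_or] at h
      have h1 : ¬ (((Finset.range m).filter fun i => Converges (H ω) S.Δ (a + 3 * i)).card : ℝ) <
        (r * S.Δ * Real.exp (-3 * (r * S.Δ)) - ε) * m := h.1.1.1
      exact not_lt.1 h1
    · intro a m ha hm hκ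
      have h := hno a ha m hm
      simp only [hZ, if_pos hκ, Set.mem_union, not_or] at h
      have h1 : ¬ (r * S.Δ + ε) * m < count H (a * S.Δ) ((a + m : ℕ) * S.Δ) ω := h.1.1.2
      have h2 : ¬ (β * lam * S.Δ + ε) * m < count A (a * S.Δ) ((a + m : ℕ) * S.Δ) ω := h.1.2
      rw [not_lt] at h1 h2
      have h3 : (mined (oracleAt H A ld ω) (a * S.Δ) ((a + m : ℕ) * S.Δ) : ℝ) =
          count H (a * S.Δ) ((a + m : ℕ) * S.Δ) ω + count A (a * S.Δ) ((a + m : ℕ) * S.Δ) ω := by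
        rw [← Nat.cast_add]; rfl
      rw [h3]
      have h4 : (lam * S.Δ + 2 * ε) * m = (r * S.Δ + ε) * m + (β * lam * S.Δ + ε) * m := by
        rw [hr]; ring
      linarith
    · intro n p hn hp
      have h := fun hq : ω ∈ nolead n p => hno n hn p hp (Or.inr hq)
      have h1 : ¬ ∀ q, p ≤ q → q < p + M → (ld (n, q) ω : Node) ∉ S.honest := h
      push Not at h1
      obtain ⟨q, hq1, hq2, hq3⟩ := h1
      exact ⟨q, hq1, hq2, hq3, (ld (n, q) ω).2⟩
  have hZle : ∀ a m, μ (Z a m) ≤ ENNReal.ofReal (3 * Real.exp (-c * κ) + (1 / 3) ^ M) := by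
    intro a m
    rw [ENNReal.ofReal_add (by positivity) (by positivity)]
    refine (measure_union_le _ _).trans (add_le_add ?_
      (no_honest_leader_prob hbad hO.ld_uniform hO.ld_indep a m M))
    split_ifs with hκ
    · have h1 := (hO.honest_poisson.converges_tail hr0 hΔ hε a m).trans (hexp hcε hκ)
      have h2 := (hO.honest_poisson.count_tail hΔ hH a m).trans (hexp hcH hκ)
      have h3 := (hO.adv_poisson.count_tail hΔ hA a m).trans (hexp hcA hκ)
      have h4 : (3 : ℝ) * Real.exp (-c * κ) =
          Real.exp (-c * κ) + Real.exp (-c * κ) + Real.exp (-c * κ) := by ring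
      rw [h4, ENNReal.ofReal_add (by positivity) (by positivity),
        ENNReal.ofReal_add (by positivity) (by positivity)]
      refine (measure_union_le _ _).trans (add_le_add ?_ h3)
      exact (measure_union_le _ _).trans (add_le_add h1 h2)
    · simp
  refine (measure_mono hsub).trans ?_
  calc μ (⋃ a ∈ Finset.range (b + 1), ⋃ m ∈ Finset.range (b + 1), Z a m)
      ≤ ∑ a ∈ Finset.range (b + 1), ∑ m ∈ Finset.range (b + 1), μ (Z a m) :=
        (measure_biUnion_finset_le _ _).trans
          (Finset.sum_le_sum fun a _ => measure_biUnion_finset_le _ _)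
    _ ≤ ∑ _a ∈ Finset.range (b + 1), ∑ _m ∈ Finset.range (b + 1),
          ENNReal.ofReal (3 * Real.exp (-c * κ) + (1 / 3) ^ M) :=
        Finset.sum_le_sum fun a _ => Finset.sum_le_sum fun m _ => hZle a m
    _ = ENNReal.ofReal ((b + 1) ^ 2 * (3 * Real.exp (-c * κ) + (1 / 3) ^ M)) := by
        rw [ENNReal.ofReal_mul (by positivity), Finset.sum_const, Finset.sum_const,
          Finset.card_range, nsmul_eq_mul, nsmul_eq_mul, ← mul_assoc]
        congr 1
        rw [← ENNReal.ofReal_natCast, ← ENNReal.ofReal_mul (by positivity)]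
        congr 1
        push_cast; ring

/-- The parameters of the protocol are suitable as soon as `κ` is large. -/
theorem Suitable.of_large {κ a : ℕ} {γ y ρ K C' T : ℝ} (hγ : 0 < γ) (hy : 0 ≤ y) (hρ : 0 ≤ ρ)
    (hgap : 2 * y - ρ = 3 * γ / 4) (hK1 : 1 ≤ K) (hK2 : 128 / γ ≤ K) (hC1 : 1 ≤ C')
    (hC2 : 16 / γ ≤ C') (hΔ : 0 < S.Δ) (hk : (ρ + 1) * κ ≤ S.k) (he : K * √κ * S.Δ ≤ S.e)
    (hT : T ≤ (κ : ℝ) ^ a) (h28 : 28 ≤ √(κ : ℝ)) (hC : 16 * C' ≤ √(κ : ℝ))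
    (hρκ : 4 * ρ < √(κ : ℝ)) (hΔκ : 1 + 5 * S.Δ ≤ √(κ : ℝ) * S.Δ)
    (hlarge : 2 * (2 * ρ + 14 * y + 150) < γ * √(κ : ℝ)) :
    Suitable S κ (κ ^ (a + 2)) ⌈√(κ : ℝ)⌉₊ y ρ T C' := by
  set x := √(κ : ℝ) with hx
  have hxx : x * x = κ := Real.mul_self_sqrt (Nat.cast_nonneg κ)
  have hx0 : 0 < x := by linarith
  have hκ28 : (28 : ℝ) ≤ κ := by nlinarith
  have hxκ : x ≤ κ := by nlinarith
  have hκn : 28 ≤ κ := by exact_mod_cast hκ28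
  set M := ⌈x⌉₊ with hM
  have hMle : (M : ℝ) ≤ x + 1 := (Nat.ceil_lt_add_one hx0.le).le
  have hM1 : 1 ≤ M := Nat.one_le_iff_ne_zero.2 (Nat.ceil_pos.2 hx0).ne'
  -- The additive constants are absorbed by `√κ ≥ 28`.
  have hM8 : 7 * (M : ℝ) + 19 ≤ 8 * x := by linarith
  have hK0 : 0 < K := by linarith
  have hC0 : 0 < C' := by linarith
  have hKx : 0 < K * x * S.Δ := by positivity
  have hpow : (1 : ℝ) ≤ (κ : ℝ) ^ a := one_le_pow₀ (by linarith)
  have hpown : 1 ≤ κ ^ a := Nat.one_le_pow _ _ (by omega)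
  refine ⟨hy, hρ, hM1, hC1, hκn, ?_, ?_, ?_, ?_, ?_, ?_⟩
  · rw [pow_add]
    nlinarith [Nat.mul_le_mul_right (κ ^ 2) hpown]
  · refine le_trans ?_ he
    nlinarith [mul_le_mul hK1 (show (1 : ℝ) ≤ x by linarith) zero_le_one hK0.le]
  · refine hT.trans ?_
    push_cast
    rw [pow_add]
    have h1 : 1 + 5 * S.Δ ≤ (κ : ℝ) ^ 2 * S.Δ := by
      refine hΔκ.trans (mul_le_mul_of_nonneg_right ?_ hΔ.le)
      nlinarith
    nlinarith [mul_le_mul_of_nonneg_left h1 (zero_le_one.trans hpow),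
      mul_le_mul_of_nonneg_right hpow hΔ.le]
  · nlinarith
  · have h1 : 2 * C' * (7 * M + 8) ≤ 2 * C' * (8 * x) :=
      mul_le_mul_of_nonneg_left (by linarith) (by positivity)
    nlinarith
  · intro len hlen
    have hlen0 : 0 ≤ len := by linarith
    have h1 : (len + 7 * M + 17) * S.Δ / S.e ≤ (len + 8 * x) / (K * x) := by
      rw [div_le_div_iff₀ (hKx.trans_le he) (by positivity)]
      have h2 : (len + 7 * M + 17) * (K * x * S.Δ) ≤ (len + 8 * x) * S.e :=
        mul_le_mul (by linarith) he hKx.le (by positivity)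
      linarith
    have h2 : (7 * M + 19 : ℝ) * ((len + 7 * M + 17) * S.Δ / S.e + 1) ≤
        8 * x * ((len + 8 * x) / (K * x) + 1) :=
      mul_le_mul hM8 (by linarith)
        (by have := hKx.trans_le he; positivity) (by positivity)
    have h3 : 8 * x * ((len + 8 * x) / (K * x) + 1) = 8 * (len / K) + 64 * (x / K) + 8 * x := by
      field_simp
      ring
    have h4 : len / K ≤ γ / 128 * len := by
      rw [div_le_iff₀ hK0]
      rw [div_le_iff₀ hγ] at hK2
      linarith [mul_le_mul_of_nonneg_right hK2 hlen0]
    have h5 : x / K ≤ x := div_le_self hx0.le hK1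
    have h6 : len / C' ≤ γ / 16 * len := by
      rw [div_le_iff₀ hC0]
      rw [div_le_iff₀ hγ] at hC2
      linarith [mul_le_mul_of_nonneg_right hC2 hlen0]
    -- Decisions and early slots each cost at most `γ / 8 * len`, by the lower bounds on `K` and
    -- `C'`. Of the gap `3γ / 4` there remains `γ / 2 * len`, which is at least of order `κ` and
    -- beats all terms of order `√κ`.
    have h7 : 2 * ρ + 14 * y + 6 + 144 * x < γ / 2 * len := by
      have h8 : γ / 2 * (x * x) ≤ γ / 2 * len :=
        mul_le_mul_of_nonneg_left (by linarith) (by positivity)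
      have h9 := mul_lt_mul_of_pos_right hlarge hx0
      have h10 : (2 * ρ + 14 * y + 6) * 1 ≤ (2 * ρ + 14 * y + 6) * x :=
        mul_le_mul_of_nonneg_left (by linarith) (by positivity)
      linarith
    have h8 : 2 * (y * len) - ρ * len = 3 * γ / 4 * len := by rw [← hgap]; ring
    linarith

end

/-- The leader term dominates: `1 / 3 ≤ exp(-1)` bounds it by `exp(-√κ)`, and half of this exponent
pays for the polynomial number of events. -/
theorem eventually_union_bound {c : ℝ} (hc : 0 < c) (a : ℕ) :
    ∀ᶠ κ : ℕ in atTop, (((κ ^ (a + 2) : ℕ) : ℝ) + 1) ^ 2 *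
      (3 * Real.exp (-c * κ) + (1 / 3) ^ ⌈√(κ : ℝ)⌉₊) ≤ Real.exp (-(1 / 2) * √(κ : ℝ)) := by
  have hs : Tendsto (fun κ : ℕ => √(κ : ℝ)) atTop atTop :=
    Real.tendsto_sqrt_atTop.comp tendsto_natCast_atTop_atTop
  have hlim : ∀ᶠ x : ℝ in atTop, 16 * x ^ (4 * a + 8) ≤ Real.exp (1 / 2 * x) := by
    have h := (isLittleO_pow_exp_pos_mul_atTop (4 * a + 8) (show (0 : ℝ) < 1 / 2 by norm_num)).def
      (show (0 : ℝ) < 1 / 16 by norm_num)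
    filter_upwards [h, eventually_ge_atTop 0] with x hx hx0
    rw [Real.norm_of_nonneg (by positivity), Real.norm_of_nonneg (by positivity)] at hx
    linarith
  filter_upwards [hs.eventually hlim, hs.eventually_ge_atTop (1 / c), hs.eventually_ge_atTop 1]
    with κ h1 h2 h3
  set x := √(κ : ℝ) with hx
  have hxx : x * x = κ := Real.mul_self_sqrt (Nat.cast_nonneg κ)
  have hcx : 1 ≤ c * x := by rw [div_le_iff₀ hc] at h2; linarith
  have hA : Real.exp (-c * κ) ≤ Real.exp (-x) := by
    refine Real.exp_le_exp.2 ?_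
    rw [← hxx]; nlinarith
  have hB : (1 / 3 : ℝ) ^ ⌈x⌉₊ ≤ Real.exp (-x) := by
    have h4 : (1 / 3 : ℝ) ≤ Real.exp (-1) := by
      rw [Real.exp_neg, one_div]
      exact inv_anti₀ (Real.exp_pos 1) (Real.exp_one_lt_d9.le.trans (by norm_num))
    calc (1 / 3 : ℝ) ^ ⌈x⌉₊ ≤ Real.exp (-1) ^ ⌈x⌉₊ := pow_le_pow_left₀ (by norm_num) h4 _
      _ = Real.exp (-⌈x⌉₊) := by rw [← Real.exp_nat_mul]; ring_nf
      _ ≤ Real.exp (-x) := Real.exp_le_exp.2 (neg_le_neg (Nat.le_ceil x))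
  have hb : ((κ ^ (a + 2) : ℕ) : ℝ) = x ^ (2 * a + 4) := by
    push_cast
    rw [← hxx, ← pow_two, ← pow_mul]
    congr 1
  have hb1 : (1 : ℝ) ≤ x ^ (2 * a + 4) := one_le_pow₀ h3
  have hsq : (x ^ (2 * a + 4) + 1) ^ 2 ≤ 4 * x ^ (4 * a + 8) := by
    have h5 : x ^ (4 * a + 8) = (x ^ (2 * a + 4)) ^ 2 := by rw [← pow_mul]; congr 1; ring
    rw [h5]; nlinarith
  rw [hb]
  calc (x ^ (2 * a + 4) + 1) ^ 2 * (3 * Real.exp (-c * κ) + (1 / 3) ^ ⌈x⌉₊)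
      ≤ 4 * x ^ (4 * a + 8) * (4 * Real.exp (-x)) :=
        mul_le_mul hsq (by linarith) (by positivity) (by positivity)
    _ = 16 * x ^ (4 * a + 8) * Real.exp (-x) := by ring
    _ ≤ Real.exp (1 / 2 * x) * Real.exp (-x) := by gcongr
    _ = Real.exp (-(1 / 2) * x) := by rw [← Real.exp_add]; congr 1; ring

end CLC

/-! ### Choice of constants and conclusion. -/

theorem mainTheorem2 (β lam Δ : ℝ) (hβ₀ : 0 ≤ β) (hβ : β < 1 / 2) (hlam : 0 < lam) (hΔ : 0 < Δ)
    (hregime : lam * Δ - ybar β lam Δ < ybar β lam Δ) :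
    ∃ C > (0 : ℝ), ∃ c > (0 : ℝ), ∃ K > (0 : ℝ), ∃ K₀ > (0 : ℝ), ∀ a : ℕ, ∃ κ₀ : ℕ,
      ∀ κ : ℕ, κ₀ ≤ κ →
      ∀ (Node : Type u) [Fintype Node] (S : Setting Node),
        S.Δ = Δ →
        K₀ * κ ≤ S.k →
        K * Real.sqrt κ * Δ ≤ S.e →
        3 * {i ∈ (S.ckpt : Set Node) | i ∉ S.honest}.ncard < S.ckpt.card →
      ∀ T : ℝ, T ≤ (κ : ℝ) ^ a →
      ∀ (Ω : Type v) [MeasurableSpace Ω] (μ : Measure Ω) [IsProbabilityMeasure μ]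
        (H A : Ω → Set ℝ) (ld : ℕ × ℕ → Ω → S.ckpt), IsOracle μ S β lam H A ld →
        μ {ω | ∃ R : Run Node, R.Admissible S (oracleAt H A ld ω) ∧
            ¬ (CommonPrefixAfter S R S.k (C * gstSlot S R) T ∧
               ChainQualityAfter S R S.k (C * gstSlot S R) (C * gstSlot S R) T)}
          ≤ ENNReal.ofReal (Real.exp (-c * Real.sqrt κ)) := by
  set γ := 2 * ybar β lam Δ - lam * Δ with hγdef
  have hγ : 0 < γ := by linarith
  have hlΔ : 0 < lam * Δ := mul_pos hlam hΔ
  -- The slack is lost four times in `2 * y - ρ`, so `γ / 16` preserves three quarters of the gap.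
  set ε := γ / 16 with hε
  have hε0 : 0 < ε := by positivity
  set y := ybar β lam Δ - ε with hy
  set ρ := lam * Δ + 2 * ε with hρ
  have hρ0 : 0 < ρ := by positivity
  have hgap : 2 * y - ρ = 3 * γ / 4 := by rw [hy, hρ, hε]; linarith
  have hy0 : 0 ≤ y := by linarith
  obtain ⟨cH, hcH, hH⟩ := exists_poisson_rate (ρ := (1 - β) * lam * Δ) (ε := ε)
    (mul_nonneg (mul_nonneg (by linarith) hlam.le) hΔ.le) hε0
  obtain ⟨cA, hcA, hA⟩ := exists_poisson_rate (ρ := β * lam * Δ) (ε := ε) (by positivity) hε0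
  set c := min (min (cH / 4) (cA / 4)) (ε ^ 2 / 2) with hc
  have hc0 : 0 < c := lt_min (lt_min (by positivity) (by positivity)) (by positivity)
  have hc1 : c ≤ cH / 4 := (min_le_left _ _).trans (min_le_left _ _)
  have hc2 : c ≤ cA / 4 := (min_le_left _ _).trans (min_le_right _ _)
  have hc3 : c ≤ ε ^ 2 / 2 := min_le_right _ _
  set C' := max 1 (16 / γ)
  set K := max 1 (128 / γ)
  have hC' : 1 ≤ C' := le_max_left _ _
  have hK : 1 ≤ K := le_max_left _ _
  refine ⟨2 * C' * (C' + 1), by positivity, 1 / 2, by norm_num, K, by positivity, ρ + 1,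
    by positivity, fun a => ?_⟩
  have hs : Tendsto (fun κ : ℕ => √(κ : ℝ)) atTop atTop :=
    Real.tendsto_sqrt_atTop.comp tendsto_natCast_atTop_atTop
  obtain ⟨κ₀, hκ₀⟩ := eventually_atTop.1 <| (eventually_union_bound hc0 a).and <|
    (hs.eventually_ge_atTop 28).and <| (hs.eventually_ge_atTop (16 * C')).and <|
    (hs.eventually_gt_atTop (4 * ρ)).and <| (hs.eventually_ge_atTop ((1 + 5 * Δ) / Δ)).and <|
    hs.eventually_gt_atTop (2 * (2 * ρ + 14 * y + 150) / γ)
  refine ⟨κ₀, fun κ hκ Node _ S hSΔ hk he hbad T hT Ω _ μ _ H A ld hO => ?_⟩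
  obtain ⟨hunion, h28, h16, h4, h5, h6⟩ := hκ₀ κ hκ
  subst hSΔ
  rw [div_le_iff₀ hΔ] at h5
  rw [div_lt_iff₀ hγ, mul_comm] at h6
  have hP : Suitable S κ (κ ^ (a + 2)) ⌈√(κ : ℝ)⌉₊ y ρ T C' :=
    Suitable.of_large hγ hy0 hρ0.le hgap hK (le_max_right _ _) hC' (le_max_right _ _) hΔ hk he hT
      h28 h16 h4 h5 (by linarith)
  -- The failure event quantifies over runs and need not be measurable; it is only compared, by
  -- monotonicity, with the set of atypical outcomes.
  refine le_trans (measure_mono ?_) ((typical_prob (by linarith) hlam.le hε0.le hΔ.le hbad hO hH hA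
    hc0.le (by linarith) (by linarith) (by linarith) κ (κ ^ (a + 2)) ⌈√(κ : ℝ)⌉₊).trans
    (ENNReal.ofReal_le_ofReal hunion))
  rintro ω ⟨R, hR, hfail⟩ hT'
  exact hfail (hT'.secure hP ⟨hR, hbad, hΔ, hΔ.trans_le hP.Δ_le_e⟩ le_rfl)
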